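/- Let $Q$ be an inner product on $\mathbb{R}^\infty=\bigcup_k\mathbb{R}^k$. For $v\in\mathbb{R}^\infty$ let $Q(v,\cdot)$ be the corresponding linear form on $\mathbb{C}^\infty=\bigcup_k \mathbb{C}^k$. **The space $\Omega$.** Consider germs at $0$ of functions $z\mapsto\sigma(z)$ on $\mathbb{C}^\infty$ (defined away from finitely many hyperplanes $Q(v,z)=0$, $v\neq0$) with values in functions on $[0,\infty)$. A holomorphic germ of symbols of affine order $\alpha(y)=\sum_i \ell_i y_i+c$ ($\ell_i,c\in\mathbb{R}$) is a germ of the form $z\mapsto T(Q(e_0,z),\dots,Q(e_{n-1},z))$, where $(e_i)_{i\ge 0}$ is the standard basis of $\mathbb{R}^\infty$ and, on a polydisc $B$ around $0\in\mathbb{C}^n$: $y\mapsto T(y)(x)$ is holomorphic and $T(\bar y)(x)=\overline{T(y)(x)}$ for all $x\ge0$; $T(y)$ is smooth on $[0,\infty)$; $|\partial_x^kT(y)(x)|\le C_k(1+x)^{\mathrm{Re}\,\alpha(y)-k}$ for $y\in B$, $x\geq 0$; and there are holomorphic $a_j$ on $B$ such that $T(y)(x)\sim\sum_{j\ge0}a_j(y)x^{\alpha(y)-j}$,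 meaning that for all $N,k$, $\big|\partial_x^k\big(T(y)(x)-\sum_{j<N}a_j(y)x^{\alpha(y)-j}\big)\big|\le C_{N,k}\,x^{\mathrm{Re}\,\alpha(y)-N-k}$ for $y\in B$, $x\ge1$. Let $\Omega$ be the real linear span of the quotients of such germs by finite products of linear forms $Q(v,\cdot)$, $v\ne0$, where the order $\alpha$ is nonconstant or, if it is constant, the only powers of $x$ occurring in the expansion have exponents in $\mathbb{Z}_{\ge 0}$. For $\sigma\in\Omega$ let $\mathrm{Dep}(\sigma)\subset\mathbb{R}^\infty$ be the smallest finite-dimensional subspace $V$ such that $\sigma$ depends only on the forms $Q(v,\cdot)$, $v\in V$, and put $\sigma\perp^Q\tau$ if $Q(u,v)=0$ for all $u\in\mathrm{Dep}(\sigma)$, $v\in\mathrm{Dep}(\tau)$. **Summation maps.** For a symbol $f$ on $[0,\infty)$ of order $\alpha$ and $J>\mathrm{Re}\,\alpha+1$ put $$R_J f(x)=\int_1^xf(t)\,dt+\sum_{j=1}^J\frac{B_j}{j!}f^{(j-1)}(x)+\frac{(-1)^J}{J!}\int_0^\infty B_J(\{t\})f^{(J)}(x+t)\,dt,\qquad B_1=\tfrac12,$$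 where $B_J(\cdot)$ are the Bernoulli polynomials (this does not depend on the choice of such a $J$). Put $\mathfrak S_1f(x)=f(1)+R_Jf(x)-R_Jf(1)$ and $\mathfrak S_{-1}f=\mathfrak S_1f-f$; they act on $\Omega$ pointwise in $z$. **Forests.** Let $\mathcal F_{\Omega,\perp^Q}$ be the set of (non-planar) rooted forests, including the empty one, with vertices decorated by elements of $\Omega$ such that the decorations of distinct vertices are independent for $\perp^Q$. Two such forests are independent, $F\top F'$, if each decoration of $F$ is $\perp^Q$ to each decoration of $F'$; two elements of the real span $\mathbb R\mathcal F_{\Omega,\perp^Q}$ are independent if all forests occurring in the one are independent of all forests occurring in the other. Let $B_+^\omega$ be grafting on a root decorated by $\omega$, extended linearly. A (commutative, unital) locality algebra is a real vector space with a symmetric relation $\top$ whose polar sets $U^\top=\{x : u\top x\ \forall u\in U\}$ are subspaces, a bilinear, commutative and associative product defined on independent pairs such that $U^\top$ is closed under products of independent pairs, and a unit independent of everything. A locality algebra homomorphism is a linear map that preserves independence and the products of independent pairs. **Proposition.** Let $\lambda=\pm1$. 1. $(\Omega,\perp^Q)$ with the pointwise product, and $(\mathbb R\mathcal F_{\Omega,\perp^Q},\top)$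 with concatenation, are commutative unital locality algebras. 2. $\mathfrak S_\lambda$ is a linear map $\Omega\to\Omega$ such that $\sigma\perp^Q\tau$ implies $\mathfrak S_\lambda\sigma\perp^Q\tau$, and for $\sigma\in\Omega$ it interpolates sums: for generic $z$ near $0$ and all integers $n\ge1$, $\mathfrak S_1(\sigma(z))(n)=\sum_{k=1}^n\sigma(z)(k)$, respectively $\mathfrak S_{-1}(\sigma(z))(n)=\sum_{k=1}^{n-1}\sigma(z)(k)$. 3. The branched map $\widehat{\mathfrak S_\lambda}$, the linear map defined recursively on forests by $\widehat{\mathfrak S_\lambda}(1)=1$, $\widehat{\mathfrak S_\lambda}(F F')=\widehat{\mathfrak S_\lambda}(F)\,\widehat{\mathfrak S_\lambda}(F')$ and $\widehat{\mathfrak S_\lambda}(B_+^\omega F)=\mathfrak S_\lambda\big(\omega\,\widehat{\mathfrak S_\lambda}(F)\big)$, takes $\mathbb R\mathcal F_{\Omega,\perp^Q}$ to $\Omega$, and $$\widehat{\mathfrak S_\lambda}:(\mathbb R\mathcal F_{\Omega,\perp^Q},\top)\to(\Omega,\perp^Q)$$ is a locality algebra homomorphism. It is the unique unital locality algebra homomorphism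 $f$ between these algebras with $f(B_+^\omega u)=\mathfrak S_\lambda(\omega f(u))$ for all $\omega\in\Omega$ and all $u\in\mathbb R\mathcal F_{\Omega,\perp^Q}$ whose forests have all their decorations independent of $\omega$. -/

import Mathlib

noncomputable section

namespace Locality

/-! ### Locality algebras

All partial products below are restrictions, to the graph of a locality relation, of the product of
an ambient commutative ring `A`; the locality algebra itself is a real subspace `V` of `A`. -/

/-- The polar set `U^⊤` of `U` inside `V`. -/
def polarSet {A : Type*} (V : Set A) (rel : A → A → Prop) (U : Set A) : Set A :=
  {x | x ∈ V ∧ ∀ u ∈ U, rel u x}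

/-- `(V, rel)`, with the product of `A` restricted to the graph of `rel`, is a commutative unital
locality algebra over `ℝ`. (Associativity, commutativity and additivity of the product
are inherited from `A`.) -/
structure IsUnitalLocalityAlgebra {A : Type*} [CommRing A] [Module ℝ A]
    (V : Submodule ℝ A) (rel : A → A → Prop) : Prop where
  symm : ∀ u ∈ V, ∀ v ∈ V, rel u v → rel v u
  polar_subspace : ∀ U : Set A, U ⊆ V → ∃ P : Submodule ℝ A, (P : Set A) = polarSet V rel U
  mul_mem : ∀ u ∈ V, ∀ v ∈ V, rel u v → u * v ∈ V
  mul_mem_polar : ∀ U : Set A, U ⊆ V → ∀ u ∈ polarSet V rel U, ∀ v ∈ polarSet V rel U,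
    rel u v → u * v ∈ polarSet V rel U
  smul_mul : ∀ (r : ℝ), ∀ u ∈ V, ∀ v ∈ V, rel u v → (r • u) * v = r • (u * v)
  one_mem : (1 : A) ∈ V
  one_rel : ∀ u ∈ V, rel 1 u

/-- A linear map `f : V → W` is a locality algebra homomorphism `(V, relV) → (W, relW)`. -/
structure IsLocalityAlgHom {A B : Type*} [CommRing A] [Module ℝ A] [CommRing B] [Module ℝ B]
    {V : Submodule ℝ A} {W : Submodule ℝ B} (relV : A → A → Prop) (relW : B → B → Prop)
    (f : V →ₗ[ℝ] W) : Prop where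
  map_rel : ∀ u v : V, relV u v → relW (f u) (f v)
  map_mul : ∀ (u v : V), relV u v → ∀ huv : (u : A) * (v : A) ∈ V,
    (f ⟨(u : A) * (v : A), huv⟩ : B) = (f u : B) * (f v : B)

/-! ### Decorated rooted forests -/

/-- Planar rooted forests with vertices decorated by `D`: either empty, or a first tree, with root
decorated by `d` and forest of branches `c`, followed by the remaining forest `r`. -/
inductive PlanarForest (D : Type*) where
  | nil : PlanarForest D
  | cons (d : D) (c r : PlanarForest D) : PlanarForest D

namespace PlanarForest

variable {D : Type*}

/-- Two planar forests are equivalent if they differ by permutations of trees, at all levels;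
a non-planar forest is an equivalence class. -/
inductive Equivalent : PlanarForest D → PlanarForest D → Prop where
  | refl (F : PlanarForest D) : Equivalent F F
  | symm {F G : PlanarForest D} : Equivalent F G → Equivalent G F
  | trans {F G H : PlanarForest D} : Equivalent F G → Equivalent G H → Equivalent F H
  | swap (a b : D) (c d r : PlanarForest D) :
      Equivalent (cons a c (cons b d r)) (cons b d (cons a c r))
  | congr (a : D) {c c' r r' : PlanarForest D} : Equivalent c c' → Equivalent r r' →
      Equivalent (cons a c r) (cons a c' r')

/-- Concatenation. -/
def append : PlanarForest D → PlanarForest D → PlanarForest D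
  | nil, G => G
  | cons a c r, G => cons a c (append r G)

/-- The multiset of the decorations of the vertices. -/
def decorations : PlanarForest D → Multiset D
  | nil => 0
  | cons a c r => a ::ₘ (decorations c + decorations r)

/-- The map to a commutative monoid `M` with operations `β a : M → M`, `a ∈ D`, that sends
concatenation to product and grafting on a root decorated by `a` to `β a`. -/
def lift {M : Type*} [CommMonoid M] (β : D → M → M) : PlanarForest D → M
  | nil => 1
  | cons a c r => β a (lift β c) * lift β r

instance setoid : Setoid (PlanarForest D) where
  r := Equivalent
  iseqv := ⟨Equivalent.refl, Equivalent.symm, Equivalent.trans⟩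

theorem append_nil (F : PlanarForest D) : append F nil = F := by
  induction F with
  | nil => rfl
  | cons a c r _ ihr => simp only [append, ihr]

theorem append_assoc (F G H : PlanarForest D) :
    append (append F G) H = append F (append G H) := by
  induction F with
  | nil => rfl
  | cons a c r _ ihr => simp only [append, ihr]

theorem append_right {G G' : PlanarForest D} (F : PlanarForest D) (h : Equivalent G G') :
    Equivalent (append F G) (append F G') := by
  induction F with
  | nil => exact h
  | cons a c r _ ihr => exact .congr a (.refl c) ihr

theorem append_left {F F' : PlanarForest D} (h : Equivalent F F') (G : PlanarForest D) :
    Equivalent (append F G) (append F' G) := by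
  induction h with
  | refl F => exact .refl _
  | symm _ ih => exact .symm ih
  | trans _ _ ih₁ ih₂ => exact .trans ih₁ ih₂
  | swap a b c d r => exact .swap a b c d _
  | congr a h _ _ ih => exact .congr a h ih

theorem append_cons (F : PlanarForest D) (a : D) (c r : PlanarForest D) :
    Equivalent (append F (cons a c r)) (cons a c (append F r)) := by
  induction F with
  | nil => exact .refl _
  | cons b d s _ ihs => exact .trans (.congr b (.refl d) ihs) (.swap b a d c _)

theorem append_comm (F G : PlanarForest D) : Equivalent (append F G) (append G F) := by
  induction F with
  | nil => rw [append_nil]; exact .refl _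
  | cons a c r _ ihr => exact .trans (.congr a (.refl c) ihr) (.symm (append_cons G a c r))

theorem decorations_eq {F G : PlanarForest D} (h : Equivalent F G) :
    decorations F = decorations G := by
  induction h with
  | refl F => rfl
  | symm _ ih => exact ih.symm
  | trans _ _ ih₁ ih₂ => exact ih₁.trans ih₂
  | swap a b c d r =>
    simp only [decorations, Multiset.add_cons, Multiset.cons_swap a b]
    rw [add_left_comm]
  | congr a _ _ ih₁ ih₂ => simp only [decorations, ih₁, ih₂]

theorem lift_eq {M : Type*} [CommMonoid M] (β : D → M → M) {F G : PlanarForest D}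
    (h : Equivalent F G) : lift β F = lift β G := by
  induction h with
  | refl F => rfl
  | symm _ ih => exact ih.symm
  | trans _ _ ih₁ ih₂ => exact ih₁.trans ih₂
  | swap a b c d r => simp only [lift, mul_left_comm]
  | congr a _ _ ih₁ ih₂ => simp only [lift, ih₁, ih₂]

end PlanarForest

/-- (Non-planar) rooted forests with vertices decorated by `D`, including the empty forest. -/
def Forest (D : Type*) : Type _ := Quotient (PlanarForest.setoid (D := D))

namespace Forest

variable {D : Type*}

/-- Forests form a commutative monoid for concatenation, with the empty forest as unit. -/
instance commMonoid : CommMonoid (Forest D) where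
  mul := Quotient.map₂ PlanarForest.append fun _ F' hF G _ hG =>
    (PlanarForest.append_left hF G).trans (PlanarForest.append_right F' hG)
  one := Quotient.mk _ PlanarForest.nil
  mul_assoc := by
    rintro ⟨F⟩ ⟨G⟩ ⟨H⟩
    exact congrArg (Quotient.mk _) (PlanarForest.append_assoc F G H)
  one_mul := by rintro ⟨F⟩; rfl
  mul_one := by
    rintro ⟨F⟩
    exact congrArg (Quotient.mk _) (PlanarForest.append_nil F)
  mul_comm := by
    rintro ⟨F⟩ ⟨G⟩
    exact Quotient.sound (PlanarForest.append_comm F G)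

/-- The grafting operator `B_+^a`: the tree with root decorated by `a` and branches `F`. -/
def graft (a : D) : Forest D → Forest D :=
  Quotient.map (fun F => PlanarForest.cons a F PlanarForest.nil)
    fun _ _ h => PlanarForest.Equivalent.congr a h (.refl _)

/-- The multiset `{d(v) : v ∈ V(F)}`. -/
def decorations : Forest D → Multiset D :=
  Quotient.lift PlanarForest.decorations fun _ _ h => PlanarForest.decorations_eq h

/-- The map to a commutative monoid `M` with operations `β a : M → M`, `a ∈ D`, determined by
`1 ↦ 1`, `F G ↦ lift F * lift G` and `B_+^a F ↦ β a (lift F)`. -/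
def lift {M : Type*} [CommMonoid M] (β : D → M → M) : Forest D → M :=
  Quotient.lift (PlanarForest.lift β) fun _ _ h => PlanarForest.lift_eq β h

/-- Decorations of distinct vertices are independent. -/
def IsProper (rel : D → D → Prop) (F : Forest D) : Prop :=
  ∀ a b : D, {a, b} ≤ F.decorations → rel a b

/-- Independence of forests: all decorations of `F` are independent of all those of `G`. -/
def Indep (rel : D → D → Prop) (F G : Forest D) : Prop :=
  ∀ a ∈ F.decorations, ∀ b ∈ G.decorations, rel a b

end Forest

/-- The real vector space `ℝ𝓕_{D,⊤}` spanned by the properly decorated forests, as a subspace of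
the algebra of all decorated forests. -/
def properForests {D : Type*} (rel : D → D → Prop) : Submodule ℝ (MonoidAlgebra ℝ (Forest D)) :=
  Submodule.span ℝ {u | ∃ F : Forest D, F.IsProper rel ∧ u = MonoidAlgebra.single F 1}

/-- The locality relation on linear combinations of forests. -/
def forestRel {D : Type*} (rel : D → D → Prop) (u v : MonoidAlgebra ℝ (Forest D)) : Prop :=
  ∀ F ∈ u.coeff.support, ∀ G ∈ v.coeff.support, F.Indep rel G

/-- The decoration `a` is independent of the linear combination `u` of forests. -/
def actRel {D : Type*} (rel : D → D → Prop) (a : D) (u : MonoidAlgebra ℝ (Forest D)) : Prop :=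
  ∀ F ∈ u.coeff.support, ∀ b ∈ F.decorations, rel a b

/-- The linear extension of the grafting operator `B_+^a`. -/
def graftLin {D : Type*} (a : D) : MonoidAlgebra ℝ (Forest D) →ₗ[ℝ] MonoidAlgebra ℝ (Forest D) :=
  MonoidAlgebra.mapDomainLinearMap ℝ ℝ (Forest.graft a)

/-- Let `(W, relW)` be a subspace of `B` with a locality relation, on which decorations `a : D` act
by `β a`. A linear map `f : ℝ𝓕_{D,⊤} → W` is a morphism of operated (unital) locality algebras. -/
structure IsOperatedMorphism {D B : Type*} [CommRing B] [Module ℝ B] {W : Submodule ℝ B}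
    (rel : D → D → Prop) (relW : B → B → Prop) (β : D → B → B)
    (f : properForests rel →ₗ[ℝ] W) : Prop extends
    IsLocalityAlgHom (forestRel rel) relW f where
  map_one : ∀ h1 : (1 : MonoidAlgebra ℝ (Forest D)) ∈ properForests rel, (f ⟨1, h1⟩ : B) = 1
  map_graft : ∀ (a : D) (u : properForests rel), actRel rel a u →
    ∀ hu : graftLin a (u : MonoidAlgebra ℝ (Forest D)) ∈ properForests rel,
      (f ⟨graftLin a u, hu⟩ : B) = β a (f u)

/-! ### Meromorphic germs of symbols with linear poles

`ℝ^∞` is `ℕ →₀ ℝ`, `ℂ^∞ = ℝ^∞ ⊗ ℂ` is `ℕ →₀ ℂ`, and `Q` is an inner product on `ℝ^∞`. -/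

/-- The linear form `Q(v, ·)` on `ℂ^∞` defined by `v ∈ ℝ^∞`. -/
def linForm (Q : LinearMap.BilinForm ℝ (ℕ →₀ ℝ)) (v : ℕ →₀ ℝ) (z : ℕ →₀ ℂ) : ℂ :=
  z.sum fun i w => (Q v (Finsupp.single i 1) : ℂ) * w

/-- The map `ℂ^∞ → ℂ^n` with components `Q(e_i, ·)`, `i < n`, that is, the `Q`-orthogonal projection
onto `ℂ^n` followed by the isomorphism of `ℂ^n` with its dual defined by `Q`. Pulling back by it
identifies germs on `ℂ^n` with elements of the direct limit over `n` of the germs on `ℂ^n`. -/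
def coords (Q : LinearMap.BilinForm ℝ (ℕ →₀ ℝ)) (n : ℕ) (z : ℕ →₀ ℂ) : Fin n → ℂ :=
  fun i => linForm Q (Finsupp.single (i : ℕ) 1) z

/-- Generic points of `ℂ^∞` close to `0`: finitely many linear forms are small, and
finitely many nonzero linear forms do not vanish. -/
def genericNhds (Q : LinearMap.BilinForm ℝ (ℕ →₀ ℝ)) : Filter (ℕ →₀ ℂ) :=
  (⨅ v : ℕ →₀ ℝ, Filter.comap (linForm Q v) (nhds 0)) ⊓
    ⨅ v : {v : ℕ →₀ ℝ // v ≠ 0}, Filter.principal {z | linForm Q v z ≠ 0}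

/-- The ring of germs at `0`, defined away from finitely many hyperplanes, of functions on `ℂ^∞` with
values in the functions on `[0, ∞)`, with the pointwise operations. -/
abbrev FunGerm (Q : LinearMap.BilinForm ℝ (ℕ →₀ ℝ)) : Type :=
  (genericNhds Q).Germ (NNReal → ℂ)

/-- A function on `[0, ∞)` as a function on `ℝ`; only its values on `[0, ∞)` matter. -/
def ext (f : NNReal → ℂ) (t : ℝ) : ℂ := f t.toNNReal

/-- The `k`-th derivative of a function on `[0, ∞)`. -/
def dx (k : ℕ) (f : NNReal → ℂ) (t : ℝ) : ℂ := iteratedDerivWithin k (ext f) (Set.Ici 0) t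

/-- The affine function `y ↦ ∑ ℓ_i y_i + c`. -/
def affineOrder {n : ℕ} (ℓ : Fin n → ℝ) (c : ℝ) (y : Fin n → ℂ) : ℂ :=
  (∑ i, (ℓ i : ℂ) * y i) + (c : ℂ)

/-- `T` is a holomorphic family, with real coefficients, on the polydisc of radius `r` of
polyhomogeneous symbols on `[0, ∞)` of affine order `α(y) = ∑ ℓ_i y_i + c`, with asymptotic expansion
`T y x ∼ ∑ a_j(y) x ^ (α(y) - j)`. -/
structure IsHolSymbolFamily {n : ℕ} (r : ℝ) (ℓ : Fin n → ℝ) (c : ℝ) (a : ℕ → (Fin n → ℂ) → ℂ)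
    (T : (Fin n → ℂ) → NNReal → ℂ) : Prop where
  holomorphic : ∀ x, DifferentiableOn ℂ (fun y => T y x) (Metric.ball 0 r)
  holomorphic_coeff : ∀ j, DifferentiableOn ℂ (a j) (Metric.ball 0 r)
  real_coeff : ∀ y ∈ Metric.ball (0 : Fin n → ℂ) r, ∀ x, T (star y) x = star (T y x)
  smooth : ∀ y ∈ Metric.ball (0 : Fin n → ℂ) r,
    ContDiffOn ℝ ((⊤ : ℕ∞) : WithTop ℕ∞) (ext (T y)) (Set.Ici 0)
  symbol : ∀ k : ℕ, ∃ C : ℝ, ∀ y ∈ Metric.ball (0 : Fin n → ℂ) r, ∀ x : ℝ, 0 ≤ x →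
    ‖dx k (T y) x‖ ≤ C * (1 + x) ^ ((affineOrder ℓ c y).re - k)
  asymptotic : ∀ N k : ℕ, ∃ C : ℝ, ∀ y ∈ Metric.ball (0 : Fin n → ℂ) r, ∀ x : ℝ, 1 ≤ x →
    ‖iteratedDeriv k (fun t : ℝ => ext (T y) t -
        ∑ j ∈ Finset.range N, a j y * (t : ℂ) ^ (affineOrder ℓ c y - j)) x‖
      ≤ C * x ^ ((affineOrder ℓ c y).re - N - k)

/-- Meromorphic germs of polyhomogeneous symbols, with linear poles and real coefficients, of
affine order `α`: quotients of a holomorphic family by a product of nonzero linear forms. Either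
`α` is nonconstant, or it is constant and the only powers of `x` that occur in the asymptotic
expansion are those with exponent a natural number. -/
def simpleGerms (Q : LinearMap.BilinForm ℝ (ℕ →₀ ℝ)) : Set (FunGerm Q) :=
  {σ | ∃ (n : ℕ) (r : ℝ) (ℓ : Fin n → ℝ) (c : ℝ) (a : ℕ → (Fin n → ℂ) → ℂ)
      (T : (Fin n → ℂ) → NNReal → ℂ) (w : List (ℕ →₀ ℝ)),
    0 < r ∧ IsHolSymbolFamily r ℓ c a T ∧ (∀ v ∈ w, v ≠ 0) ∧
    (ℓ ≠ 0 ∨ ∀ j : ℕ, (∀ m : ℕ, c - j ≠ m) → ∀ y ∈ Metric.ball (0 : Fin n → ℂ) r, a j y = 0) ∧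
    σ = ((fun z x => ((w.map fun v => linForm Q v z).prod)⁻¹ * T (coords Q n z) x :
      (ℕ →₀ ℂ) → NNReal → ℂ) : FunGerm Q)}

/-- The space `Ω` of multivariate meromorphic germs of symbols on `[0, ∞)`. -/
def symbolGerms (Q : LinearMap.BilinForm ℝ (ℕ →₀ ℝ)) : Submodule ℝ (FunGerm Q) :=
  Submodule.span ℝ (simpleGerms Q)

/-- The germ `σ` depends only on the linear forms `Q(v, ·)`, `v ∈ V`. -/
def DependsOn (Q : LinearMap.BilinForm ℝ (ℕ →₀ ℝ)) (σ : FunGerm Q) (V : Submodule ℝ (ℕ →₀ ℝ)) :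
    Prop :=
  ∃ s : (ℕ →₀ ℂ) → NNReal → ℂ, σ = (s : FunGerm Q) ∧
    ∀ z z' : ℕ →₀ ℂ, (∀ v ∈ V, linForm Q v z = linForm Q v z') → s z = s z'

/-- The dependence space `Dep(σ)`: the smallest finite-dimensional subspace on which `σ` depends
(linear forms `Q(v, ·)` are identified with vectors `v`). -/
def dep (Q : LinearMap.BilinForm ℝ (ℕ →₀ ℝ)) (σ : FunGerm Q) : Submodule ℝ (ℕ →₀ ℝ) :=
  sInf {V | FiniteDimensional ℝ V ∧ DependsOn Q σ V}

/-- The locality relation `⊥^Q`. -/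
def perp (Q : LinearMap.BilinForm ℝ (ℕ →₀ ℝ)) (σ τ : FunGerm Q) : Prop :=
  ∀ u ∈ dep Q σ, ∀ v ∈ dep Q τ, Q u v = 0

/-- `⊥^Q` restricted to `Ω`. -/
def perpΩ (Q : LinearMap.BilinForm ℝ (ℕ →₀ ℝ)) (σ τ : symbolGerms Q) : Prop :=
  perp Q σ τ

/-! ### The interpolated summation maps -/

/-- The Euler-MacLaurin sum of level `J`:
`∫_1^x f + ∑_{j=1}^J B_j / j! f^{(j-1)}(x) + (-1)^J / J! ∫_0^∞ B_J({t}) f^{(J)}(x + t) dt`,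
with `B_1 = 1/2`. For a symbol `f` of order `< J - 1` the integrals converge,
the value does not depend on `J`, and its difference between `x` and `x + 1` is `f (x + 1)`. -/
def eulerMaclaurin (J : ℕ) (f : NNReal → ℂ) (x : ℝ) : ℂ :=
  (∫ t in (1 : ℝ)..x, ext f t) +
    (∑ j ∈ Finset.range J, ((bernoulli' (j + 1) : ℚ) : ℂ) / ((j + 1).factorial : ℂ) * dx j f x) +
    (-1) ^ J / (J.factorial : ℂ) *
      ∫ t in Set.Ioi (0 : ℝ), ((bernoulliFun J (Int.fract t) : ℝ) : ℂ) * dx J f (x + t)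

/-- The interpolation `𝔖_1 f` of `n ↦ ∑_{k=1}^n f k` by the Euler-MacLaurin formula; the
limit is over an eventually constant sequence if `f` is a symbol. -/
def sumOne (f : NNReal → ℂ) (x : NNReal) : ℂ :=
  f 1 + Filter.limUnder Filter.atTop fun J : ℕ => eulerMaclaurin J f x - eulerMaclaurin J f 1

/-- `𝔖_λ` on functions, for `λ = 1` (interpolating `n ↦ ∑_{k=1}^n f k`) and for `λ = -1`
(interpolating `n ↦ ∑_{k=1}^{n-1} f k`). -/
def summation (lam : ℤ) (f : NNReal → ℂ) : NNReal → ℂ :=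
  if lam = 1 then sumOne f else sumOne f - f

/-- The sum interpolated by `𝔖_λ f` at the positive integer `n`. -/
def discreteSum (lam : ℤ) (f : NNReal → ℂ) (n : ℕ) : ℂ :=
  if lam = 1 then ∑ k ∈ Finset.Icc 1 n, f k else ∑ k ∈ Finset.Ico 1 n, f k

/-- `𝔖_λ` on germs of families, pointwise in the parameter `z`. -/
def summationGerm (Q : LinearMap.BilinForm ℝ (ℕ →₀ ℝ)) (lam : ℤ) : FunGerm Q → FunGerm Q :=
  Filter.Germ.map (summation lam)

/-- The action `β^ω(u) = 𝔖_λ(ω u)` of `ω ∈ Ω` induced by `𝔖_λ`. -/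
def summationAction (Q : LinearMap.BilinForm ℝ (ℕ →₀ ℝ)) (lam : ℤ) (ω : symbolGerms Q)
    (u : FunGerm Q) : FunGerm Q :=
  summationGerm Q lam (ω * u)

end Locality

end

/-! The algebraic half is formal. All products are taken in the ambient ring of germs, so the
branched map is defined on every decorated forest, and the question is why it lands in Ω on the
proper ones. By induction on forests, the image of `F` lies in Ω and is independent of every germ
that is independent of all decorations of `F` (`lift_mem`). The second assertion makes `ω` times the
image of `F` a product of independent germs. It uses only that Ω is a locality algebra and that the
summation map preserves Ω and independence. Uniqueness holds because concatenation and grafting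
generate all forests (`exists_branched`).

Dependence spaces behave well because a germ that depends only on the forms in `V₁`, and only on
those in `V₂`, depends only on those in the intersection (`DependsOn.inf`). Hence `dep` is attained,
pointwise operations do not enlarge it, and independence from a fixed germ is a linear condition.

Ω is stable under summation by the Euler-MacLaurin formula (`map_sumOne_mem`). Derivatives and
remainder preserve polyhomogeneity; the primitive of `x ^ (α - j)` divides by `α + 1 - j`. Near `0`
this factor is invertible, except for at most one `j`, where it is the linear part of `α` and gives
a new linear pole. If `α` is constant, the exponent `-1` is excluded by integrality. The constant of
integration is a germ that does not depend on `x`, and it is split off as a germ of order `0`.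

Ω is closed under products of independent germs (`mul_mem_symbolGerms`). The danger is that two
nonconstant orders add up to a constant one with nonintegral exponents. A germ depending only on the
forms in `V` can be written with orders whose linear part lies in `V` (`mem_spanIn`): moving the
parameter orthogonally to `V` does not change the germ, but it changes the exponents of any term
whose order is outside `V`, so by uniqueness of asymptotic expansions these terms have zero
expansion and may be regarded as having order `0`. Two orthogonal spaces meet in `0` since `Q` is
positive definite, so linear parts cancel only if both vanish. -/

noncomputable section

namespace Locality

/-! ### Linear combinations of forests -/

section Supported

variable {X : Type*}

/-- The linear combinations of elements of `X` all of which satisfy `P`. -/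
def supportedIn (P : X → Prop) : Submodule ℝ (MonoidAlgebra ℝ X) where
  carrier := {u | ∀ F ∈ u.coeff.support, P F}
  zero_mem' := by simp
  add_mem' := by
    classical
    intro u v hu hv F hF
    rcases Finset.mem_union.1 (Finsupp.support_add hF) with h | h
    exacts [hu F h, hv F h]
  smul_mem' := fun r u hu F hF => hu F (Finsupp.support_smul hF)

theorem mem_supportedIn {P : X → Prop} {u : MonoidAlgebra ℝ X} :
    u ∈ supportedIn P ↔ ∀ F ∈ u.coeff.support, P F := Iff.rfl

theorem single_mem_supportedIn {P : X → Prop} {F : X} {r : ℝ} (hF : P F) :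
    MonoidAlgebra.single F r ∈ supportedIn P := by
  intro G hG
  have : G = F := Finset.mem_singleton.1 (Finsupp.support_single_subset hG)
  exact this ▸ hF

theorem supportedIn_eq_span (P : X → Prop) :
    supportedIn P = Submodule.span ℝ {u | ∃ F : X, P F ∧ u = MonoidAlgebra.single F 1} := by
  apply le_antisymm
  · intro u hu
    rw [← MonoidAlgebra.sum_coeff_single u]
    refine Submodule.sum_mem _ fun F hF => ?_
    have : MonoidAlgebra.single F (u.coeff F) =
        u.coeff F • (MonoidAlgebra.single F 1 : MonoidAlgebra ℝ X) := by simp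
    rw [this]
    exact Submodule.smul_mem _ _ (Submodule.subset_span ⟨F, hu F hF, rfl⟩)
  · rw [Submodule.span_le]
    rintro _ ⟨F, hF, rfl⟩
    exact single_mem_supportedIn hF

/-- Span induction carrying the membership proof along. It reduces statements that are linear in `u`
to single elements of `X`, also when the statement itself needs `u` to be admissible. -/
theorem supportedIn_induction {P : X → Prop}
    {motive : (u : MonoidAlgebra ℝ X) → u ∈ supportedIn P → Prop}
    (single : ∀ F (hF : P F), motive (MonoidAlgebra.single F 1) (single_mem_supportedIn hF))
    (zero : motive 0 (Submodule.zero_mem _))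
    (add : ∀ u v hu hv, motive u hu → motive v hv → motive (u + v) (Submodule.add_mem _ hu hv))
    (smul : ∀ (r : ℝ) u hu, motive u hu → motive (r • u) (Submodule.smul_mem _ r hu))
    (u : MonoidAlgebra ℝ X) (hu : u ∈ supportedIn P) : motive u hu := by
  have hu' := hu
  rw [supportedIn_eq_span] at hu'
  suffices h : ∃ h, motive u h from h.2
  induction hu' using Submodule.span_induction with
  | mem x h => obtain ⟨F, hF, rfl⟩ := h; exact ⟨_, single F hF⟩
  | zero => exact ⟨_, zero⟩
  | add x y hx hy ihx ihy =>
    rw [← supportedIn_eq_span] at hx hy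
    exact ⟨_, add x y hx hy (ihx hx).2 (ihy hy).2⟩
  | smul a x hx ih =>
    rw [← supportedIn_eq_span] at hx
    exact ⟨_, smul a x hx (ih hx).2⟩

theorem mul_mem_supportedIn [CommMonoid X] {P₁ P₂ P₃ : X → Prop} {u v : MonoidAlgebra ℝ X}
    (hu : u ∈ supportedIn P₁) (hv : v ∈ supportedIn P₂)
    (h : ∀ F G, P₁ F → P₂ G → P₃ (F * G)) : u * v ∈ supportedIn P₃ := by
  induction u, hu using supportedIn_induction with
  | single F hF =>
    induction v, hv using supportedIn_induction with
    | single G hG =>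
      rw [MonoidAlgebra.single_mul_single]
      exact single_mem_supportedIn (h F G hF hG)
    | zero => simp
    | add u v _ _ hu hv => rw [mul_add]; exact Submodule.add_mem _ hu hv
    | smul r u _ hu => rw [mul_smul_comm]; exact Submodule.smul_mem _ _ hu
  | zero => simp
  | add u v _ _ hu hv => rw [add_mul]; exact Submodule.add_mem _ hu hv
  | smul r u _ hu => rw [smul_mul_assoc]; exact Submodule.smul_mem _ _ hu

end Supported

namespace Forest

variable {D : Type*}

@[simp] theorem decorations_one : (1 : Forest D).decorations = 0 := rfl

theorem decorations_mul (F G : Forest D) :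
    (F * G).decorations = F.decorations + G.decorations := by
  induction F using Quotient.inductionOn
  induction G using Quotient.inductionOn
  rename_i F G
  change (PlanarForest.append F G).decorations = F.decorations + G.decorations
  induction F with
  | nil => simp [PlanarForest.append, PlanarForest.decorations]
  | cons a c r _ ihr => simp [PlanarForest.append, PlanarForest.decorations, ihr, add_assoc]

theorem decorations_graft (a : D) (F : Forest D) :
    (F.graft a).decorations = a ::ₘ F.decorations := by
  induction F using Quotient.inductionOn
  rename_i F
  change PlanarForest.decorations _ = a ::ₘ PlanarForest.decorations F
  simp [PlanarForest.decorations]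

theorem lift_one {M : Type*} [CommMonoid M] (β : D → M → M) : (1 : Forest D).lift β = 1 := rfl

theorem lift_mul {M : Type*} [CommMonoid M] (β : D → M → M) (F G : Forest D) :
    (F * G).lift β = F.lift β * G.lift β := by
  induction F using Quotient.inductionOn
  induction G using Quotient.inductionOn
  rename_i F G
  change (PlanarForest.append F G).lift β = F.lift β * G.lift β
  induction F with
  | nil => simp [PlanarForest.append, PlanarForest.lift]
  | cons a c r _ ihr => simp [PlanarForest.append, PlanarForest.lift, ihr, mul_assoc]

theorem lift_graft {M : Type*} [CommMonoid M] (β : D → M → M) (a : D) (F : Forest D) :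
    (F.graft a).lift β = β a (F.lift β) := by
  induction F using Quotient.inductionOn
  rename_i F
  change PlanarForest.lift β _ = β a (PlanarForest.lift β F)
  simp [PlanarForest.lift]

/-- Induction on forests: every nonempty forest is a product of a grafted forest and a forest. -/
theorem induction {motive : Forest D → Prop} (one : motive 1)
    (graft_mul : ∀ a c r, motive c → motive r → motive (graft a c * r)) (F : Forest D) :
    motive F := by
  induction F using Quotient.inductionOn
  rename_i F
  induction F with
  | nil => exact one
  | cons a c r ihc ihr => exact graft_mul a _ _ ihc ihr

theorem decorations_graft_mul (a : D) (c r : Forest D) :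
    (graft a c * r).decorations = a ::ₘ (c.decorations + r.decorations) := by
  rw [decorations_mul, decorations_graft, Multiset.cons_add]

variable {rel : D → D → Prop}

theorem IsProper.of_le {F G : Forest D} (hF : F.IsProper rel)
    (h : G.decorations ≤ F.decorations) : G.IsProper rel :=
  fun a b hab => hF a b (hab.trans h)

theorem isProper_one : (1 : Forest D).IsProper rel := by
  intro a b h
  simp at h

theorem pair_le_of_mem {a b : D} {s t : Multiset D} (ha : a ∈ s) (hb : b ∈ t) :
    ({a, b} : Multiset D) ≤ s + t := by
  change ({a} : Multiset D) + {b} ≤ s + t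
  exact add_le_add (Multiset.singleton_le.2 ha) (Multiset.singleton_le.2 hb)

theorem IsProper.indep {F G : Forest D} (h : (F * G).IsProper rel) : F.Indep rel G :=
  fun a ha b hb => h a b (by rw [decorations_mul]; exact pair_le_of_mem ha hb)

/-- Properness of a forest concerns two-element submultisets of its decorations. A pair of vertices
of a concatenation lies in one of the factors or is split between them; counting is needed because
two vertices may carry the same decoration. -/
theorem pair_le_add {a b : D} {s t : Multiset D} (h : ({a, b} : Multiset D) ≤ s + t) :
    {a, b} ≤ s ∨ {a, b} ≤ t ∨ (a ∈ s ∧ b ∈ t) ∨ (b ∈ s ∧ a ∈ t) := by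
  classical
  simp only [Multiset.le_iff_count, Multiset.count_add] at h ⊢
  have count (x : D) : ({a, b} : Multiset D).count x =
      (if x = a then 1 else 0) + if x = b then 1 else 0 := by
    rw [Multiset.insert_eq_cons, Multiset.count_cons, Multiset.count_singleton, add_comm]
  simp only [count, ← Multiset.count_pos] at h ⊢
  by_cases hab : a = b
  · subst hab
    have h1 := h a
    simp only [if_true] at h1
    by_cases h2 : 2 ≤ s.count a
    · left; intro x; split_ifs with hx <;> simp_all
    · by_cases h3 : 2 ≤ t.count a
      · right; left; intro x; split_ifs with hx <;> simp_all
      · right; right; left; omega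
  · have h1 := h a
    have h2 := h b
    simp only [if_true, hab, Ne.symm hab, if_false] at h1 h2
    by_cases h3 : 1 ≤ s.count a
    · by_cases h4 : 1 ≤ s.count b
      · left
        intro x
        by_cases hxa : x = a
        · subst hxa; simpa [hab] using h3
        · by_cases hxb : x = b
          · subst hxb; simpa [hxa] using h4
          · simp [hxa, hxb]
      · right; right; left; omega
    · by_cases h4 : 1 ≤ s.count b
      · right; right; right; omega
      · right; left
        intro x
        by_cases hxa : x = a
        · subst hxa; simp [hab]; omega
        · by_cases hxb : x = b
          · subst hxb; simp [hxa]; omega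
          · simp [hxa, hxb]

theorem IsProper.mul (hsymm : ∀ a b, rel a b → rel b a) {F G : Forest D} (hF : F.IsProper rel)
    (hG : G.IsProper rel) (h : F.Indep rel G) : (F * G).IsProper rel := by
  intro a b hab
  rw [decorations_mul] at hab
  rcases pair_le_add hab with h1 | h1 | h1 | h1
  · exact hF a b h1
  · exact hG a b h1
  · exact h a h1.1 b h1.2
  · exact hsymm _ _ (h b h1.1 a h1.2)

end Forest

variable {D : Type*} {rel : D → D → Prop}

theorem properForests_eq (rel : D → D → Prop) :
    properForests rel = supportedIn (Forest.IsProper rel) :=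
  (supportedIn_eq_span _).symm

theorem mem_properForests {u : MonoidAlgebra ℝ (Forest D)} :
    u ∈ properForests rel ↔ ∀ F ∈ u.coeff.support, F.IsProper rel := by
  rw [properForests_eq, mem_supportedIn]

theorem mul_mem_properForests (hsymm : ∀ a b, rel a b → rel b a)
    {u v : MonoidAlgebra ℝ (Forest D)} (hu : u ∈ properForests rel) (hv : v ∈ properForests rel)
    (h : forestRel rel u v) : u * v ∈ properForests rel := by
  rw [properForests_eq] at *
  -- The predicates also record membership in the supports, since independence is assumed only for
  -- the forests occurring in `u` and `v`.
  refine mul_mem_supportedIn (P₁ := fun F => F.IsProper rel ∧ F ∈ u.coeff.support)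
    (P₂ := fun F => F.IsProper rel ∧ F ∈ v.coeff.support) (fun F hF => ⟨hu F hF, hF⟩)
    (fun F hF => ⟨hv F hF, hF⟩) fun F G hF hG => hF.1.mul hsymm hG.1 (h F hF.2 G hG.2)

/-- The properly decorated forests span a locality algebra. -/
theorem isUnitalLocalityAlgebra_properForests (hsymm : ∀ a b, rel a b → rel b a) :
    IsUnitalLocalityAlgebra (properForests rel) (forestRel rel) where
  symm := fun u _ v _ h F hF G hG a ha b hb => hsymm _ _ (h G hG F hF b hb a ha)
  polar_subspace := fun U _ => by
    refine ⟨properForests rel ⊓ supportedIn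
      fun G => ∀ u ∈ U, ∀ F ∈ u.coeff.support, F.Indep rel G, ?_⟩
    ext x
    simp only [Submodule.coe_inf, Set.mem_inter_iff, SetLike.mem_coe, mem_supportedIn, polarSet,
      Set.mem_ofPred_eq, forestRel]
    exact and_congr_right fun _ => ⟨fun h u hu F hF G hG => h G hG u hu F hF,
      fun h G hG u hu F hF => h u hu F hF G hG⟩
  mul_mem := fun _ hu _ hv h => mul_mem_properForests hsymm hu hv h
  mul_mem_polar := fun U _ u hu v hv h => by
    refine ⟨mul_mem_properForests hsymm hu.1 hv.1 h, fun w hw F hF => ?_⟩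
    refine mul_mem_supportedIn (P₁ := fun G => F.Indep rel G) (P₂ := fun G => F.Indep rel G)
      (P₃ := fun G => F.Indep rel G) (fun G hG => hu.2 w hw F hF G hG)
      (fun G hG => hv.2 w hw F hF G hG) fun G H hG hH a ha b hb => ?_
    rw [Forest.decorations_mul, Multiset.mem_add] at hb
    rcases hb with hb | hb
    exacts [hG a ha b hb, hH a ha b hb]
  smul_mul := fun r u _ v _ _ => smul_mul_assoc r u v
  one_mem := by
    rw [properForests_eq, MonoidAlgebra.one_def]
    exact single_mem_supportedIn Forest.isProper_one
  one_rel := fun u _ F hF => by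
    rw [MonoidAlgebra.one_def] at hF
    obtain rfl := Finset.mem_singleton.1 (Finsupp.support_single_subset hF)
    simp [Forest.Indep]

/-! ### Branched maps -/

section Branched

variable {A : Type*} [CommRing A] [Module ℝ A] {V : Submodule ℝ A} {relA : A → A → Prop}

/-- Independence from a fixed `t` cuts out a linear subspace, inside which inductions over linear
combinations of forests can be run. -/
theorem IsUnitalLocalityAlgebra.exists_polar (hV : IsUnitalLocalityAlgebra V relA) {t : A}
    (ht : t ∈ V) : ∃ P : Submodule ℝ A, ∀ x, x ∈ P ↔ x ∈ V ∧ relA t x := by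
  obtain ⟨P, hP⟩ := hV.polar_subspace {t} (by simpa using ht)
  refine ⟨P, fun x => ?_⟩
  rw [← SetLike.mem_coe, hP]
  simp [polarSet]

theorem IsUnitalLocalityAlgebra.rel_mul (hV : IsUnitalLocalityAlgebra V relA) {t x y : A}
    (ht : t ∈ V) (hx : x ∈ V) (hy : y ∈ V) (htx : relA t x) (hty : relA t y) (hxy : relA x y) :
    relA t (x * y) := by
  have := hV.mul_mem_polar {t} (by simpa using ht) x (by simp [polarSet, *]) y
    (by simp [polarSet, *]) hxy
  simpa using this.2

variable {s : A → A} {S : V →ₗ[ℝ] V}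

/-- The forests properly decorated by elements of `V` are mapped to `V`, compatibly with `rel`. -/
theorem lift_mem (hV : IsUnitalLocalityAlgebra V relA) (hS : ∀ σ, (S σ : A) = s σ)
    (hrel : ∀ σ τ : V, relA σ τ → relA (S σ) τ) (F : Forest V)
    (hF : F.IsProper fun a b : V => relA a b) :
    F.lift (fun (ω : V) u => s (ω * u)) ∈ V ∧
      ∀ t ∈ V, (∀ b ∈ F.decorations, relA t b) → relA t (F.lift fun (ω : V) u => s (ω * u)) := by
  -- Membership and independence have to be proved together: `a` times the image of `c` belongs to
  -- `V` only because the independence statement for `c` can be applied to `t = a`.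
  induction F using Forest.induction with
  | one =>
    refine ⟨hV.one_mem, fun t ht _ => ?_⟩
    exact hV.symm _ hV.one_mem _ ht (hV.one_rel t ht)
  | graft_mul a c r ihc ihr =>
    have hdec := Forest.decorations_graft_mul a c r
    have hc : c.IsProper fun a b : V => relA a b := hF.of_le (by
      rw [hdec]; exact (Multiset.le_add_right _ _).trans (Multiset.le_cons_self _ _))
    have hr : r.IsProper fun a b : V => relA a b := hF.of_le (by
      rw [hdec]; exact (Multiset.le_add_left _ _).trans (Multiset.le_cons_self _ _))
    obtain ⟨hcV, hcrel⟩ := ihc hc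
    obtain ⟨hrV, hrrel⟩ := ihr hr
    have hac : relA a (c.lift fun (ω : V) u => s (ω * u)) := by
      refine hcrel a a.2 fun b hb => hF a b ?_
      rw [hdec]
      exact Multiset.cons_le_cons a (Multiset.singleton_le.2 (Multiset.mem_add.2 (.inl hb)))
    have hmul := hV.mul_mem _ a.2 _ hcV hac
    have hSmem : s (a * c.lift fun (ω : V) u => s (ω * u)) ∈ V := by
      rw [← hS ⟨_, hmul⟩]; exact (S _).2
    have hSrel : ∀ t ∈ V, relA t a → (∀ b ∈ c.decorations, relA t b) →
        relA t (s (a * c.lift fun (ω : V) u => s (ω * u))) := by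
      intro t ht hta htc
      have h1 := hV.rel_mul ht a.2 hcV hta (hcrel t ht htc) hac
      have h2 := hrel ⟨_, hmul⟩ ⟨t, ht⟩ (hV.symm _ ht _ hmul h1)
      rw [hS] at h2
      exact hV.symm _ hSmem _ ht h2
    have hSr : relA (s (a * c.lift fun (ω : V) u => s (ω * u)))
        (r.lift fun (ω : V) u => s (ω * u)) := by
      -- The image of the tree plays the role of `t` for the remaining forest `r`; that it is
      -- independent of a decoration `b` of `r` is `hSrel` with `t = b`.
      refine hrrel _ hSmem fun b hb => hV.symm _ b.2 _ hSmem (hSrel b b.2 ?_ ?_)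
      · refine hV.symm _ a.2 _ b.2 (hF a b ?_)
        rw [hdec]
        exact Multiset.cons_le_cons a (Multiset.singleton_le.2 (Multiset.mem_add.2 (.inr hb)))
      · intro b' hb'
        refine hV.symm _ b'.2 _ b.2 (hF b' b ?_)
        rw [hdec]
        exact (Forest.pair_le_of_mem hb' hb).trans (Multiset.le_cons_self _ _)
    rw [Forest.lift_mul, Forest.lift_graft]
    refine ⟨hV.mul_mem _ hSmem _ hrV hSr, fun t ht hdt => ?_⟩
    rw [hdec] at hdt
    refine hV.rel_mul ht hSmem hrV (hSrel t ht ?_ ?_) (hrrel t ht ?_) hSr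
    · exact hdt a (Multiset.mem_cons_self _ _)
    · exact fun b hb => hdt b (Multiset.mem_cons_of_mem (Multiset.mem_add.2 (.inl hb)))
    · exact fun b hb => hdt b (Multiset.mem_cons_of_mem (Multiset.mem_add.2 (.inr hb)))

/-- The linear extension to linear combinations of forests of the universal map
`Forest.lift β`. -/
def branched (β : V → A → A) : MonoidAlgebra ℝ (Forest V) →ₗ[ℝ] A :=
  (Finsupp.linearCombination ℝ (Forest.lift β)).comp (MonoidAlgebra.coeffLinearEquiv ℝ).toLinearMap

theorem branched_single (β : V → A → A) (F : Forest V) :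
    branched β (MonoidAlgebra.single F 1) = F.lift β := by
  simp [branched]

/-- No independence is needed, since both products are those of ambient rings. As `A` is only
assumed to be a module over `ℝ`, the compatibility of scalars with the product enters as a
hypothesis, and commutativity gives it on the other side. -/
theorem branched_mul (hmul : ∀ (r : ℝ) (u v : A), (r • u) * v = r • (u * v)) (β : V → A → A)
    (u v : MonoidAlgebra ℝ (Forest V)) : branched β (u * v) = branched β u * branched β v := by
  have hmul' (r : ℝ) (u v : A) : u * (r • v) = r • (u * v) := by
    rw [mul_comm, hmul, mul_comm]
  have hu : u ∈ supportedIn fun _ : Forest V => True := fun _ _ => trivial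
  have hv : v ∈ supportedIn fun _ : Forest V => True := fun _ _ => trivial
  induction u, hu using supportedIn_induction with
  | single F hF =>
    induction v, hv using supportedIn_induction with
    | single G hG =>
      rw [MonoidAlgebra.single_mul_single, one_mul]
      simp only [branched_single, Forest.lift_mul]
    | zero => simp
    | add u v _ _ hu hv => simp only [mul_add, map_add, hu, hv]
    | smul r u _ hu => simp only [mul_smul_comm, map_smul, hu, hmul']
  | zero => simp
  | add u v _ _ hu hv => simp only [add_mul, map_add, hu, hv]
  | smul r u _ hu => simp only [smul_mul_assoc, map_smul, hu, hmul]

/-- A linear map `S : V → V` independent of the identity lifts to a unique morphism of operated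
locality algebras on properly decorated forests. -/
theorem exists_branched (hmul : ∀ (r : ℝ) (u v : A), (r • u) * v = r • (u * v))
    (hV : IsUnitalLocalityAlgebra V relA) (hS : ∀ σ, (S σ : A) = s σ)
    (hrel : ∀ σ τ : V, relA σ τ → relA (S σ) τ) :
    ∃ f : properForests (fun a b : V => relA a b) →ₗ[ℝ] V,
      (∀ F : Forest V, (F.IsProper fun a b : V => relA a b) →
        ∀ hF : MonoidAlgebra.single F 1 ∈ properForests (fun a b : V => relA a b),
          (f ⟨MonoidAlgebra.single F 1, hF⟩ : A) = F.lift fun (ω : V) u => s (ω * u)) ∧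
      IsLocalityAlgHom (forestRel fun a b : V => relA a b) relA f ∧
      IsOperatedMorphism (fun a b : V => relA a b) relA (fun (ω : V) u => s (ω * u)) f ∧
      ∀ g : properForests (fun a b : V => relA a b) →ₗ[ℝ] V,
        IsOperatedMorphism (fun a b : V => relA a b) relA (fun (ω : V) u => s (ω * u)) g →
          g = f := by
  set relV : V → V → Prop := fun a b : V => relA a b with hrelV
  set β : V → A → A := fun (ω : V) u => s (ω * u) with hβ
  have hsymm : ∀ a b : V, relV a b → relV b a := fun a b h => hV.symm _ a.2 _ b.2 h
  have hL := lift_mem hV hS hrel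
  have hmem : ∀ u ∈ properForests relV, branched β u ∈ V := by
    intro u hu
    rw [properForests_eq] at hu
    induction u, hu using supportedIn_induction with
    | single F hF => rw [branched_single]; exact (hL F hF).1
    | zero => simp
    | add u v _ _ hu hv => rw [map_add]; exact V.add_mem hu hv
    | smul r u _ hu => rw [map_smul]; exact V.smul_mem r hu
  let f : properForests relV →ₗ[ℝ] V :=
    ((branched β).comp (properForests relV).subtype).codRestrict V fun u => hmem u u.2
  have hf : ∀ u (hu : u ∈ properForests relV), (f ⟨u, hu⟩ : A) = branched β u := fun u hu => rfl
  have hrelb : ∀ t ∈ V, ∀ u ∈ properForests relV,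
      (∀ F ∈ u.coeff.support, ∀ b ∈ F.decorations, relA t b) → relA t (branched β u) := by
    intro t ht u hu htu
    obtain ⟨P, hP⟩ := hV.exists_polar ht
    have hu' : u ∈ supportedIn fun F : Forest V => F.IsProper relV ∧
        ∀ b ∈ F.decorations, relA t b :=
      fun F hF => ⟨mem_properForests.1 hu F hF, htu F hF⟩
    refine ((hP _).1 ?_).2
    clear hu htu
    induction u, hu' using supportedIn_induction with
    | single F hF =>
      rw [branched_single]
      exact (hP _).2 ⟨(hL F hF.1).1, (hL F hF.1).2 t ht hF.2⟩
    | zero => simp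
    | add u v _ _ hu hv => rw [map_add]; exact P.add_mem hu hv
    | smul r u _ hu => rw [map_smul]; exact P.smul_mem r hu
  have hom : IsLocalityAlgHom (forestRel relV) relA f := by
    refine ⟨fun u v huv => ?_, fun u v huv h => ?_⟩
    -- Two applications of `hrelb`: independence of `f u` from `f v` reduces to independence of `f
    -- u` from the decorations of `v`, and then to that of the decorations of `u` from those of `v`.
    · refine hrelb _ (f u).2 v v.2 fun F hF b hb => ?_
      refine hV.symm _ b.2 _ (f u).2 (hrelb b b.2 u u.2 fun G hG a ha => ?_)
      exact hV.symm _ a.2 _ b.2 (huv G hG F hF a ha b hb)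
    · rw [hf]
      exact branched_mul hmul β u v
  have hop : IsOperatedMorphism relV relA β f := by
    refine ⟨hom, fun h1 => ?_, fun a u hau hu => ?_⟩
    · rw [hf, MonoidAlgebra.one_def, branched_single, Forest.lift_one]
    · rw [hf, ← Subtype.coe_eta u u.2, hf]
      obtain ⟨u, hu0⟩ := u
      simp only at hau ⊢
      have hu' : u ∈ supportedIn fun F : Forest V => F.IsProper relV ∧
          ∀ b ∈ F.decorations, relA a b :=
        fun F hF => ⟨mem_properForests.1 hu0 F hF, hau F hF⟩
      -- The function `s` is known to be linear only on `V`, through `S`, so the membership of its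
      -- argument is carried through the induction.
      suffices h : ∃ h : a * branched β u ∈ V,
          branched β (graftLin a u) = S ⟨a * branched β u, h⟩ by
        obtain ⟨h, h'⟩ := h
        rw [h', hS]
      clear hau hu hu0
      have hmul' (r : ℝ) (u v : A) : u * (r • v) = r • (u * v) := by
        rw [mul_comm, hmul, mul_comm]
      induction u, hu' using supportedIn_induction with
      | single F hF =>
        rw [branched_single]
        have h : (a : A) * F.lift β ∈ V :=
          hV.mul_mem _ a.2 _ (hL F hF.1).1 ((hL F hF.1).2 a a.2 hF.2)
        refine ⟨h, ?_⟩
        rw [show graftLin a (MonoidAlgebra.single F 1) = MonoidAlgebra.single (F.graft a) 1 by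
          simp [graftLin], branched_single, Forest.lift_graft, hS]
      | zero =>
        refine ⟨by simp, ?_⟩
        have : (⟨a * branched β 0, by simp⟩ : V) = 0 := by ext; simp
        rw [this]; simp
      | add u v _ _ hu hv =>
        obtain ⟨hu, hu'⟩ := hu
        obtain ⟨hv, hv'⟩ := hv
        refine ⟨by rw [map_add, mul_add]; exact V.add_mem hu hv, ?_⟩
        rw [map_add, map_add, hu', hv', ← Submodule.coe_add, ← map_add]
        congr 2
        ext
        simp [mul_add]
      | smul r u _ hu =>
        obtain ⟨hu, hu'⟩ := hu
        refine ⟨by rw [map_smul, hmul']; exact V.smul_mem r hu, ?_⟩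
        rw [map_smul, map_smul, hu', ← Submodule.coe_smul, ← map_smul]
        congr 2
        ext
        simp [hmul']
  refine ⟨f, fun F _ hF' => by rw [hf, branched_single], hom, hop, fun g hg => ?_⟩
  -- A nonempty proper forest is a tree times a forest independent of it, and the root of the tree
  -- is independent of its branches. Hence the two axioms for `g` apply and determine its value
  -- recursively.
  have key : ∀ F : Forest V, F.IsProper relV →
      ∀ h : MonoidAlgebra.single F 1 ∈ properForests relV,
        (g ⟨MonoidAlgebra.single F 1, h⟩ : A) = F.lift β := by
    intro F
    induction F using Forest.induction with
    | one =>
      intro _ h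
      exact hg.map_one h
    | graft_mul a c r ihc ihr =>
      intro hF h
      have hdec := Forest.decorations_graft_mul a c r
      have hgc : (c.graft a).IsProper relV := hF.of_le (by
        rw [Forest.decorations_mul]; exact Multiset.le_add_right _ _)
      have hc : c.IsProper relV := hgc.of_le (by
        rw [Forest.decorations_graft]; exact Multiset.le_cons_self _ _)
      have hr : r.IsProper relV := hF.of_le (by
        rw [Forest.decorations_mul]; exact Multiset.le_add_left _ _)
      have hm (G : Forest V) (hG : G.IsProper relV) :
          MonoidAlgebra.single G 1 ∈ properForests relV := by
        rw [properForests_eq]; exact single_mem_supportedIn hG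
      have h1 : forestRel relV (MonoidAlgebra.single (c.graft a) 1)
          (MonoidAlgebra.single r 1) := by
        intro F' hF' G' hG'
        obtain rfl := Finset.mem_singleton.1 (Finsupp.support_single_subset hF')
        obtain rfl := Finset.mem_singleton.1 (Finsupp.support_single_subset hG')
        exact hF.indep
      have h2 : actRel relV a (MonoidAlgebra.single c 1) := by
        intro F' hF' b hb
        obtain rfl := Finset.mem_singleton.1 (Finsupp.support_single_subset hF')
        refine hgc a b ?_
        rw [Forest.decorations_graft]
        exact Multiset.cons_le_cons a (Multiset.singleton_le.2 hb)
      have e1 : (MonoidAlgebra.single (c.graft a * r) 1 : MonoidAlgebra ℝ (Forest V)) =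
          MonoidAlgebra.single (c.graft a) 1 * MonoidAlgebra.single r 1 := by
        rw [MonoidAlgebra.single_mul_single, one_mul]
      have e2 : (MonoidAlgebra.single (c.graft a) 1 : MonoidAlgebra ℝ (Forest V)) =
          graftLin a (MonoidAlgebra.single c 1) := by
        simp [graftLin]
      have h3 := hg.map_mul ⟨_, hm _ hgc⟩ ⟨_, hm _ hr⟩ h1 (by rw [← e1]; exact hm _ hF)
      have h4 := hg.map_graft a ⟨_, hm _ hc⟩ h2 (by rw [← e2]; exact hm _ hgc)
      simp only [← e1, ← e2] at h3 h4
      rw [h3, h4, ihc hc, ihr hr, Forest.lift_mul, Forest.lift_graft]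
  ext ⟨u, hu⟩
  rw [hf]
  have hu' := hu
  rw [properForests_eq] at hu'
  suffices h : ∀ u ∈ supportedIn (Forest.IsProper relV),
      ∃ hu : u ∈ properForests relV, (g ⟨u, hu⟩ : A) = branched β u from (h u hu').2
  clear hu hu' u
  intro u hu
  induction u, hu using supportedIn_induction with
  | single F hF =>
    have hm : MonoidAlgebra.single F 1 ∈ properForests relV := by
      rw [properForests_eq]; exact single_mem_supportedIn hF
    exact ⟨hm, by rw [key F hF hm, branched_single]⟩
  | zero =>
    refine ⟨Submodule.zero_mem _, ?_⟩
    have : (⟨0, Submodule.zero_mem _⟩ : properForests relV) = 0 := rfl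
    rw [this]; simp
  | add u v _ _ hu hv =>
    obtain ⟨hu, hu'⟩ := hu
    obtain ⟨hv, hv'⟩ := hv
    refine ⟨Submodule.add_mem _ hu hv, ?_⟩
    rw [map_add, ← hu', ← hv', ← Submodule.coe_add, ← map_add]
    rfl
  | smul r u _ hu =>
    obtain ⟨hu, hu'⟩ := hu
    refine ⟨Submodule.smul_mem _ r hu, ?_⟩
    rw [map_smul, ← hu', ← Submodule.coe_smul, ← map_smul]
    rfl

end Branched

end Locality

end

noncomputable section

namespace Locality

open Filter Topology

/-! ### Linear forms in coordinates -/

section Dot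

variable {n : ℕ}

/-- The complex linear form on `ℂ^n` with real coefficients `u`. -/
def dot (u : Fin n → ℝ) (y : Fin n → ℂ) : ℂ := ∑ i, (u i : ℂ) * y i

/-- A real vector as a complex vector. -/
def cvec (x : Fin n → ℝ) : Fin n → ℂ := fun i => (x i : ℂ)

@[simp] theorem dot_zero_left (y : Fin n → ℂ) : dot 0 y = 0 := by simp [dot]
@[simp] theorem dot_zero_right (u : Fin n → ℝ) : dot u 0 = 0 := by simp [dot]

theorem dot_add_left (u v : Fin n → ℝ) (y : Fin n → ℂ) : dot (u + v) y = dot u y + dot v y := by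
  simp [dot, add_mul, Finset.sum_add_distrib]

theorem dot_smul_left (r : ℝ) (u : Fin n → ℝ) (y : Fin n → ℂ) : dot (r • u) y = r * dot u y := by
  simp [dot, Finset.mul_sum, mul_assoc]

theorem dot_add_right (u : Fin n → ℝ) (y z : Fin n → ℂ) : dot u (y + z) = dot u y + dot u z := by
  simp [dot, mul_add, Finset.sum_add_distrib]

theorem dot_sub_right (u : Fin n → ℝ) (y z : Fin n → ℂ) : dot u (y - z) = dot u y - dot u z := by
  simp [dot, mul_sub, Finset.sum_sub_distrib]

theorem dot_smul_right (u : Fin n → ℝ) (r : ℂ) (y : Fin n → ℂ) :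
    dot u (r • y) = r * dot u y := by
  simp [dot, Finset.mul_sum, mul_left_comm]

theorem dot_sum_left {ι : Type*} (s : Finset ι) (u : ι → Fin n → ℝ) (y : Fin n → ℂ) :
    dot (∑ i ∈ s, u i) y = ∑ i ∈ s, dot (u i) y := by
  classical
  induction s using Finset.induction_on with
  | empty => simp
  | insert a s ha ih => rw [Finset.sum_insert ha, Finset.sum_insert ha, dot_add_left, ih]

theorem dot_cvec (u x : Fin n → ℝ) : dot u (cvec x) = ((u ⬝ᵥ x : ℝ) : ℂ) := by
  simp [dot, cvec, dotProduct]

theorem dot_star (u : Fin n → ℝ) (y : Fin n → ℂ) : dot u (star y) = star (dot u y) := by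
  simp [dot]

theorem differentiable_dot (u : Fin n → ℝ) : Differentiable ℂ (dot u) := by
  unfold dot
  fun_prop

theorem continuous_dot (u : Fin n → ℝ) : Continuous (dot u) := (differentiable_dot u).continuous

/-- The complexified transpose of a real linear map. -/
def dualMap (π : (Fin n → ℝ) →ₗ[ℝ] (Fin n → ℝ)) : (Fin n → ℂ) →ₗ[ℂ] (Fin n → ℂ) where
  toFun y i := dot (π (Pi.single i 1)) y
  map_add' y z := by ext i; simp [dot_add_right]
  map_smul' r y := by ext i; simp [dot_smul_right]

theorem dot_dualMap (π : (Fin n → ℝ) →ₗ[ℝ] (Fin n → ℝ)) (u : Fin n → ℝ) (y : Fin n → ℂ) :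
    dot u (dualMap π y) = dot (π u) y := by
  have hu : u = ∑ i, u i • (Pi.single i 1 : Fin n → ℝ) := by
    ext j; simp [Finset.sum_apply, Pi.single_apply]
  conv_rhs => rw [hu, map_sum, dot_sum_left]
  simp only [map_smul, dot_smul_left]
  rfl

theorem continuous_dualMap (π : (Fin n → ℝ) →ₗ[ℝ] (Fin n → ℝ)) : Continuous (dualMap π) :=
  LinearMap.continuous_of_finiteDimensional _

/-- A vector is orthogonal to a subspace and not orthogonal to finitely many vectors outside it. -/
theorem exists_orthogonal_generic (V : Submodule ℝ (Fin n → ℝ)) (L : List (Fin n → ℝ)) :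
    ∃ x : Fin n → ℝ, (∀ v ∈ V, dot v (cvec x) = 0) ∧ ∀ u ∈ L, u ∉ V → dot u (cvec x) ≠ 0 := by
  classical
  simp only [dot_cvec, Complex.ofReal_eq_zero, ne_eq]
  let W : Submodule ℝ (Fin n → ℝ) :=
    { carrier := {x | ∀ v ∈ V, v ⬝ᵥ x = 0}
      zero_mem' := fun v _ => dotProduct_zero v
      add_mem' := fun {a b} ha hb v hv => by rw [dotProduct_add, ha v hv, hb v hv, add_zero]
      smul_mem' := fun r a ha v hv => by rw [dotProduct_smul, ha v hv, smul_zero] }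
  let p : (Fin n → ℝ) → Submodule ℝ W := fun u =>
    { carrier := {x | u ⬝ᵥ (x : Fin n → ℝ) = 0}
      zero_mem' := dotProduct_zero u
      add_mem' := fun {a b} ha hb => by
        have ha' : u ⬝ᵥ (a : Fin n → ℝ) = 0 := ha
        have hb' : u ⬝ᵥ (b : Fin n → ℝ) = 0 := hb
        change u ⬝ᵥ ((a : Fin n → ℝ) + b) = 0
        rw [dotProduct_add, ha', hb', add_zero]
      smul_mem' := fun r a ha => by
        have ha' : u ⬝ᵥ (a : Fin n → ℝ) = 0 := ha
        change u ⬝ᵥ (r • (a : Fin n → ℝ)) = 0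
        rw [dotProduct_smul, ha', smul_zero] }
  have hp : ∀ u, u ∉ V → p u ≠ ⊤ := by
    intro u hu htop
    -- A linear functional that vanishes on `V` but not at `u` is the dot product with some `x`, and
    -- this `x` lies in `W` outside `p u`.
    obtain ⟨f, hfu, hf⟩ := Submodule.exists_dual_map_eq_bot_of_notMem hu inferInstance
    let x : Fin n → ℝ := fun i => f (Pi.single i 1)
    have hx : ∀ v, v ⬝ᵥ x = f v := by
      intro v
      have hv : v = ∑ i, v i • (Pi.single i 1 : Fin n → ℝ) := by
        ext j; simp [Finset.sum_apply, Pi.single_apply]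
      conv_rhs => rw [hv, map_sum]
      simp [dotProduct, x]
    have hxW : x ∈ W := by
      intro v hv
      rw [hx]
      exact (Submodule.mem_bot ℝ).1 (hf ▸ Submodule.mem_map_of_mem hv)
    have : (⟨x, hxW⟩ : W) ∈ p u := by rw [htop]; trivial
    exact hfu ((hx u).symm.trans this)
  have hs : (⊤ : Submodule ℝ W) ∉ ((L.toFinset.filter (· ∉ V)).image p) := by
    intro h
    -- The spaces `p u` are proper subspaces of `W`, and a vector space over an infinite field is
    -- not a finite union of proper subspaces.
    obtain ⟨u, hu, hu'⟩ := Finset.mem_image.1 h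
    exact hp u (Finset.mem_filter.1 hu).2 hu'
  have := Subspace.biUnion_ne_univ_of_top_notMem hs
  obtain ⟨x, hx⟩ := (Set.ne_univ_iff_exists_notMem _).1 this
  refine ⟨x, x.2, fun u hu huV h0 => hx ?_⟩
  simp only [Set.mem_iUnion]
  exact ⟨p u, Finset.mem_image_of_mem p (by simp [hu, huV]), h0⟩

theorem eventually_affine_ne_zero (a b : ℂ) (hb : b ≠ 0) :
    ∀ᶠ t : ℝ in 𝓝[≠] 0, a + t * b ≠ 0 := by
  by_cases ha : a = 0
  · filter_upwards [self_mem_nhdsWithin] with t ht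
    simpa [ha, hb] using ht
  · apply eventually_nhdsWithin_of_eventually_nhds
    have : ContinuousAt (fun t : ℝ => a + t * b) 0 := by fun_prop
    exact this.eventually_ne (by simpa using ha)

/-- The map `π` is the identity on `V₁` modulo `V₁ ⊓ V₂` and maps `V₂` to `V₁ ⊓ V₂`. -/
theorem exists_splitting {K E : Type*} [Field K] [AddCommGroup E] [Module K E]
    (V₁ V₂ : Submodule K E) :
    ∃ π : E →ₗ[K] E, (∀ v ∈ V₁, π v = v) ∧ ∀ v ∈ V₂, π v ∈ V₁ ⊓ V₂ := by
  -- `C` is a complement of `V₁ ⊓ V₂` in `V₂`. It meets `V₁` trivially, so it extends to a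
  -- complement `C'` of `V₁`, and the projection onto `V₁` along `C'` kills `C`.
  obtain ⟨C, hC⟩ := exists_isCompl ((V₁ ⊓ V₂).comap V₂.subtype)
  let C₁ := C.map V₂.subtype
  have hdisj : Disjoint C₁ V₁ := by
    rw [Submodule.disjoint_def]
    rintro _ ⟨x, hx, rfl⟩ hx1
    have := Submodule.disjoint_def.1 hC.disjoint x ⟨hx1, x.2⟩ hx
    simp [this]
  obtain ⟨C', hCC', hC'⟩ := hdisj.exists_isCompl
  refine ⟨Submodule.projection V₁ C' hC'.symm, fun v hv => ?_, fun v hv => ?_⟩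
  · exact Submodule.projection_apply_of_mem_left hC'.symm hv
  · obtain ⟨a, ha, b, hb, hab⟩ := Submodule.mem_sup.1
      (hC.sup_eq_top ▸ Submodule.mem_top : (⟨v, hv⟩ : V₂) ∈ _)
    have hb' : (b : E) ∈ C' := hCC' ⟨b, hb, rfl⟩
    have hv' : v = (a : E) + b := by
      have := congrArg Subtype.val hab
      exact this.symm
    rw [hv', map_add, Submodule.projection_apply_of_mem_left (x := (a : E)) hC'.symm ha.1,
      Submodule.projection_apply_of_mem_right hC'.symm hb', add_zero]
    exact ha

end Dot

/-! ### Coordinates on `ℂ^∞` -/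

section Coords

/-- The inclusion of `ℝ^n` in `ℝ^∞`. -/
def emb (n : ℕ) : (Fin n → ℝ) →ₗ[ℝ] (ℕ →₀ ℝ) where
  toFun u := ∑ i : Fin n, Finsupp.single (i : ℕ) (u i)
  map_add' u v := by simp [Finset.sum_add_distrib]
  map_smul' r u := by simp [Finset.smul_sum]

theorem emb_apply {n : ℕ} (u : Fin n → ℝ) (i : Fin n) : emb n u i = u i := by
  have : ∀ j : Fin n, (Finsupp.single (j : ℕ) (u j)) (i : ℕ) = if j = i then u i else 0 := by
    intro j
    rw [Finsupp.single_apply]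
    by_cases h : j = i
    · simp [h]
    · simp [h, Fin.val_injective.ne h]
  simp [emb, Finset.sum_apply', this]

theorem emb_injective (n : ℕ) : Function.Injective (emb n) := by
  intro u v h
  ext i
  rw [← emb_apply u i, h, emb_apply]

theorem exists_emb_eq (v : ℕ →₀ ℝ) : ∃ n₀, ∀ n ≥ n₀, ∃ u, emb n u = v := by
  refine ⟨v.support.sup id + 1, fun n hn => ⟨fun i => v i, ?_⟩⟩
  have h : v.support ⊆ Finset.range n := by
    intro i hi
    have : i ≤ v.support.sup id := Finset.le_sup (f := id) hi
    simp; omega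
  conv_rhs => rw [← Finsupp.sum_single v, Finsupp.sum_of_support_subset v h _ (by simp)]
  rw [Finset.sum_range]
  rfl

theorem exists_le_range_emb (V : Submodule ℝ (ℕ →₀ ℝ)) (hV : FiniteDimensional ℝ V) :
    ∃ n₀, ∀ n ≥ n₀, V ≤ LinearMap.range (emb n) := by
  obtain ⟨s, rfl⟩ := (Submodule.fg_iff_finiteDimensional V).2 hV
  choose N hN using exists_emb_eq
  refine ⟨s.sup N, fun n hn => Submodule.span_le.2 fun v hv => ?_⟩
  obtain ⟨u, hu⟩ := hN v n ((Finset.le_sup hv).trans hn)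
  exact ⟨u, hu⟩

theorem emb_eq_zero {n : ℕ} {u : Fin n → ℝ} : emb n u = 0 ↔ u = 0 :=
  map_eq_zero_iff _ (emb_injective n)

variable (Q : LinearMap.BilinForm ℝ (ℕ →₀ ℝ))

theorem linForm_add (u v : ℕ →₀ ℝ) (z : ℕ →₀ ℂ) :
    linForm Q (u + v) z = linForm Q u z + linForm Q v z := by
  simp [linForm, Finsupp.sum, add_mul, Finset.sum_add_distrib]

theorem linForm_smul (r : ℝ) (v : ℕ →₀ ℝ) (z : ℕ →₀ ℂ) :
    linForm Q (r • v) z = r * linForm Q v z := by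
  simp [linForm, Finsupp.sum, Finset.mul_sum, mul_assoc]

@[simp] theorem linForm_zero (z : ℕ →₀ ℂ) : linForm Q 0 z = 0 := by
  simp [linForm, Finsupp.sum]

theorem linForm_emb {n : ℕ} (u : Fin n → ℝ) (z : ℕ →₀ ℂ) :
    linForm Q (emb n u) z = dot u (coords Q n z) := by
  have h : ∀ s : Finset (Fin n), linForm Q (∑ i ∈ s, Finsupp.single (i : ℕ) (u i)) z =
      ∑ i ∈ s, (u i : ℂ) * coords Q n z i := by
    classical
    intro s
    induction s using Finset.induction_on with
    | empty => simp
    | insert a s ha ih =>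
      rw [Finset.sum_insert ha, Finset.sum_insert ha, linForm_add, ih]
      congr 1
      have : Finsupp.single (a : ℕ) (u a) = u a • Finsupp.single (a : ℕ) (1 : ℝ) := by simp
      rw [this, linForm_smul]
      rfl
  exact h Finset.univ

theorem linForm_add_right (v : ℕ →₀ ℝ) (z z' : ℕ →₀ ℂ) :
    linForm Q v (z + z') = linForm Q v z + linForm Q v z' :=
  Finsupp.sum_add_index' (by simp) (by simp [mul_add])

theorem linForm_smul_right (v : ℕ →₀ ℝ) (c : ℂ) (z : ℕ →₀ ℂ) :
    linForm Q v (c • z) = c * linForm Q v z := by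
  rw [linForm, linForm, Finsupp.sum_smul_index' (by simp), Finsupp.mul_sum]
  simp [mul_left_comm]

theorem linForm_ofReal (v w : ℕ →₀ ℝ) :
    linForm Q v (w.mapRange (fun x : ℝ => (x : ℂ)) (by simp)) = (Q v w : ℂ) := by
  rw [linForm, Finsupp.sum_mapRange_index (by simp)]
  conv_rhs => rw [← Finsupp.sum_single w, Finsupp.sum, map_sum]
  rw [Finsupp.sum]
  push_cast
  refine Finset.sum_congr rfl fun i _ => ?_
  have : Finsupp.single i (w i) = w i • Finsupp.single i (1 : ℝ) := by simp
  rw [this, map_smul]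
  simp [mul_comm]

variable {Q}

/-- Already on `ℂ^n` the map is the complexified Gram matrix of `Q`, which is injective over `ℝ` by
positive definiteness. The real and imaginary parts of the equation are solved separately. -/
theorem coords_surjective (hpos : ∀ v, v ≠ 0 → 0 < Q v v) (n : ℕ) :
    Function.Surjective (coords Q n) := by
  let g : (Fin n → ℝ) →ₗ[ℝ] (Fin n → ℝ) :=
    LinearMap.pi fun i => (Q (Finsupp.single (i : ℕ) 1)).comp (emb n)
  have hg : ∀ v u, Q (emb n u) (emb n v) = u ⬝ᵥ g v := by
    intro v u
    have : emb n u = ∑ i : Fin n, u i • Finsupp.single (i : ℕ) (1 : ℝ) := by simp [emb]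
    rw [this, map_sum, LinearMap.sum_apply, dotProduct]
    refine Finset.sum_congr rfl fun i _ => ?_
    rw [map_smul]
    rfl
  have hinj : Function.Injective g := by
    rw [injective_iff_map_eq_zero]
    intro v hv
    by_contra hne
    have := hpos (emb n v) (by rwa [ne_eq, emb_eq_zero])
    rw [hg, hv, dotProduct_zero] at this
    exact lt_irrefl _ this
  have hsurj : Function.Surjective g := LinearMap.injective_iff_surjective.1 hinj
  intro y
  obtain ⟨a, ha⟩ := hsurj fun i => (y i).re
  obtain ⟨b, hb⟩ := hsurj fun i => (y i).im
  refine ⟨(emb n a).mapRange (fun x : ℝ => (x : ℂ)) (by simp) +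
    Complex.I • (emb n b).mapRange (fun x : ℝ => (x : ℂ)) (by simp), ?_⟩
  ext i
  simp only [coords, linForm_add_right, linForm_smul_right, linForm_ofReal]
  have ha' : Q (Finsupp.single (i : ℕ) 1) (emb n a) = (y i).re := congrFun ha i
  have hb' : Q (Finsupp.single (i : ℕ) 1) (emb n b) = (y i).im := congrFun hb i
  rw [ha', hb', mul_comm]
  exact Complex.re_add_im (y i)

/-- The coordinates in `ℂ^n` of a point with coordinates in `ℂ^m`, for `n ≤ m`. -/
def restr {n m : ℕ} (h : n ≤ m) (y : Fin m → ℂ) : Fin n → ℂ := fun i => y (Fin.castLE h i)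

theorem restr_coords {n m : ℕ} (h : n ≤ m) (z : ℕ →₀ ℂ) :
    restr h (coords Q m z) = coords Q n z := rfl

theorem restr_mem_ball {n m : ℕ} (h : n ≤ m) {y : Fin m → ℂ} {r : ℝ}
    (hy : y ∈ Metric.ball 0 r) : restr h y ∈ Metric.ball 0 r := by
  rw [mem_ball_zero_iff] at hy ⊢
  have hr : 0 < r := (norm_nonneg y).trans_lt hy
  rw [pi_norm_lt_iff hr] at hy ⊢
  exact fun i => hy _

variable (Q) in
/-- The filter generated by the sets of points whose first coordinates are small and are not zeros
of finitely many nonzero linear forms. -/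
def coordsFilter : Filter (ℕ →₀ ℂ) where
  sets := {s | ∃ n₀, ∀ n ≥ n₀, ∃ r : ℝ, 0 < r ∧ ∃ L : List (Fin n → ℝ), (∀ u ∈ L, u ≠ 0) ∧
    ∀ z, coords Q n z ∈ Metric.ball 0 r → (∀ u ∈ L, dot u (coords Q n z) ≠ 0) → z ∈ s}
  univ_sets := ⟨0, fun n _ => ⟨1, one_pos, [], by simp, fun _ _ _ => trivial⟩⟩
  sets_of_superset := by
    rintro s t ⟨n₀, h⟩ hst
    refine ⟨n₀, fun n hn => ?_⟩
    obtain ⟨r, hr, L, hL, h⟩ := h n hn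
    exact ⟨r, hr, L, hL, fun z h1 h2 => hst (h z h1 h2)⟩
  inter_sets := by
    rintro s t ⟨n₀, h⟩ ⟨n₁, h'⟩
    refine ⟨max n₀ n₁, fun n hn => ?_⟩
    obtain ⟨r, hr, L, hL, h⟩ := h n ((le_max_left _ _).trans hn)
    obtain ⟨r', hr', L', hL', h'⟩ := h' n ((le_max_right _ _).trans hn)
    refine ⟨min r r', lt_min hr hr', L ++ L', ?_, fun z h1 h2 => ⟨h z ?_ ?_, h' z ?_ ?_⟩⟩
    · simp only [List.mem_append]
      rintro u (hu | hu)
      exacts [hL u hu, hL' u hu]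
    · exact Metric.ball_subset_ball (min_le_left _ _) h1
    · exact fun u hu => h2 u (List.mem_append_left _ hu)
    · exact Metric.ball_subset_ball (min_le_right _ _) h1
    · exact fun u hu => h2 u (List.mem_append_right _ hu)

/-- `genericNhds` is an infimum of infinitely many conditions. The comparison with `coordsFilter`
shows that a statement holding eventually involves a small ball and finitely many hyperplanes in
`ℂ^n`, for every large `n`. -/
theorem coordsFilter_le : coordsFilter Q ≤ genericNhds Q := by
  refine le_inf (le_iInf fun v => ?_) (le_iInf fun v => ?_)
  · rw [← tendsto_iff_comap]
    intro s hs
    obtain ⟨ε, hε, hs⟩ := Metric.mem_nhds_iff.1 hs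
    obtain ⟨n₀, h⟩ := exists_emb_eq v
    refine ⟨n₀, fun n hn => ?_⟩
    obtain ⟨u, rfl⟩ := h n hn
    have hc : ContinuousAt (dot u) 0 := (continuous_dot u).continuousAt
    obtain ⟨r, hr, h⟩ := Metric.continuousAt_iff.1 hc ε hε
    refine ⟨r, hr, [], by simp, fun z hz _ => hs ?_⟩
    rw [linForm_emb]
    simpa using h hz
  · rw [le_principal_iff]
    obtain ⟨n₀, h⟩ := exists_emb_eq v
    refine ⟨n₀, fun n hn => ?_⟩
    obtain ⟨u, hu⟩ := h n hn
    refine ⟨1, one_pos, [u], ?_, fun z _ hz => ?_⟩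
    · simp only [List.mem_singleton, forall_eq]
      rintro rfl
      exact v.2 (by simpa using hu.symm)
    · change linForm Q v z ≠ 0
      rw [← hu, linForm_emb]
      exact hz u (by simp)

theorem exists_of_eventually {p : (ℕ →₀ ℂ) → Prop} (h : ∀ᶠ z in genericNhds Q, p z) :
    ∃ n₀, ∀ n ≥ n₀, ∃ r : ℝ, 0 < r ∧ ∃ L : List (Fin n → ℝ), (∀ u ∈ L, u ≠ 0) ∧
      ∀ z, coords Q n z ∈ Metric.ball 0 r → (∀ u ∈ L, dot u (coords Q n z) ≠ 0) → p z :=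
  coordsFilter_le h

theorem eventually_linForm_ne_zero {v : ℕ →₀ ℝ} (hv : v ≠ 0) :
    ∀ᶠ z in genericNhds Q, linForm Q v z ≠ 0 :=
  have h : genericNhds Q ≤ 𝓟 {z | linForm Q v z ≠ 0} :=
    inf_le_right.trans (iInf_le (fun v : {v : ℕ →₀ ℝ // v ≠ 0} => 𝓟 {z | linForm Q v z ≠ 0}) ⟨v, hv⟩)
  le_principal_iff.1 h

theorem eventually_dot_ne_zero {n : ℕ} {u : Fin n → ℝ} (hu : u ≠ 0) :
    ∀ᶠ z in genericNhds Q, dot u (coords Q n z) ≠ 0 := by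
  simp_rw [← linForm_emb]
  exact eventually_linForm_ne_zero (by rwa [ne_eq, emb_eq_zero])

theorem tendsto_coords (n : ℕ) : Tendsto (coords Q n) (genericNhds Q) (𝓝 0) := by
  rw [tendsto_pi_nhds]
  intro i
  exact (tendsto_comap (f := linForm Q (Finsupp.single (i : ℕ) 1))).mono_left
    (inf_le_left.trans (iInf_le _ _))

theorem eventually_coords_mem_ball (n : ℕ) {r : ℝ} (hr : 0 < r) :
    ∀ᶠ z in genericNhds Q, coords Q n z ∈ Metric.ball 0 r :=
  tendsto_coords n (Metric.ball_mem_nhds 0 hr)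

theorem eventually_forall_dot_ne_zero {n : ℕ} {L : List (Fin n → ℝ)} (hL : ∀ u ∈ L, u ≠ 0) :
    ∀ᶠ z in genericNhds Q, ∀ u ∈ L, dot u (coords Q n z) ≠ 0 := by
  induction L with
  | nil => simp
  | cons a L ih =>
    filter_upwards [eventually_dot_ne_zero (hL a (by simp)),
      ih fun u hu => hL u (List.mem_cons_of_mem _ hu)] with z h1 h2 u hu
    rcases List.mem_cons.1 hu with rfl | hu
    exacts [h1, h2 u hu]

end Coords

end Locality

end

noncomputable section

namespace Locality

open Filter Topology

/-! ### Dependence spaces -/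

section Dep

variable {Q : LinearMap.BilinForm ℝ (ℕ →₀ ℝ)} {σ τ : FunGerm Q} {V V₁ V₂ : Submodule ℝ (ℕ →₀ ℝ)}

theorem DependsOn.mono (h : DependsOn Q σ V₁) (hV : V₁ ≤ V₂) : DependsOn Q σ V₂ := by
  obtain ⟨s, hs, h⟩ := h
  exact ⟨s, hs, fun z z' hz => h z z' fun v hv => hz v (hV hv)⟩

theorem DependsOn.add (h₁ : DependsOn Q σ V) (h₂ : DependsOn Q τ V) : DependsOn Q (σ + τ) V := by
  obtain ⟨s, rfl, hs⟩ := h₁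
  obtain ⟨t, rfl, ht⟩ := h₂
  exact ⟨s + t, rfl, fun z z' hz => by rw [Pi.add_apply, Pi.add_apply, hs z z' hz, ht z z' hz]⟩

theorem DependsOn.mul (h₁ : DependsOn Q σ V) (h₂ : DependsOn Q τ V) : DependsOn Q (σ * τ) V := by
  obtain ⟨s, rfl, hs⟩ := h₁
  obtain ⟨t, rfl, ht⟩ := h₂
  exact ⟨s * t, rfl, fun z z' hz => by rw [Pi.mul_apply, Pi.mul_apply, hs z z' hz, ht z z' hz]⟩

theorem DependsOn.smul (r : ℝ) (h : DependsOn Q σ V) : DependsOn Q (r • σ) V := by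
  obtain ⟨s, rfl, hs⟩ := h
  exact ⟨r • s, rfl, fun z z' hz => by rw [Pi.smul_apply, Pi.smul_apply, hs z z' hz]⟩

theorem DependsOn.map (g : (NNReal → ℂ) → NNReal → ℂ) (h : DependsOn Q σ V) :
    DependsOn Q (Germ.map g σ) V := by
  obtain ⟨s, rfl, hs⟩ := h
  exact ⟨g ∘ s, rfl, fun z z' hz => by simp only [Function.comp_apply, hs z z' hz]⟩

theorem dependsOn_const (f : NNReal → ℂ) :
    DependsOn Q (((fun _ => f : (ℕ →₀ ℂ) → NNReal → ℂ)) : FunGerm Q) V :=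
  ⟨fun _ => f, rfl, fun _ _ _ => rfl⟩

/-- A germ that depends only on the linear forms in `V₁`, and only on those in `V₂`, depends only on
those in `V₁ ⊓ V₂`. -/
theorem DependsOn.inf (hpos : ∀ v, v ≠ 0 → 0 < Q v v) (hV₁ : FiniteDimensional ℝ V₁)
    (hV₂ : FiniteDimensional ℝ V₂) (h₁ : DependsOn Q σ V₁) (h₂ : DependsOn Q σ V₂) :
    DependsOn Q σ (V₁ ⊓ V₂) := by
  classical
  obtain ⟨s₁, rfl, hs₁⟩ := h₁
  obtain ⟨s₂, hs, hs₂⟩ := h₂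
  obtain ⟨n₁, hn₁⟩ := exists_le_range_emb V₁ hV₁
  obtain ⟨n₂, hn₂⟩ := exists_le_range_emb V₂ hV₂
  obtain ⟨n₃, hn₃⟩ := exists_of_eventually (Germ.coe_eq.1 hs)
  let n := max n₁ (max n₂ n₃)
  have hn1 : n₁ ≤ n := le_max_left _ _
  have hn2 : n₂ ≤ n := (le_max_left _ _).trans (le_max_right _ _)
  have hn3 : n₃ ≤ n := (le_max_right _ _).trans (le_max_right _ _)
  clear_value n
  replace hn₁ := hn₁ n hn1
  replace hn₂ := hn₂ n hn2
  obtain ⟨r, hr, L, hL, hrL⟩ := hn₃ n hn3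
  let W₁ := V₁.comap (emb n)
  let W₂ := V₂.comap (emb n)
  obtain ⟨π, hπ₁, hπ₂⟩ := exists_splitting W₁ W₂
  obtain ⟨η, hη, hηL⟩ := exists_orthogonal_generic W₂ L
  have hβ : ContinuousAt (dualMap π) 0 := (continuous_dualMap π).continuousAt
  obtain ⟨ρ, hρ, hβ⟩ := Metric.continuousAt_iff.1 hβ (r / 4) (by positivity)
  let r' := min (r / 4) (ρ / 2)
  let G : (ℕ →₀ ℂ) → Prop := fun z =>
    coords Q n z ∈ Metric.ball 0 r' ∧ ∀ u ∈ L, dot u (coords Q n z) ≠ 0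
  have hr' : 0 < r' := lt_min (by positivity) (by positivity)
  have hG : ∀ᶠ z in genericNhds Q, G z :=
    (eventually_coords_mem_ball n hr').and (eventually_forall_dot_ne_zero hL)
  have key : ∀ z z', G z → G z' →
      (∀ v ∈ V₁ ⊓ V₂, linForm Q v z = linForm Q v z') → s₁ z = s₁ z' := by
    intro z z' hz hz' hzz'
    set y := coords Q n z with hy
    set y' := coords Q n z' with hy'
    have hyy' : ∀ u ∈ W₁ ⊓ W₂, dot u (y' - y) = 0 := by
      intro u hu
      rw [dot_sub_right, hy, hy', ← linForm_emb, ← linForm_emb, hzz' _ hu, sub_self]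
    have hyr : ‖y‖ < r / 4 := (mem_ball_zero_iff.1 hz.1).trans_le (min_le_left _ _)
    have hyr' : ‖y'‖ < r / 4 := (mem_ball_zero_iff.1 hz'.1).trans_le (min_le_left _ _)
    have hyρ : ‖y‖ < ρ / 2 := (mem_ball_zero_iff.1 hz.1).trans_le (min_le_right _ _)
    have hyρ' : ‖y'‖ < ρ / 2 := (mem_ball_zero_iff.1 hz'.1).trans_le (min_le_right _ _)
    have hb : ‖dualMap π (y' - y)‖ < r / 4 := by
      have : dist (y' - y) 0 < ρ := by
        rw [dist_zero_right]
        exact (norm_sub_le _ _).trans_lt (by linarith)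
      simpa using hβ this
    -- `b` is invisible to the forms in `V₂` and looks like `y' - y` to those in `V₁`. Such a vector
    -- exists because `y' - y` is invisible to `V₁ ⊓ V₂`. So `y' - b` agrees with `y` on `V₁` and
    -- with `y'` on `V₂`.
    set b := dualMap π (y' - y) with hbdef
    have hb₂ : ∀ u ∈ W₂, dot u b = 0 := fun u hu => by
      rw [hbdef, dot_dualMap]; exact hyy' _ (hπ₂ u hu)
    have hb₁ : ∀ u ∈ W₁, dot u b = dot u (y' - y) := fun u hu => by
      rw [hbdef, dot_dualMap, hπ₁ u hu]
    -- The functions `s₁` and `s₂` agree only off the hyperplanes in `L`, and `y' - b` might lie on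
    -- one of them. A small multiple of `η`, invisible to `V₂`, moves it off. The same multiple is
    -- added to `y`, so that the two points still agree on `V₁`.
    have hev : ∀ᶠ t : ℝ in 𝓝[≠] 0, ‖(t : ℂ) • cvec η‖ < r / 4 ∧
        ∀ u ∈ L, dot u (y + (t : ℂ) • cvec η) ≠ 0 ∧
          dot u (y' - b + (t : ℂ) • cvec η) ≠ 0 := by
      refine Eventually.and ?_ ?_
      · apply eventually_nhdsWithin_of_eventually_nhds
        have hc : ContinuousAt (fun t : ℝ => ‖(t : ℂ) • cvec η‖) 0 := by fun_prop
        exact hc.eventually_lt continuousAt_const (by simpa using by positivity)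
      · have : ∀ u ∈ L, ∀ᶠ t : ℝ in 𝓝[≠] 0, dot u (y + (t : ℂ) • cvec η) ≠ 0 ∧
            dot u (y' - b + (t : ℂ) • cvec η) ≠ 0 := by
          intro u hu
          by_cases huW : u ∈ W₂
          · refine Eventually.of_forall fun t => ?_
            simp only [dot_add_right, dot_sub_right, dot_smul_right, hη u huW, hb₂ u huW, mul_zero,
              add_zero, sub_zero]
            exact ⟨hz.2 u hu, hz'.2 u hu⟩
          · simp only [dot_add_right, dot_smul_right]
            exact (eventually_affine_ne_zero _ _ (hηL u hu huW)).and
              (eventually_affine_ne_zero _ _ (hηL u hu huW))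
        have h := (eventually_all_finset L.toFinset).2 fun u hu => this u (List.mem_toFinset.1 hu)
        filter_upwards [h] with t ht u hu
        exact ht u (List.mem_toFinset.2 hu)
    obtain ⟨t, ht, htL⟩ := hev.exists
    obtain ⟨z₁, hz₁⟩ := coords_surjective hpos n (y + (t : ℂ) • cvec η)
    obtain ⟨z₂, hz₂⟩ := coords_surjective hpos n (y' - b + (t : ℂ) • cvec η)
    have e : ∀ w : ℕ →₀ ℂ, ‖coords Q n w‖ < r → (∀ u ∈ L, dot u (coords Q n w) ≠ 0) →
        s₁ w = s₂ w := fun w h1 h2 => hrL w (mem_ball_zero_iff.2 h1) h2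
    have e0 : s₁ z = s₂ z := e z (by rw [← hy]; linarith) hz.2
    have e3 : s₁ z' = s₂ z' := e z' (by rw [← hy']; linarith) hz'.2
    have e1 : s₁ z₁ = s₂ z₁ := by
      refine e z₁ ?_ fun u hu => ?_ <;> rw [hz₁]
      · exact (norm_add_le _ _).trans_lt (by linarith)
      · exact (htL u hu).1
    have e2 : s₁ z₂ = s₂ z₂ := by
      refine e z₂ ?_ fun u hu => ?_ <;> rw [hz₂]
      · refine (norm_add_le _ _).trans_lt ?_
        have := norm_sub_le y' b
        linarith
      · exact (htL u hu).2
    have f1 : s₂ z = s₂ z₁ := by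
      refine hs₂ _ _ fun v hv => ?_
      obtain ⟨u, rfl⟩ := hn₂ hv
      rw [linForm_emb, linForm_emb, hz₁, ← hy, dot_add_right, dot_smul_right, hη u hv, mul_zero,
        add_zero]
    have f2 : s₁ z₁ = s₁ z₂ := by
      refine hs₁ _ _ fun v hv => ?_
      obtain ⟨u, rfl⟩ := hn₁ hv
      rw [linForm_emb, linForm_emb, hz₁, hz₂, dot_add_right, dot_add_right, dot_sub_right,
        hb₁ u hv, dot_sub_right, sub_sub_cancel]
    have f3 : s₂ z₂ = s₂ z' := by
      refine hs₂ _ _ fun v hv => ?_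
      obtain ⟨u, rfl⟩ := hn₂ hv
      rw [linForm_emb, linForm_emb, hz₂, ← hy', dot_add_right, dot_smul_right, hη u hv, mul_zero,
        add_zero, dot_sub_right, hb₂ u hv, sub_zero]
    -- The chain alternates between `s₂`, constant along moves invisible to `V₂`, and `s₁`, constant
    -- along the move invisible to `V₁`, and switches only at good points.
    rw [e0, f1, ← e1, f2, e2, f3, e3]
  -- The representative has to be constant on all fibres, not only on good points. It takes the
  -- value of `s₁` at a chosen good point of the fibre and `0` if there is none; the choice depends
  -- only on the fibre.
  refine ⟨fun z => if h : ∃ z', G z' ∧ ∀ v ∈ V₁ ⊓ V₂, linForm Q v z' = linForm Q v z then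
    s₁ h.choose else 0, ?_, fun z z' hzz' => ?_⟩
  · refine Germ.coe_eq.2 ?_
    filter_upwards [hG] with z hz
    have h : ∃ z', G z' ∧ ∀ v ∈ V₁ ⊓ V₂, linForm Q v z' = linForm Q v z := ⟨z, hz, fun _ _ => rfl⟩
    rw [dif_pos h]
    exact key _ _ hz h.choose_spec.1 fun v hv => (h.choose_spec.2 v hv).symm
  · have : (fun w => G w ∧ ∀ v ∈ V₁ ⊓ V₂, linForm Q v w = linForm Q v z) =
        fun w => G w ∧ ∀ v ∈ V₁ ⊓ V₂, linForm Q v w = linForm Q v z' := by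
      funext w
      refine propext (and_congr_right fun _ => forall₂_congr fun v hv => ?_)
      rw [hzz' v hv]
    simp only [this]

theorem dep_le (hV : FiniteDimensional ℝ V) (h : DependsOn Q σ V) : dep Q σ ≤ V :=
  sInf_le ⟨hV, h⟩

/-- The dependence space is attained. -/
theorem dependsOn_dep (hpos : ∀ v, v ≠ 0 → 0 < Q v v)
    (h : ∃ V : Submodule ℝ (ℕ →₀ ℝ), FiniteDimensional ℝ V ∧ DependsOn Q σ V) :
    FiniteDimensional ℝ (dep Q σ) ∧ DependsOn Q σ (dep Q σ) := by
  classical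
  -- A space of minimal dimension is contained in every other one, because the intersection with
  -- another one is again admissible and cannot have smaller dimension.
  obtain ⟨V, ⟨hV, hσ⟩, hmin⟩ := exists_minimalFor_of_wellFoundedLT
    (fun V : Submodule ℝ (ℕ →₀ ℝ) => FiniteDimensional ℝ V ∧ DependsOn Q σ V)
    (fun V => Module.finrank ℝ V) h
  have : dep Q σ = V := by
    refine le_antisymm (dep_le hV hσ) (le_sInf ?_)
    rintro W ⟨hW, hσW⟩
    have hfd : FiniteDimensional ℝ (V ⊓ W : Submodule ℝ (ℕ →₀ ℝ)) :=
      Submodule.finiteDimensional_inf_left V W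
    have h1 := hmin ⟨hfd, hσ.inf hpos hV hW hσW⟩ (Submodule.finrank_mono inf_le_left)
    have h2 := Submodule.eq_of_le_of_finrank_le inf_le_left h1
    exact h2 ▸ inf_le_right
  rw [this]
  exact ⟨hV, hσ⟩

/-- Without this the infimum defining `dep` might be over the empty set, and hence be the whole
space. -/
theorem exists_dependsOn {σ : FunGerm Q} (hσ : σ ∈ symbolGerms Q) :
    ∃ V : Submodule ℝ (ℕ →₀ ℝ), FiniteDimensional ℝ V ∧ DependsOn Q σ V := by
  induction hσ using Submodule.span_induction with
  | mem σ h =>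
    obtain ⟨n, r, ℓ, c, a, T, w, -, -, -, -, rfl⟩ := h
    refine ⟨Submodule.span ℝ {v | v ∈ w} ⊔ LinearMap.range (emb n), ?_, _, rfl,
      fun z z' hz => ?_⟩
    · have : FiniteDimensional ℝ (Submodule.span ℝ {v | v ∈ w}) :=
        FiniteDimensional.span_of_finite ℝ (List.finite_toSet w)
      infer_instance
    · have h1 : coords Q n z = coords Q n z' := by
        funext i
        refine hz _ (Submodule.mem_sup_right ⟨Pi.single i 1, ?_⟩)
        ext j
        simp only [emb, LinearMap.coe_mk, AddHom.coe_mk]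
        rw [Finset.sum_eq_single i]
        · simp
        · intro k _ hk; simp [hk]
        · simp
      have h2 : w.map (fun v => linForm Q v z) = w.map fun v => linForm Q v z' :=
        List.map_congr_left fun v hv => hz _ (Submodule.mem_sup_left (Submodule.subset_span hv))
      simp only [h1, h2]
  | zero => exact ⟨⊥, inferInstance, dependsOn_const 0⟩
  | add σ τ _ _ hσ hτ =>
    obtain ⟨V, hV, hσ⟩ := hσ
    obtain ⟨W, hW, hτ⟩ := hτ
    exact ⟨V ⊔ W, inferInstance, (hσ.mono le_sup_left).add (hτ.mono le_sup_right)⟩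
  | smul r σ _ hσ =>
    obtain ⟨V, hV, hσ⟩ := hσ
    exact ⟨V, hV, hσ.smul r⟩

/-- Independence, in terms of any space on which the second germ depends. -/
theorem perp_of_dependsOn (hV : FiniteDimensional ℝ V) (hτ : DependsOn Q τ V)
    (h : ∀ u ∈ dep Q σ, ∀ v ∈ V, Q u v = 0) : perp Q σ τ :=
  fun u hu v hv => h u hu v (dep_le hV hτ hv)

theorem perp_symm (hsymm : ∀ u v, Q u v = Q v u) (h : perp Q σ τ) : perp Q τ σ :=
  fun u hu v hv => (hsymm u v).trans (h v hv u hu)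

/-- The hypothesis `hf` covers sums, scalar multiples and products at once: each of these depends
only on the sum of the dependence spaces of `σ` and `τ`. -/
theorem perp_sup (hpos : ∀ v, v ≠ 0 → 0 < Q v v) {ρ f : FunGerm Q}
    (hσ : σ ∈ symbolGerms Q) (hτ : τ ∈ symbolGerms Q)
    (hf : ∀ V, DependsOn Q σ V → DependsOn Q τ V → DependsOn Q f V) (h₁ : perp Q ρ σ)
    (h₂ : perp Q ρ τ) : perp Q ρ f := by
  obtain ⟨hVσ, hσ⟩ := dependsOn_dep hpos (exists_dependsOn hσ)
  obtain ⟨hVτ, hτ⟩ := dependsOn_dep hpos (exists_dependsOn hτ)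
  refine perp_of_dependsOn (V := dep Q σ ⊔ dep Q τ) inferInstance
    (hf _ (hσ.mono le_sup_left) (hτ.mono le_sup_right)) fun u hu v hv => ?_
  obtain ⟨a, ha, b, hb, rfl⟩ := Submodule.mem_sup.1 hv
  rw [map_add, h₁ u hu a ha, h₂ u hu b hb, add_zero]

/-- An operation performed pointwise in `z` cannot enlarge the dependence space, so the summation
maps preserve independence for a reason that involves no analysis. -/
theorem perp_map (hpos : ∀ v, v ≠ 0 → 0 < Q v v)
    (g : (NNReal → ℂ) → NNReal → ℂ) {ρ : FunGerm Q} (hσ : σ ∈ symbolGerms Q)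
    (h : perp Q σ ρ) : perp Q (Germ.map g σ) ρ := by
  obtain ⟨hVσ, hσ⟩ := dependsOn_dep hpos (exists_dependsOn hσ)
  exact fun u hu v hv => h u (dep_le hVσ (hσ.map g) hu) v hv

/-- Apart from the unit, the only property that concerns symbols rather than general germs is
closure under independent products, here a hypothesis; the rest follows from the behaviour of
dependence spaces. -/
theorem isUnitalLocalityAlgebra_symbolGerms (hpos : ∀ v, v ≠ 0 → 0 < Q v v)
    (hsymm : ∀ u v, Q u v = Q v u)
    (hone : 1 ∈ symbolGerms Q)
    (hmul : ∀ σ ∈ symbolGerms Q, ∀ τ ∈ symbolGerms Q, perp Q σ τ → σ * τ ∈ symbolGerms Q) :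
    IsUnitalLocalityAlgebra (symbolGerms Q) (perp Q) where
  symm := fun _ _ _ _ h => perp_symm hsymm h
  polar_subspace := fun U hU => by
    refine ⟨{ carrier := polarSet (symbolGerms Q) (perp Q) U, zero_mem' := ?_,
              add_mem' := ?_, smul_mem' := ?_ }, rfl⟩
    · rintro σ τ ⟨hσ, hσ'⟩ ⟨hτ, hτ'⟩
      refine ⟨Submodule.add_mem _ hσ hτ, fun u hu => ?_⟩
      exact perp_sup hpos hσ hτ (fun V h1 h2 => h1.add h2) (hσ' u hu) (hτ' u hu)
    · refine ⟨Submodule.zero_mem _, fun u hu => ?_⟩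
      refine perp_of_dependsOn (V := ⊥) inferInstance (dependsOn_const 0) fun a _ v hv => ?_
      rw [(Submodule.mem_bot ℝ).1 hv, map_zero]
    · rintro r σ ⟨hσ, hσ'⟩
      refine ⟨Submodule.smul_mem _ r hσ, fun u hu => ?_⟩
      exact perp_sup hpos hσ hσ (fun V h1 _ => h1.smul r) (hσ' u hu) (hσ' u hu)
  mul_mem := hmul
  mul_mem_polar := fun U _ σ hσ τ hτ h => by
    refine ⟨hmul σ hσ.1 τ hτ.1 h, fun u hu => ?_⟩
    exact perp_sup hpos hσ.1 hτ.1 (fun V h1 h2 => h1.mul h2) (hσ.2 u hu) (hτ.2 u hu)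
  smul_mul := fun r u _ v _ _ => by
    induction u using Germ.inductionOn
    induction v using Germ.inductionOn
    exact congrArg (Germ.ofFun (l := genericNhds Q)) (funext fun z => smul_mul_assoc r _ _)
  one_mem := hone
  one_rel := fun u hu => by
    refine perp_symm hsymm (perp_of_dependsOn (V := ⊥) inferInstance (dependsOn_const 1) ?_)
    intro a _ v hv
    rw [(Submodule.mem_bot ℝ).1 hv, map_zero]

end Dep

end Locality

end

noncomputable section

namespace Locality

open Filter Topology MeasureTheory Set

/-! ### Derivatives of functions on `[0, ∞)` -/

section Dx

variable {f g : NNReal → ℂ}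

/-- The function `f` on `[0, ∞)` is smooth. -/
abbrev Smooth (f : NNReal → ℂ) : Prop := ContDiffOn ℝ ((⊤ : ℕ∞) : WithTop ℕ∞) (ext f) (Ici 0)

theorem ext_coe (f : NNReal → ℂ) (x : NNReal) : ext f x = f x := by simp [ext]

theorem dx_zero (f : NNReal → ℂ) : dx 0 f = ext f := iteratedDerivWithin_zero

theorem Smooth.hasDerivWithinAt (hf : Smooth f) (k : ℕ) {x : ℝ} (hx : 0 ≤ x) :
    HasDerivWithinAt (dx k f) (dx (k + 1) f x) (Ici 0) x := by
  have h := hf.differentiableOn_iteratedDerivWithin (m := k) (mod_cast WithTop.coe_lt_top _)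
    (uniqueDiffOn_Ici 0) x hx
  have := h.hasDerivWithinAt
  rwa [← iteratedDerivWithin_succ] at this

theorem Smooth.hasDerivAt (hf : Smooth f) (k : ℕ) {x : ℝ} (hx : 0 < x) :
    HasDerivAt (dx k f) (dx (k + 1) f x) x :=
  (hf.hasDerivWithinAt k hx.le).hasDerivAt (Ici_mem_nhds hx)

theorem Smooth.continuousOn (hf : Smooth f) (k : ℕ) : ContinuousOn (dx k f) (Ici 0) :=
  fun _ hx => (hf.hasDerivWithinAt k hx).continuousWithinAt

theorem Smooth.contDiffAt (hf : Smooth f) {x : ℝ} (hx : 0 < x) :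
    ContDiffAt ℝ ((⊤ : ℕ∞) : WithTop ℕ∞) (ext f) x :=
  (hf x hx.le).contDiffAt (Ici_mem_nhds hx)

theorem Smooth.dx_eq (hf : Smooth f) (k : ℕ) {x : ℝ} (hx : 0 < x) :
    dx k f x = iteratedDeriv k (ext f) x :=
  iteratedDerivWithin_eq_iteratedDeriv (uniqueDiffOn_Ici 0)
    ((hf.contDiffAt hx).of_le (mod_cast le_top)) hx.le

theorem ext_add (f g : NNReal → ℂ) : ext (f + g) = ext f + ext g := rfl

theorem ext_smul (c : ℂ) (f : NNReal → ℂ) : ext (c • f) = c • ext f := rfl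

theorem dx_add (hf : Smooth f) (hg : Smooth g) (k : ℕ) {x : ℝ} (hx : 0 ≤ x) :
    dx k (f + g) x = dx k f x + dx k g x :=
  iteratedDerivWithin_add hx (uniqueDiffOn_Ici 0) ((hf x hx).of_le (mod_cast le_top))
    ((hg x hx).of_le (mod_cast le_top))

theorem dx_smul (c : ℂ) (f : NNReal → ℂ) (k : ℕ) (x : ℝ) : dx k (c • f) x = c * dx k f x := by
  rw [dx, ext_smul, iteratedDerivWithin_const_smul_field]
  rfl

theorem ext_star (f : NNReal → ℂ) : ext (star f) = star (ext f) := rfl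

theorem dx_star (f : NNReal → ℂ) (k : ℕ) : dx k (star f) = star (dx k f) := by
  induction k with
  | zero => simp only [dx_zero, ext_star]
  | succ k ih =>
    funext x
    have ih' : iteratedDerivWithin k (ext (star f)) (Ici 0) =
        star (iteratedDerivWithin k (ext f) (Ici 0)) := ih
    rw [Pi.star_apply, dx, dx, iteratedDerivWithin_succ, ih', iteratedDerivWithin_succ]
    exact derivWithin.star (f := iteratedDerivWithin k (ext f) (Ici 0)) (x := x)

theorem Smooth.star (hf : Smooth f) : Smooth (star f) :=
  Complex.conjCLE.toContinuousLinearMap.contDiff.comp_contDiffOn hf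

end Dx

/-! ### Symbols -/

/-- The function `f` on `[0, ∞)` is a symbol of order `m`. -/
structure IsSym (m : ℝ) (f : NNReal → ℂ) : Prop where
  smooth : Smooth f
  bound : ∀ k : ℕ, ∃ C : ℝ, ∀ x : ℝ, 0 ≤ x → ‖dx k f x‖ ≤ C * (1 + x) ^ (m - k)

section Sym

variable {f g : NNReal → ℂ} {m m' : ℝ}

theorem IsSym.mono (hf : IsSym m f) (h : m ≤ m') : IsSym m' f := by
  refine ⟨hf.smooth, fun k => ?_⟩
  obtain ⟨C, hC⟩ := hf.bound k
  refine ⟨C, fun x hx => (hC x hx).trans ?_⟩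
  have hC0 : 0 ≤ C := by
    have := (norm_nonneg _).trans (hC 0 le_rfl)
    simpa using this
  gcongr
  linarith

theorem IsSym.add (hf : IsSym m f) (hg : IsSym m g) : IsSym m (f + g) := by
  refine ⟨hf.smooth.add hg.smooth, fun k => ?_⟩
  obtain ⟨C, hC⟩ := hf.bound k
  obtain ⟨D, hD⟩ := hg.bound k
  refine ⟨C + D, fun x hx => ?_⟩
  rw [dx_add hf.smooth hg.smooth k hx, add_mul]
  exact (norm_add_le _ _).trans (add_le_add (hC x hx) (hD x hx))

theorem IsSym.smul (c : ℂ) (hf : IsSym m f) : IsSym m (c • f) := by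
  refine ⟨contDiffOn_const.smul hf.smooth, fun k => ?_⟩
  obtain ⟨C, hC⟩ := hf.bound k
  refine ⟨‖c‖ * C, fun x hx => ?_⟩
  rw [dx_smul, norm_mul, mul_assoc]
  exact mul_le_mul_of_nonneg_left (hC x hx) (norm_nonneg c)

theorem IsSym.star (hf : IsSym m f) : IsSym m (star f) := by
  refine ⟨hf.smooth.star, fun k => ?_⟩
  obtain ⟨C, hC⟩ := hf.bound k
  refine ⟨C, fun x hx => ?_⟩
  rw [dx_star, Pi.star_apply, norm_star]
  exact hC x hx

theorem isSym_zero (m : ℝ) : IsSym m 0 := by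
  refine ⟨contDiffOn_const, fun k => ⟨0, fun x _ => ?_⟩⟩
  have : dx k 0 x = 0 := by
    simpa using dx_smul 0 0 k x
  simp [this]

end Sym

/-! ### Integrals over `[0, ∞)` against bounded functions -/

section Tail

theorem integral_Ioi_comp_add {E : Type*} [NormedAddCommGroup E] [NormedSpace ℝ E] (h : ℝ → E)
    (a x : ℝ) : ∫ t in Ioi a, h (x + t) = ∫ t in Ioi (x + a), h t := by
  rw [← (measurePreserving_add_left volume x).setIntegral_preimage_emb
    (MeasurableEquiv.addLeft x).measurableEmbedding h (Ioi (x + a))]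
  simp

theorem integrableOn_Ioi_comp_add {E : Type*} [NormedAddCommGroup E] (h : ℝ → E) (a x : ℝ) :
    IntegrableOn (fun t => h (x + t)) (Ioi a) ↔ IntegrableOn h (Ioi (x + a)) := by
  have := (measurePreserving_add_left volume x).integrableOn_comp_preimage
    (MeasurableEquiv.addLeft x).measurableEmbedding (f := h) (s := Ioi (x + a))
  simpa [Function.comp_def] using this

/-- The periodic Bernoulli function. -/
def periodic (J : ℕ) (t : ℝ) : ℂ := ((bernoulliFun J (Int.fract t) : ℝ) : ℂ)

theorem measurable_periodic (J : ℕ) : Measurable (periodic J) :=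
  Complex.measurable_ofReal.comp ((continuous_bernoulliFun J).measurable.comp measurable_fract)

theorem exists_periodic_bound (J : ℕ) : ∃ M : ℝ, 0 ≤ M ∧ ∀ t, ‖periodic J t‖ ≤ M := by
  obtain ⟨M, hM⟩ := isCompact_Icc.exists_bound_of_continuousOn
    (s := Icc (0 : ℝ) 1) (continuous_bernoulliFun J).continuousOn
  refine ⟨M, (norm_nonneg _).trans (hM 0 (by simp)), fun t => ?_⟩
  rw [periodic, Complex.norm_real]
  exact hM _ ⟨Int.fract_nonneg t, (Int.fract_lt_one t).le⟩

theorem periodic_add_one (J : ℕ) (t : ℝ) : periodic J (1 + t) = periodic J t := by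
  rw [periodic, periodic, add_comm, Int.fract_add_one]

theorem star_periodic (J : ℕ) (t : ℝ) : star (periodic J t) = periodic J t := by
  simp [periodic]

variable {β h : ℝ → ℂ} {s C M : ℝ}

theorem integrableOn_one_add_rpow (hs : s < -1) :
    IntegrableOn (fun t : ℝ => (1 + t) ^ s) (Ioi 0) := by
  rw [integrableOn_Ioi_comp_add (fun t : ℝ => t ^ s)]
  exact integrableOn_Ioi_rpow_of_lt hs (by norm_num)

theorem integral_one_add_rpow (hs : s < -1) {x : ℝ} (hx : 0 ≤ x) :
    ∫ t in Ioi (0 : ℝ), (1 + x + t) ^ s = (1 + x) ^ (s + 1) / (-(s + 1)) := by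
  rw [integral_Ioi_comp_add (fun t : ℝ => t ^ s), add_zero, integral_Ioi_rpow_of_lt hs (by linarith)]
  rw [div_neg, neg_div]

theorem aestronglyMeasurable_tail (hβ : Measurable β) (hc : ContinuousOn h (Ici 0)) {x : ℝ}
    (hx : 0 ≤ x) : AEStronglyMeasurable (fun t => β t * h (x + t)) (volume.restrict (Ioi 0)) := by
  refine hβ.aestronglyMeasurable.mul (ContinuousOn.aestronglyMeasurable ?_ measurableSet_Ioi)
  refine hc.comp (by fun_prop) fun t ht => ?_
  have : 0 < t := ht
  exact (by positivity : (0 : ℝ) ≤ x + t)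

theorem norm_tail_le (hM : ∀ t, ‖β t‖ ≤ M) (hC : ∀ t, 0 ≤ t → ‖h t‖ ≤ C * (1 + t) ^ s) {x t : ℝ}
    (hx : 0 ≤ x) (ht : 0 < t) : ‖β t * h (x + t)‖ ≤ M * C * (1 + x + t) ^ s := by
  rw [norm_mul, mul_assoc, add_assoc 1]
  exact mul_le_mul (hM t) (hC _ (by positivity)) (norm_nonneg _) ((norm_nonneg _).trans (hM t))

/-- Meant for `β` a periodic Bernoulli function and `h` a derivative of high order of a symbol: the
remainder of the Euler-MacLaurin formula then converges absolutely. -/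
theorem integrableOn_tail (hβ : Measurable β) (hM : ∀ t, ‖β t‖ ≤ M) (hc : ContinuousOn h (Ici 0))
    (hC : ∀ t, 0 ≤ t → ‖h t‖ ≤ C * (1 + t) ^ s) (hs : s < -1) {x : ℝ} (hx : 0 ≤ x) :
    IntegrableOn (fun t => β t * h (x + t)) (Ioi 0) := by
  have h1 : IntegrableOn (fun t : ℝ => M * C * (1 + x + t) ^ s) (Ioi 0) := by
    refine Integrable.const_mul ?_ _
    refine (integrableOn_Ioi_comp_add (fun t : ℝ => t ^ s) 0 (1 + x)).2 ?_
    exact integrableOn_Ioi_rpow_of_lt hs (by linarith)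
  refine Integrable.mono' h1 (aestronglyMeasurable_tail hβ hc hx) ?_
  filter_upwards [ae_restrict_mem measurableSet_Ioi] with t ht
  exact norm_tail_le hM hC hx ht

theorem norm_integral_tail_le (hM : ∀ t, ‖β t‖ ≤ M)
    (hC : ∀ t, 0 ≤ t → ‖h t‖ ≤ C * (1 + t) ^ s) (hs : s < -1) {x : ℝ} (hx : 0 ≤ x) :
    ‖∫ t in Ioi (0 : ℝ), β t * h (x + t)‖ ≤ M * C * ((1 + x) ^ (s + 1) / (-(s + 1))) := by
  rw [← integral_one_add_rpow hs hx, ← integral_const_mul]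
  refine norm_integral_le_of_norm_le ?_ ?_
  · refine Integrable.const_mul ?_ _
    refine (integrableOn_Ioi_comp_add (fun t : ℝ => t ^ s) 0 (1 + x)).2 ?_
    exact integrableOn_Ioi_rpow_of_lt hs (by linarith)
  · filter_upwards [ae_restrict_mem measurableSet_Ioi] with t ht
    exact norm_tail_le hM hC hx ht

theorem tendsto_one_add_rpow {s : ℝ} (hs : s < 0) :
    Tendsto (fun x : ℝ => (1 + x) ^ s) atTop (𝓝 0) := by
  have h := (tendsto_rpow_neg_atTop (y := -s) (by linarith)).comp
    (tendsto_atTop_add_const_left atTop 1 tendsto_id)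
  simpa [Function.comp_def] using h

end Tail

/-! ### The Euler-MacLaurin formula -/

section EulerMaclaurin

variable {f g : NNReal → ℂ} {m : ℝ} {J : ℕ}

/-- The remainder integral of the Euler-MacLaurin formula. -/
def remainder (J : ℕ) (f : NNReal → ℂ) (x : ℝ) : ℂ :=
  ∫ t in Ioi (0 : ℝ), periodic J t * dx J f (x + t)

/-- The coefficients `B_{j+1} / (j+1)!` of the Euler-MacLaurin formula. -/
def emCoeff (j : ℕ) : ℂ := ((bernoulli' (j + 1) : ℚ) : ℂ) / ((j + 1).factorial : ℂ)

theorem star_emCoeff (j : ℕ) : star (emCoeff j) = emCoeff j := by simp [emCoeff]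

theorem eulerMaclaurin_eq (J : ℕ) (f : NNReal → ℂ) (x : ℝ) :
    eulerMaclaurin J f x = (∫ t in (1 : ℝ)..x, ext f t) +
      (∑ j ∈ Finset.range J, emCoeff j * dx j f x) +
      (-1) ^ J / (J.factorial : ℂ) * remainder J f x := rfl

/-- Integration by parts with `B_{J+1}' = (J + 1) B_J`; it raises the level of the formula by one.
-/
theorem intervalIntegral_bernoulliFun_mul_dx_succ (hf : Smooth f) (J : ℕ) {x : ℝ} (hx : 0 ≤ x) :
    ∫ t in (0 : ℝ)..1, ((bernoulliFun (J + 1) t : ℝ) : ℂ) * dx (J + 1) f (x + t) =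
      ((bernoulliFun (J + 1) 1 : ℝ) : ℂ) * dx J f (x + 1) -
        ((bernoulliFun (J + 1) 0 : ℝ) : ℂ) * dx J f x -
      (J + 1) * ∫ t in (0 : ℝ)..1, ((bernoulliFun J t : ℝ) : ℂ) * dx J f (x + t) := by
  have hcont : ∀ k, ContinuousOn (fun t => dx k f (x + t)) (uIcc 0 1) := by
    intro k
    refine (hf.continuousOn k).comp (by fun_prop) fun t ht => ?_
    rw [uIcc_of_le zero_le_one] at ht
    exact add_nonneg hx ht.1
  have hB : Continuous fun t : ℝ => ((bernoulliFun J t : ℝ) : ℂ) :=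
    Complex.continuous_ofReal.comp (continuous_bernoulliFun J)
  rw [intervalIntegral.integral_mul_deriv_eq_deriv_mul_of_hasDerivAt
    (u := fun t => ((bernoulliFun (J + 1) t : ℝ) : ℂ))
    (u' := fun t => (J + 1) * ((bernoulliFun J t : ℝ) : ℂ)) (v := fun t => dx J f (x + t))
    (v' := fun t => dx (J + 1) f (x + t))]
  · simp [mul_assoc]
  · exact (Complex.continuous_ofReal.comp (continuous_bernoulliFun (J + 1))).continuousOn
  · exact hcont J
  · intro t _
    have h := (hasDerivAt_bernoulliFun (J + 1) t).ofReal_comp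
    simpa using h
  · intro t ht
    simp only [zero_le_one, min_eq_left, max_eq_right] at ht
    exact (hf.hasDerivAt J (by linarith [ht.1] : 0 < x + t)).comp_const_add x t
  · exact (continuous_const.mul hB).intervalIntegrable _ _
  · exact (hcont (J + 1)).intervalIntegrable

/-- The Euler-MacLaurin formula on an interval of length one. -/
theorem eulerMaclaurin_interval (hf : Smooth f) {x : ℝ} (hx : 0 ≤ x) (J : ℕ) :
    (∫ t in x..(x + 1), ext f t) +
      (∑ j ∈ Finset.range (J + 1), emCoeff j * (dx j f (x + 1) - dx j f x)) -
      (-1) ^ (J + 1) / ((J + 1).factorial : ℂ) *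
        ∫ t in (0 : ℝ)..1, ((bernoulliFun (J + 1) t : ℝ) : ℂ) * dx (J + 1) f (x + t) =
      ext f (x + 1) := by
  induction J with
  | zero =>
    rw [intervalIntegral_bernoulliFun_mul_dx_succ hf 0 hx]
    have h1 : ∫ t in (0 : ℝ)..1, ((bernoulliFun 0 t : ℝ) : ℂ) * dx 0 f (x + t) =
        ∫ t in x..(x + 1), ext f t := by
      simp [dx_zero, intervalIntegral.integral_comp_add_left (fun t => ext f t)]
    rw [h1]
    -- Here `B_1(1) = 1/2`, `B_1(0) = -1/2` and the coefficient is `1/2`, so the terms at `x` cancel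
    -- and those at `x + 1` add up to the value there.
    simp [dx_zero, bernoulliFun_one, emCoeff]
    ring
  | succ J ih =>
    rw [← ih, intervalIntegral_bernoulliFun_mul_dx_succ hf (J + 1) hx,
      Finset.sum_range_succ _ (J + 1), bernoulliFun_endpoints_eq_of_ne_one (by omega),
      bernoulliFun_eval_zero, bernoulli_eq_bernoulli'_of_ne_one (by omega)]
    have hfac : ((J + 1 + 1).factorial : ℂ) = (J + 1 + 1) * ((J + 1).factorial : ℂ) := by
      rw [Nat.factorial_succ]; push_cast; ring
    have hne : ((J + 1).factorial : ℂ) ≠ 0 := Nat.cast_ne_zero.2 (Nat.factorial_ne_zero _)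
    have hne' : (J + 1 + 1 : ℂ) ≠ 0 := by
      have := Nat.cast_ne_zero (R := ℂ).2 (Nat.succ_ne_zero (J + 1))
      push_cast at this
      exact this
    -- The boundary terms carry a sign that the sum does not have. It is harmless, since Bernoulli
    -- numbers of odd index at least `3` vanish.
    have hb : ((bernoulli' (J + 1 + 1) : ℚ) : ℂ) * (-1) ^ (J + 1 + 1) =
        ((bernoulli' (J + 1 + 1) : ℚ) : ℂ) := by
      rcases Nat.even_or_odd (J + 1 + 1) with he | ho
      · rw [he.neg_one_pow, mul_one]
      · rw [bernoulli'_eq_zero_of_odd ho (by omega)]; simp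
    have hb' : (((bernoulli' (J + 1 + 1) : ℚ) : ℝ) : ℂ) = ((bernoulli' (J + 1 + 1) : ℚ) : ℂ) := by
      simp
    rw [hb', emCoeff, hfac]
    generalize ((bernoulli' (J + 1 + 1) : ℚ) : ℂ) = b at *
    generalize (∫ t in (0 : ℝ)..1, ((bernoulliFun (J + 1) t : ℝ) : ℂ) * dx (J + 1) f (x + t)) = I
    generalize dx (J + 1) f (x + 1) = u
    generalize dx (J + 1) f x = v
    generalize (∑ j ∈ Finset.range (J + 1), emCoeff j * (dx j f (x + 1) - dx j f x)) = S
    rw [← sub_eq_zero]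
    push_cast
    field_simp
    linear_combination (-(u - v)) * hb

theorem IsSym.integrableOn_remainder (hf : IsSym m f) (hJ : m + 1 < J) {x : ℝ} (hx : 0 ≤ x) :
    IntegrableOn (fun t => periodic J t * dx J f (x + t)) (Ioi 0) := by
  obtain ⟨M, -, hM⟩ := exists_periodic_bound J
  obtain ⟨C, hC⟩ := hf.bound J
  exact integrableOn_tail (measurable_periodic J) hM (hf.smooth.continuousOn J) hC (by linarith) hx

theorem IsSym.tendsto_remainder (hf : IsSym m f) (hJ : m + 1 < J) :
    Tendsto (remainder J f) atTop (𝓝 0) := by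
  obtain ⟨M, -, hM⟩ := exists_periodic_bound J
  obtain ⟨C, hC⟩ := hf.bound J
  have hs : m - J < -1 := by linarith
  refine squeeze_zero_norm' (a := fun x => M * C * ((1 + x) ^ (m - J + 1) / (-(m - J + 1)))) ?_ ?_
  · filter_upwards [eventually_ge_atTop 0] with x hx
    exact norm_integral_tail_le hM hC hs hx
  · have := ((tendsto_one_add_rpow (s := m - J + 1) (by linarith)).div_const
      (-(m - J + 1))).const_mul (M * C)
    simpa using this

/-- By periodicity the remainder at `x + 1` is the integral for `x` taken over `(1, ∞)`, and on the
missing interval the fractional part is `t` itself. -/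
theorem IsSym.remainder_sub (hf : IsSym m f) (hJ : m + 1 < J) {x : ℝ} (hx : 0 ≤ x) :
    remainder J f x - remainder J f (x + 1) =
      ∫ t in (0 : ℝ)..1, ((bernoulliFun J t : ℝ) : ℂ) * dx J f (x + t) := by
  have h1 : remainder J f (x + 1) = ∫ t in Ioi (1 : ℝ), periodic J t * dx J f (x + t) := by
    have := integral_Ioi_comp_add (fun t => periodic J t * dx J f (x + t)) 0 1
    simp only [periodic_add_one, add_zero, ← add_assoc] at this
    exact this
  have hi := hf.integrableOn_remainder hJ hx
  rw [h1, remainder, ← Ioc_union_Ioi_eq_Ioi zero_le_one,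
    setIntegral_union Ioc_disjoint_Ioi_same measurableSet_Ioi
      (hi.mono_set Ioc_subset_Ioi_self) (hi.mono_set (Ioi_subset_Ioi zero_le_one)),
    add_sub_cancel_right, intervalIntegral.integral_of_le zero_le_one,
    integral_Ioc_eq_integral_Ioo, integral_Ioc_eq_integral_Ioo]
  refine setIntegral_congr_fun measurableSet_Ioo fun t ht => ?_
  simp only [periodic, Int.fract_eq_self.2 ⟨ht.1.le, ht.2⟩]

theorem Smooth.intervalIntegrable (hf : Smooth f) {a b : ℝ} (ha : 0 ≤ a) (hb : 0 ≤ b) :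
    IntervalIntegrable (ext f) volume a b := by
  have h := hf.continuousOn 0
  rw [dx_zero] at h
  refine (h.mono fun t ht => ?_).intervalIntegrable
  exact (le_min ha hb).trans ht.1

theorem IsSym.eulerMaclaurin_add_one (hf : IsSym m f) (hJ : m + 1 < J) (hJ0 : J ≠ 0) {x : ℝ}
    (hx : 0 ≤ x) : eulerMaclaurin J f (x + 1) = eulerMaclaurin J f x + ext f (x + 1) := by
  obtain ⟨J, rfl⟩ := Nat.exists_eq_succ_of_ne_zero hJ0
  have h := eulerMaclaurin_interval hf.smooth hx J
  rw [← hf.remainder_sub hJ hx] at h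
  have h1 := intervalIntegral.integral_add_adjacent_intervals
    (hf.smooth.intervalIntegrable zero_le_one hx)
    (hf.smooth.intervalIntegrable hx (by linarith : (0 : ℝ) ≤ x + 1))
  rw [eulerMaclaurin_eq, eulerMaclaurin_eq, ← h, ← h1]
  simp only [mul_sub, Finset.sum_sub_distrib, Nat.succ_eq_add_one]
  ring

/-- Applied to the difference of the sums of two consecutive levels. Both solve the same difference
equation, so their difference has period one, and it decays since only a derivative and two
remainders are left. -/
theorem eq_zero_of_periodic {D : ℝ → ℂ} (h1 : ∀ x, 0 ≤ x → D (x + 1) = D x)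
    (h2 : Tendsto D atTop (𝓝 0)) {x : ℝ} (hx : 0 ≤ x) : D x = 0 := by
  have h3 : ∀ n : ℕ, D (x + n) = D x := by
    intro n
    induction n with
    | zero => simp
    | succ n ih => rw [Nat.cast_succ, ← add_assoc, h1 _ (by positivity), ih]
  have h4 : Tendsto (fun n : ℕ => D (x + n)) atTop (𝓝 0) :=
    h2.comp (tendsto_atTop_add_const_left _ _ tendsto_natCast_atTop_atTop)
  simp only [h3] at h4
  exact tendsto_nhds_unique tendsto_const_nhds h4

theorem IsSym.tendsto_dx (hf : IsSym m f) (hJ : m < J) : Tendsto (dx J f) atTop (𝓝 0) := by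
  obtain ⟨C, hC⟩ := hf.bound J
  refine squeeze_zero_norm' (a := fun x => C * (1 + x) ^ (m - J)) ?_ ?_
  · filter_upwards [eventually_ge_atTop 0] with x hx
    exact hC x hx
  · simpa using (tendsto_one_add_rpow (s := m - J) (by linarith)).const_mul C

theorem IsSym.eulerMaclaurin_succ (hf : IsSym m f) (hJ : m + 1 < J) (hJ0 : J ≠ 0) {x : ℝ}
    (hx : 0 ≤ x) : eulerMaclaurin (J + 1) f x = eulerMaclaurin J f x := by
  have hJ' : m + 1 < (J + 1 : ℕ) := by push_cast; linarith
  rw [← sub_eq_zero]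
  refine eq_zero_of_periodic (D := fun x => eulerMaclaurin (J + 1) f x - eulerMaclaurin J f x)
    (fun x hx => ?_) ?_ hx
  · rw [hf.eulerMaclaurin_add_one hJ hJ0 hx, hf.eulerMaclaurin_add_one hJ' (by omega) hx]
    ring
  · have h := (((hf.tendsto_dx (by linarith : m < J)).const_mul (emCoeff J)).add
      ((hf.tendsto_remainder hJ').const_mul ((-1) ^ (J + 1) / ((J + 1).factorial : ℂ)))).sub
      ((hf.tendsto_remainder hJ).const_mul ((-1) ^ J / (J.factorial : ℂ)))
    simp only [mul_zero, add_zero, sub_zero] at h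
    refine h.congr fun x => ?_
    rw [eulerMaclaurin_eq, eulerMaclaurin_eq, Finset.sum_range_succ]
    ring

theorem IsSym.eulerMaclaurin_eq_of_le (hf : IsSym m f) (hJ : m + 1 < J) (hJ0 : J ≠ 0) {x : ℝ}
    (hx : 0 ≤ x) {J' : ℕ} (h : J ≤ J') : eulerMaclaurin J' f x = eulerMaclaurin J f x := by
  induction J', h using Nat.le_induction with
  | base => rfl
  | succ J' h ih =>
    have : (J : ℝ) ≤ J' := by exact_mod_cast h
    rw [hf.eulerMaclaurin_succ (by linarith) (by omega) hx, ih]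

theorem IsSym.sumOne_eq (hf : IsSym m f) (hJ : m + 1 < J) (hJ0 : J ≠ 0) (x : NNReal) :
    sumOne f x = f 1 + (eulerMaclaurin J f x - eulerMaclaurin J f 1) := by
  rw [sumOne]
  congr 1
  refine Tendsto.limUnder_eq (tendsto_const_nhds.congr' ?_)
  filter_upwards [eventually_ge_atTop J] with J' hJ'
  rw [hf.eulerMaclaurin_eq_of_le hJ hJ0 x.coe_nonneg hJ', hf.eulerMaclaurin_eq_of_le hJ hJ0 zero_le_one hJ']

/-- Level `0` has to be excluded separately. It satisfies the inequality when `m < -1`, but the sum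
of level `0` is `∫_1^x f + ∫_x^∞ f`, which does not depend on `x`. -/
theorem exists_level (m : ℝ) : ∃ J : ℕ, m + 1 < J ∧ J ≠ 0 := by
  obtain ⟨J, hJ⟩ := exists_nat_gt (m + 1)
  refine ⟨J + 1, ?_, by omega⟩
  push_cast
  linarith

theorem IsSym.sumOne_add_one (hf : IsSym m f) (x : NNReal) :
    sumOne f (x + 1) = sumOne f x + f (x + 1) := by
  obtain ⟨J, hJ, hJ0⟩ := exists_level m
  have h : ((x + 1 : NNReal) : ℝ) = x + 1 := by simp
  rw [hf.sumOne_eq hJ hJ0, hf.sumOne_eq hJ hJ0, h, hf.eulerMaclaurin_add_one hJ hJ0 x.coe_nonneg, ← h,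
    ext_coe]
  ring

theorem IsSym.sumOne_one (hf : IsSym m f) : sumOne f 1 = f 1 := by
  obtain ⟨J, hJ, hJ0⟩ := exists_level m
  rw [hf.sumOne_eq hJ hJ0]
  simp

theorem IsSym.sumOne_nat (hf : IsSym m f) (n : ℕ) (hn : 1 ≤ n) :
    sumOne f n = ∑ k ∈ Finset.Icc 1 n, f k := by
  induction n, hn using Nat.le_induction with
  | base => simp [hf.sumOne_one]
  | succ n hn ih =>
    rw [Finset.sum_Icc_succ_top (by omega), ← ih, Nat.cast_succ, hf.sumOne_add_one]

theorem IsSym.summation_nat (hf : IsSym m f) {lam : ℤ} (hlam : lam = 1 ∨ lam = -1) (n : ℕ)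
    (hn : 1 ≤ n) : summation lam f n = discreteSum lam f n := by
  rcases hlam with rfl | rfl
  · simp only [summation, discreteSum, if_true, hf.sumOne_nat n hn]
  · have h : ¬ (-1 : ℤ) = 1 := by norm_num
    simp only [summation, discreteSum, h, if_false, Pi.sub_apply, hf.sumOne_nat n hn]
    have := Finset.sum_Ico_succ_top (f := fun k : ℕ => f k) hn
    rw [show Finset.Icc 1 n = Finset.Ico 1 (n + 1) from rfl, this]
    ring

theorem IsSym.eulerMaclaurin_add (hf : IsSym m f) (hg : IsSym m g) (hJ : m + 1 < J) {x : ℝ}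
    (hx : 0 ≤ x) :
    eulerMaclaurin J (f + g) x = eulerMaclaurin J f x + eulerMaclaurin J g x := by
  have h1 : ∫ t in (1 : ℝ)..x, ext (f + g) t =
      (∫ t in (1 : ℝ)..x, ext f t) + ∫ t in (1 : ℝ)..x, ext g t :=
    intervalIntegral.integral_add (hf.smooth.intervalIntegrable zero_le_one hx)
      (hg.smooth.intervalIntegrable zero_le_one hx)
  have h2 : remainder J (f + g) x = remainder J f x + remainder J g x := by
    rw [remainder, remainder, remainder, ← integral_add (hf.integrableOn_remainder hJ hx)
      (hg.integrableOn_remainder hJ hx)]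
    refine setIntegral_congr_fun measurableSet_Ioi fun t ht => ?_
    have : 0 ≤ x + t := add_nonneg hx (le_of_lt ht)
    simp only [dx_add hf.smooth hg.smooth J this, mul_add]
  simp only [eulerMaclaurin_eq, h1, h2, dx_add hf.smooth hg.smooth _ hx, mul_add,
    Finset.sum_add_distrib]
  ring

theorem eulerMaclaurin_smul (c : ℂ) (f : NNReal → ℂ) (J : ℕ) (x : ℝ) :
    eulerMaclaurin J (c • f) x = c * eulerMaclaurin J f x := by
  simp only [eulerMaclaurin_eq, remainder, dx_smul, ext_smul, Pi.smul_apply, smul_eq_mul,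
    intervalIntegral.integral_const_mul, mul_left_comm _ c, integral_const_mul]
  rw [← Finset.mul_sum]
  ring

theorem eulerMaclaurin_star (f : NNReal → ℂ) (J : ℕ) (x : ℝ) :
    eulerMaclaurin J (star f) x = star (eulerMaclaurin J f x) := by
  have h1 : ∫ t in (1 : ℝ)..x, ext (star f) t = star (∫ t in (1 : ℝ)..x, ext f t) := by
    simp only [ext_star, intervalIntegral, Pi.star_apply, star_sub, Complex.star_def]
    rw [← integral_conj, ← integral_conj]
  have h2 : remainder J (star f) x = star (remainder J f x) := by
    simp only [remainder, dx_star, Pi.star_apply, Complex.star_def]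
    rw [← integral_conj]
    simp only [map_mul]
    refine integral_congr_ae (Eventually.of_forall fun t => ?_)
    have := star_periodic J t
    rw [Complex.star_def] at this
    simp only [this]
  simp only [eulerMaclaurin_eq, h1, h2, dx_star, star_add, star_sum, star_mul', star_emCoeff,
    Pi.star_apply]
  simp

theorem IsSym.sumOne_add (hf : IsSym m f) (hg : IsSym m g) :
    sumOne (f + g) = sumOne f + sumOne g := by
  obtain ⟨J, hJ, hJ0⟩ := exists_level m
  funext x
  rw [Pi.add_apply, (hf.add hg).sumOne_eq hJ hJ0, hf.sumOne_eq hJ hJ0, hg.sumOne_eq hJ hJ0,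
    hf.eulerMaclaurin_add hg hJ x.coe_nonneg, hf.eulerMaclaurin_add hg hJ zero_le_one, Pi.add_apply]
  ring

theorem IsSym.sumOne_smul (c : ℂ) (hf : IsSym m f) : sumOne (c • f) = c • sumOne f := by
  obtain ⟨J, hJ, hJ0⟩ := exists_level m
  funext x
  rw [Pi.smul_apply, (hf.smul c).sumOne_eq hJ hJ0, hf.sumOne_eq hJ hJ0, eulerMaclaurin_smul,
    eulerMaclaurin_smul, Pi.smul_apply, smul_eq_mul, smul_eq_mul]
  ring

theorem sumOne_star (hf : IsSym m f) : sumOne (star f) = star (sumOne f) := by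
  obtain ⟨J, hJ, hJ0⟩ := exists_level m
  funext x
  rw [Pi.star_apply, hf.star.sumOne_eq hJ hJ0, hf.sumOne_eq hJ hJ0, eulerMaclaurin_star,
    eulerMaclaurin_star, Pi.star_apply]
  simp

theorem IsSym.summation_add (lam : ℤ) (hf : IsSym m f) (hg : IsSym m g) :
    summation lam (f + g) = summation lam f + summation lam g := by
  unfold summation
  split_ifs
  · exact hf.sumOne_add hg
  · rw [hf.sumOne_add hg]; ring

theorem IsSym.summation_smul (lam : ℤ) (c : ℂ) (hf : IsSym m f) :
    summation lam (c • f) = c • summation lam f := by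
  unfold summation
  split_ifs
  · exact hf.sumOne_smul c
  · rw [hf.sumOne_smul c, smul_sub]

end EulerMaclaurin

end Locality

end

noncomputable section

namespace Locality

open Filter Topology MeasureTheory Set

/-! ### Holomorphic functions of several variables -/

section Holomorphic

variable {n : ℕ}

/-- Cauchy's estimate; the bound `C + C` appears because the values are compared with the value at
the centre. -/
theorem norm_fderiv_le_of_norm_le {E : Type*} [NormedAddCommGroup E] [NormedSpace ℂ E] {f : E → ℂ}
    {c : E} {R C : ℝ} (hR : 0 < R) (hd : DifferentiableOn ℂ f (Metric.ball c R))
    (hC : ∀ y ∈ Metric.ball c R, ‖f y‖ ≤ C) : ‖fderiv ℂ f c‖ ≤ (C + C) / R := by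
  refine Complex.norm_fderiv_le_div_of_mapsTo_ball hd (fun y hy => ?_) hR
  rw [Metric.mem_closedBall, dist_eq_norm]
  exact (norm_sub_le _ _).trans (add_le_add (hC y hy) (hC c (Metric.mem_ball_self hR)))

/-- One radius serves all centres near `y`, so that Cauchy's estimate is uniform there. -/
theorem exists_ball_subset {E : Type*} [PseudoMetricSpace E] {U : Set E} (hU : IsOpen U) {y : E}
    (hy : y ∈ U) :
    ∃ ρ : ℝ, 0 < ρ ∧ ∀ z ∈ Metric.ball y ρ, Metric.ball z ρ ⊆ U := by
  obtain ⟨ε, hε, h⟩ := Metric.isOpen_iff.1 hU y hy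
  refine ⟨ε / 2, by positivity, fun z hz w hw => h ?_⟩
  rw [Metric.mem_ball] at *
  linarith [dist_triangle w z y]

/-- By Cauchy's estimate, uniform convergence of holomorphic functions forces uniform convergence of
their derivatives on a smaller ball. -/
theorem differentiableOn_of_tendstoUniformlyOn {E : Type*} [NormedAddCommGroup E] [NormedSpace ℂ E]
    {U : Set E} (hU : IsOpen U) {F : ℕ → E → ℂ} {f : E → ℂ}
    (hF : ∀ k, DifferentiableOn ℂ (F k) U) (h : TendstoUniformlyOn F f atTop U) :
    DifferentiableOn ℂ f U := by
  intro y hy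
  obtain ⟨ρ, hρ, hball⟩ := exists_ball_subset hU hy
  have hyU : Metric.ball y ρ ⊆ U := hball y (Metric.mem_ball_self hρ)
  have hcauchy : UniformCauchySeqOn (fun k => fderiv ℂ (F k)) atTop (Metric.ball y ρ) := by
    rw [Metric.uniformCauchySeqOn_iff]
    intro ε hε
    obtain ⟨N, hN⟩ := (Metric.uniformCauchySeqOn_iff.1 h.uniformCauchySeqOn) (ε * ρ / 4)
      (by positivity)
    refine ⟨N, fun m hm k hk z hz => ?_⟩
    have hzU := hball z hz
    have hdm : DifferentiableAt ℂ (F m) z :=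
      (hF m).differentiableAt (hU.mem_nhds (hzU (Metric.mem_ball_self hρ)))
    have hdk : DifferentiableAt ℂ (F k) z :=
      (hF k).differentiableAt (hU.mem_nhds (hzU (Metric.mem_ball_self hρ)))
    rw [dist_eq_norm, ← fderiv_sub hdm hdk]
    refine (norm_fderiv_le_of_norm_le (C := ε * ρ / 4) hρ
      (((hF m).sub (hF k)).mono hzU) fun w hw => ?_).trans_lt ?_
    · have := hN m hm k hk w (hzU hw)
      rw [dist_eq_norm] at this
      exact this.le
    · rw [div_lt_iff₀ hρ]
      nlinarith [mul_pos hε hρ]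
  have hlim : ∀ z ∈ Metric.ball y ρ, ∃ L, Tendsto (fun k => fderiv ℂ (F k) z) atTop (𝓝 L) :=
    fun z hz => cauchySeq_tendsto_of_complete (hcauchy.cauchySeq hz)
  choose! g hg using hlim
  have hunif := hcauchy.tendstoUniformlyOn_of_tendsto hg
  have := hasFDerivAt_of_tendstoUniformlyOn (𝕜 := ℂ) Metric.isOpen_ball hunif
    (fun k z hz => ((hF k).differentiableAt (hU.mem_nhds (hyU hz))).hasFDerivAt)
    (fun z hz => h.tendsto_at (hyU hz)) (Metric.mem_ball_self hρ)
  exact this.differentiableAt.differentiableWithinAt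

theorem clm_eq_sum (L : (Fin n → ℂ) →L[ℂ] ℂ) :
    L = ∑ i, L (Pi.single i 1) • (ContinuousLinearMap.proj i : (Fin n → ℂ) →L[ℂ] ℂ) := by
  ext v
  have hv : v = ∑ i, v i • (Pi.single i 1 : Fin n → ℂ) := by
    ext j; simp [Finset.sum_apply, Pi.single_apply]
  conv_lhs => rw [hv, map_sum]
  simp [mul_comm]

/-- A bound for the integrand alone suffices: Cauchy's estimate turns it into a bound for the
derivative in the parameter, and differentiation under the integral applies. -/
theorem differentiableOn_integral {α : Type*} [MeasurableSpace α] {μ : Measure α}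
    {U : Set (Fin n → ℂ)} (hU : IsOpen U) {g : (Fin n → ℂ) → α → ℂ} {bound : α → ℝ}
    (hmeas : ∀ y ∈ U, AEStronglyMeasurable (g y) μ)
    (hd : ∀ᵐ t ∂μ, DifferentiableOn ℂ (fun y => g y t) U)
    (hb : ∀ᵐ t ∂μ, ∀ y ∈ U, ‖g y t‖ ≤ bound t) (hint : Integrable bound μ) :
    DifferentiableOn ℂ (fun y => ∫ t, g y t ∂μ) U := by
  intro y hy
  obtain ⟨ρ, hρ, hball⟩ := exists_ball_subset hU hy
  have hyU : Metric.ball y ρ ⊆ U := hball y (Metric.mem_ball_self hρ)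
  have hderiv : ∀ᵐ t ∂μ, HasFDerivAt (fun y => g y t) (fderiv ℂ (fun y => g y t) y) y := by
    filter_upwards [hd] with t ht
    exact (ht.differentiableAt (hU.mem_nhds hy)).hasFDerivAt
  have hm' : AEStronglyMeasurable (fun t => fderiv ℂ (fun y => g y t) y) μ := by
    -- Measurability of the derivative in `t` is not assumed. Each partial derivative is a limit of
    -- difference quotients along steps `c k` smaller than `ρ`, and these are measurable.
    have hcoord : ∀ i : Fin n,
        AEStronglyMeasurable (fun t => fderiv ℂ (fun y => g y t) y (Pi.single i 1)) μ := by
      intro i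
      let c : ℕ → ℝ := fun k => ρ / (2 * ((k : ℝ) + 1))
      have hc0 : ∀ k, 0 < c k := fun k => by positivity
      have hcρ : ∀ k, c k < ρ := fun k => by
        rw [div_lt_iff₀ (by positivity)]
        nlinarith [(Nat.cast_nonneg k : (0 : ℝ) ≤ k)]
      have hclim : Tendsto c atTop (𝓝 0) := by
        have h := (tendsto_one_div_add_atTop_nhds_zero_nat (𝕜 := ℝ)).const_mul (ρ / 2)
        rw [mul_zero] at h
        refine h.congr fun k => ?_
        simp only [c]
        field_simp
      refine aestronglyMeasurable_of_tendsto_ae atTop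
        (f := fun k t => (c k : ℂ)⁻¹ * (g (y + (c k : ℂ) • Pi.single i 1) t - g y t))
        (fun k => ?_) ?_
      · refine ((hmeas _ (hyU ?_)).sub (hmeas y hy)).const_mul _
        rw [mem_ball_iff_norm, add_sub_cancel_left, norm_smul, Complex.norm_real,
          Real.norm_of_nonneg (hc0 k).le]
        have h1 : ‖(Pi.single i 1 : Fin n → ℂ)‖ = 1 := by simp [Pi.norm_single]
        rw [h1, mul_one]
        exact hcρ k
      · filter_upwards [hderiv] with t ht
        have h1 := ht.hasLineDerivAt (Pi.single i 1)
        have h2 := h1.tendsto_slope_zero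
        have h3 : Tendsto (fun k => (c k : ℂ)) atTop (𝓝[≠] 0) := by
          rw [tendsto_nhdsWithin_iff]
          refine ⟨?_, Eventually.of_forall fun k => ?_⟩
          · have := (Complex.continuous_ofReal.tendsto 0).comp hclim
            simpa [Function.comp_def] using this
          · simpa using (hc0 k).ne'
        exact h2.comp h3
    have heq : (fun t => fderiv ℂ (fun y => g y t) y) = fun t =>
        ∑ i, fderiv ℂ (fun y => g y t) y (Pi.single i 1) •
          (ContinuousLinearMap.proj i : (Fin n → ℂ) →L[ℂ] ℂ) := by
      funext t
      exact clm_eq_sum _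
    rw [heq]
    exact Finset.aestronglyMeasurable_fun_sum _ fun i _ => (hcoord i).smul_const _
  have := hasFDerivAt_integral_of_dominated_of_fderiv_le (𝕜 := ℂ) (μ := μ) (F := g)
    (F' := fun z t => fderiv ℂ (fun y => g y t) z) (x₀ := y) (s := Metric.ball y ρ)
    (bound := fun t => (bound t + bound t) / ρ) (Metric.ball_mem_nhds y hρ)
    (Filter.eventually_of_mem (hU.mem_nhds hy) hmeas)
    (Integrable.mono' hint (hmeas y hy) (hb.mono fun t ht => ht y hy)) hm' ?_
    ((hint.add hint).div_const ρ) ?_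
  · exact this.differentiableAt.differentiableWithinAt
  · filter_upwards [hd, hb] with t ht hbt z hz
    exact norm_fderiv_le_of_norm_le hρ (ht.mono (hball z hz)) fun w hw => hbt w (hball z hz hw)
  · filter_upwards [hd] with t ht z hz
    exact (ht.differentiableAt (hU.mem_nhds (hyU hz))).hasFDerivAt

end Holomorphic

/-! ### Uniform families of symbols -/

/-- A family of symbols of order `m` on `[0, ∞)`, uniformly in the parameter in `B`. -/
structure UnifSym {Y : Type*} (B : Set Y) (m : ℝ) (T : Y → NNReal → ℂ) : Prop where
  smooth : ∀ y ∈ B, Smooth (T y)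
  bound : ∀ k : ℕ, ∃ C : ℝ, ∀ y ∈ B, ∀ x : ℝ, 0 ≤ x → ‖dx k (T y) x‖ ≤ C * (1 + x) ^ (m - k)

section UnifSym

variable {n : ℕ} {Y : Type*} {m : ℝ} {T : Y → NNReal → ℂ} {B : Set Y}

theorem UnifSym.isSym (h : UnifSym B m T) {y : Y} (hy : y ∈ B) : IsSym m (T y) :=
  ⟨h.smooth y hy, fun k => (h.bound k).imp fun _ hC => hC y hy⟩

theorem rpow_le_of_mem {x R m : ℝ} (hx : 1 ≤ x) (hR : x ≤ R) : x ^ m ≤ R ^ |m| := by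
  calc x ^ m ≤ x ^ |m| := Real.rpow_le_rpow_of_exponent_le hx (le_abs_self m)
    _ ≤ R ^ |m| := Real.rpow_le_rpow (by linarith) hR (abs_nonneg m)

theorem UnifSym.exists_bound_Icc (h : UnifSym B m T) (k : ℕ) (R : ℝ) :
    ∃ C : ℝ, 0 ≤ C ∧ ∀ y ∈ B, ∀ x ∈ Icc 0 R, ‖dx k (T y) x‖ ≤ C := by
  obtain ⟨C, hC⟩ := h.bound k
  refine ⟨|C| * (1 + |R|) ^ |m - k|, by positivity, fun y hy x hx => ?_⟩
  refine (hC y hy x hx.1).trans ?_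
  have h1 : 1 ≤ 1 + x := by linarith [hx.1]
  have h2 : 1 + x ≤ 1 + |R| := by linarith [hx.2, le_abs_self R]
  have h0 : 0 ≤ (1 + x) ^ (m - k) := Real.rpow_nonneg (by linarith) _
  calc C * (1 + x) ^ (m - k) ≤ |C| * (1 + x) ^ (m - k) :=
        mul_le_mul_of_nonneg_right (le_abs_self C) h0
    _ ≤ |C| * (1 + |R|) ^ |m - k| :=
        mul_le_mul_of_nonneg_left (rpow_le_of_mem h1 h2) (abs_nonneg C)

/-- The error depends only on a bound for the second derivative, so for a uniform family it is
uniform in the parameter. -/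
theorem norm_slope_sub_le {u u' u'' : ℝ → ℂ} {x h C : ℝ} (hh : 0 ≤ h)
    (hu : ∀ t ∈ Icc x (x + h), HasDerivWithinAt u (u' t) (Icc x (x + h)) t)
    (hu' : ∀ t ∈ Icc x (x + h), HasDerivWithinAt u' (u'' t) (Icc x (x + h)) t)
    (hC : ∀ t ∈ Icc x (x + h), ‖u'' t‖ ≤ C) :
    ‖u (x + h) - u x - h * u' x‖ ≤ C * h * h := by
  have hx : x ∈ Icc x (x + h) := ⟨le_rfl, by linarith⟩
  have hxh : x + h ∈ Icc x (x + h) := ⟨by linarith, le_rfl⟩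
  have hC0 : 0 ≤ C := (norm_nonneg _).trans (hC x hx)
  have h1 : ∀ t ∈ Icc x (x + h), ‖u' t - u' x‖ ≤ C * h := by
    intro t ht
    have := (convex_Icc x (x + h)).norm_image_sub_le_of_norm_hasDerivWithin_le hu' hC hx ht
    refine this.trans (mul_le_mul_of_nonneg_left ?_ hC0)
    rw [Real.norm_of_nonneg (by linarith [ht.1])]
    linarith [ht.2]
  have h2 := (convex_Icc x (x + h)).norm_image_sub_le_of_norm_hasDerivWithin_le
    (f := fun t => u t - ((t : ℂ) - x) * u' x) (f' := fun t => u' t - u' x) (fun t ht => ?_) h1 hx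
    hxh
  · have e : u (x + h) - u x - h * u' x =
        u (x + h) - (((x + h : ℝ) : ℂ) - x) * u' x - (u x - ((x : ℂ) - x) * u' x) := by
      push_cast
      ring
    rw [e]
    refine h2.trans (le_of_eq ?_)
    rw [add_sub_cancel_left, Real.norm_of_nonneg hh]
  · have h3 := ((hasDerivAt_id t).ofReal_comp.sub_const (x : ℂ)).mul_const (u' x)
    exact ((hu t ht).sub h3.hasDerivWithinAt).congr_deriv (by simp)

variable {U : Set (Fin n → ℂ)} {S : (Fin n → ℂ) → NNReal → ℂ}

/-- Holomorphy in `y` survives differentiation in `x`: the derivative is a limit of difference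
quotients, uniform in `y` because the derivative of order `k + 2` is bounded uniformly on `[0, x +
1]`. Only forward steps are taken, so that `x = 0` is allowed. -/
theorem UnifSym.differentiableOn_dx (hU : IsOpen U) (h : UnifSym U m S)
    (hol : ∀ x, DifferentiableOn ℂ (fun y => S y x) U) (k : ℕ) {x : ℝ} (hx : 0 ≤ x) :
    DifferentiableOn ℂ (fun y => dx k (S y) x) U := by
  induction k generalizing x with
  | zero => simp only [dx_zero]; exact hol _
  | succ k ih =>
    obtain ⟨C, hC0, hC⟩ := h.exists_bound_Icc (k + 2) (x + 1)
    let c : ℕ → ℝ := fun j => 1 / ((j : ℝ) + 1)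
    have hc0 : ∀ j, 0 < c j := fun j => by positivity
    have hc1 : ∀ j, c j ≤ 1 := fun j => by
      rw [div_le_iff₀ (by positivity)]
      linarith [(Nat.cast_nonneg j : (0 : ℝ) ≤ j)]
    refine differentiableOn_of_tendstoUniformlyOn hU
      (F := fun j y => (c j : ℂ)⁻¹ * (dx k (S y) (x + c j) - dx k (S y) x))
      (fun j => ((ih (by linarith [hc0 j])).sub (ih hx)).const_mul _) ?_
    rw [Metric.tendstoUniformlyOn_iff]
    intro ε hε
    have hlim : Tendsto (fun j => C * c j) atTop (𝓝 0) := by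
      simpa [c] using (tendsto_one_div_add_atTop_nhds_zero_nat (𝕜 := ℝ)).const_mul C
    filter_upwards [hlim.eventually_lt_const hε] with j hj y hy
    refine lt_of_le_of_lt ?_ hj
    have hsub : Icc x (x + c j) ⊆ Ici 0 := fun t ht => hx.trans ht.1
    have := norm_slope_sub_le (hc0 j).le
      (fun t ht => ((h.smooth y hy).hasDerivWithinAt k (hsub ht)).mono hsub)
      (fun t ht => ((h.smooth y hy).hasDerivWithinAt (k + 1) (hsub ht)).mono hsub)
      (fun t ht => hC y hy t ⟨hsub ht, ht.2.trans (by linarith [hc1 j])⟩)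
    have hne : (c j : ℂ) ≠ 0 := Complex.ofReal_ne_zero.2 (hc0 j).ne'
    have heq : dx (k + 1) (S y) x - (c j : ℂ)⁻¹ * (dx k (S y) (x + c j) - dx k (S y) x) =
        -((c j : ℂ)⁻¹ * (dx k (S y) (x + c j) - dx k (S y) x - c j * dx (k + 1) (S y) x)) := by
      field_simp
      ring
    rw [dist_eq_norm, heq, norm_neg, norm_mul, norm_inv, Complex.norm_real,
      Real.norm_of_nonneg (hc0 j).le]
    calc (c j)⁻¹ * _ ≤ (c j)⁻¹ * (C * c j * c j) :=
          mul_le_mul_of_nonneg_left this (inv_nonneg.2 (hc0 j).le)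
      _ = C * c j := by field_simp

theorem UnifSym.differentiableOn_remainder (hU : IsOpen U) (h : UnifSym U m S)
    (hol : ∀ x, DifferentiableOn ℂ (fun y => S y x) U) {J : ℕ} (hJ : m + 1 < J) {x : ℝ}
    (hx : 0 ≤ x) : DifferentiableOn ℂ (fun y => remainder J (S y) x) U := by
  obtain ⟨M, -, hM⟩ := exists_periodic_bound J
  obtain ⟨C, hC⟩ := h.bound J
  refine differentiableOn_integral hU (bound := fun t => M * C * (1 + x + t) ^ (m - J))
    (fun y hy => aestronglyMeasurable_tail (measurable_periodic J)
      ((h.smooth y hy).continuousOn J) hx) ?_ ?_ ?_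
  · filter_upwards [ae_restrict_mem measurableSet_Ioi] with t ht
    exact (h.differentiableOn_dx hU hol J (add_nonneg hx (le_of_lt ht))).const_mul _
  · filter_upwards [ae_restrict_mem measurableSet_Ioi] with t ht y hy
    exact norm_tail_le hM (hC y hy) hx ht
  · refine Integrable.const_mul ?_ _
    refine (integrableOn_Ioi_comp_add (fun t : ℝ => t ^ (m - J)) 0 (1 + x)).2 ?_
    exact integrableOn_Ioi_rpow_of_lt (by linarith) (by linarith)

theorem UnifSym.differentiableOn_intervalIntegral (hU : IsOpen U) (h : UnifSym U m S)
    (hol : ∀ x, DifferentiableOn ℂ (fun y => S y x) U) {a b : ℝ} (ha : 0 ≤ a) (hb : 0 ≤ b) :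
    DifferentiableOn ℂ (fun y => ∫ t in a..b, ext (S y) t) U := by
  obtain ⟨C, -, hC⟩ := h.exists_bound_Icc 0 (max a b)
  have hmem : ∀ t ∈ uIoc a b, t ∈ Icc 0 (max a b) := fun t ht =>
    ⟨(le_min ha hb).trans ht.1.le, ht.2⟩
  simp only [intervalIntegral.intervalIntegral_eq_integral_uIoc]
  refine DifferentiableOn.const_smul ?_ _
  refine differentiableOn_integral hU (bound := fun _ => C) (fun y hy => ?_) ?_ ?_ ?_
  · exact (intervalIntegrable_iff.1 ((h.smooth y hy).intervalIntegrable ha hb)).aestronglyMeasurable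
  · exact Eventually.of_forall fun t => hol _
  · filter_upwards [ae_restrict_mem measurableSet_uIoc] with t ht y hy
    have := hC y hy t (hmem t ht)
    rwa [dx_zero] at this
  · exact integrableOn_const (by simp [uIoc])

theorem UnifSym.differentiableOn_eulerMaclaurin (hU : IsOpen U) (h : UnifSym U m S)
    (hol : ∀ x, DifferentiableOn ℂ (fun y => S y x) U) {J : ℕ} (hJ : m + 1 < J) {x : ℝ}
    (hx : 0 ≤ x) : DifferentiableOn ℂ (fun y => eulerMaclaurin J (S y) x) U := by
  simp only [eulerMaclaurin_eq]
  refine ((h.differentiableOn_intervalIntegral hU hol zero_le_one hx).add ?_).add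
    ((h.differentiableOn_remainder hU hol hJ hx).const_mul _)
  exact DifferentiableOn.fun_sum fun j _ => (h.differentiableOn_dx hU hol j hx).const_mul _

theorem UnifSym.differentiableOn_sumOne (hU : IsOpen U) (h : UnifSym U m S)
    (hol : ∀ x, DifferentiableOn ℂ (fun y => S y x) U) (x : NNReal) :
    DifferentiableOn ℂ (fun y => sumOne (S y) x) U := by
  obtain ⟨J, hJ, hJ0⟩ := exists_level m
  refine DifferentiableOn.congr (f := fun y => S y 1 +
    (eulerMaclaurin J (S y) x - eulerMaclaurin J (S y) 1)) ?_ fun y hy =>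
      (h.isSym hy).sumOne_eq hJ hJ0 x
  exact (hol 1).add ((h.differentiableOn_eulerMaclaurin hU hol hJ x.coe_nonneg).sub
    (h.differentiableOn_eulerMaclaurin hU hol hJ zero_le_one))

end UnifSym

/-! ### Derivatives of the interpolated sums -/

section Tower

/-- A function with successive derivatives `G k` is smooth. -/
theorem contDiffOn_of_tower {G : ℕ → ℝ → ℂ} {s : Set ℝ} (hs : IsOpen s)
    (h : ∀ k, ∀ x ∈ s, HasDerivAt (G k) (G (k + 1) x) x) :
    ContDiffOn ℝ ((⊤ : ℕ∞) : WithTop ℕ∞) (G 0) s := by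
  have key : ∀ m k : ℕ, ContDiffOn ℝ m (G k) s := by
    intro m
    induction m with
    | zero => exact fun k => contDiffOn_zero.2 fun x hx => (h k x hx).continuousAt.continuousWithinAt
    | succ m ih =>
      intro k
      push_cast
      rw [contDiffOn_succ_iff_deriv_of_isOpen hs]
      refine ⟨fun x hx => (h k x hx).differentiableAt.differentiableWithinAt, by simp, ?_⟩
      exact (ih (k + 1)).congr fun x hx => (h k x hx).deriv
  exact contDiffOn_infty.2 fun m => key m 0

theorem iteratedDeriv_of_tower {G : ℕ → ℝ → ℂ} {s : Set ℝ} (hs : IsOpen s)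
    (h : ∀ k, ∀ x ∈ s, HasDerivAt (G k) (G (k + 1) x) x) (k : ℕ) {x : ℝ} (hx : x ∈ s) :
    iteratedDeriv k (G 0) x = G k x := by
  induction k generalizing x with
  | zero => simp
  | succ k ih =>
    rw [iteratedDeriv_succ, ← (h k x hx).deriv]
    refine EventuallyEq.deriv_eq ?_
    filter_upwards [hs.mem_nhds hx] with t ht
    exact ih ht

variable {β h h' : ℝ → ℂ} {s s' C C' M : ℝ}

theorem hasDerivAt_tail (hβ : Measurable β) (hM : ∀ t, ‖β t‖ ≤ M) (hc : ContinuousOn h (Ici 0))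
    (hc' : ContinuousOn h' (Ici 0)) (hd : ∀ t, 0 < t → HasDerivAt h (h' t) t)
    (hC : ∀ t, 0 ≤ t → ‖h t‖ ≤ C * (1 + t) ^ s) (hC' : ∀ t, 0 ≤ t → ‖h' t‖ ≤ C' * (1 + t) ^ s')
    (hs : s < -1) (hs' : s' < -1) {x : ℝ} (hx : 0 < x) :
    HasDerivAt (fun x => ∫ t in Ioi (0 : ℝ), β t * h (x + t))
      (∫ t in Ioi (0 : ℝ), β t * h' (x + t)) x := by
  have hC0 : 0 ≤ C' := by
    have := (norm_nonneg _).trans (hC' 0 le_rfl)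
    simpa using this
  have hM0 : 0 ≤ M := (norm_nonneg _).trans (hM 0)
  refine (hasDerivAt_integral_of_dominated_loc_of_deriv_le (s := Ioi 0)
    (μ := volume.restrict (Ioi 0)) (F := fun x t => β t * h (x + t))
    (F' := fun x t => β t * h' (x + t))
    (bound := fun t => M * C' * (1 + t) ^ s') (Ioi_mem_nhds hx) ?_
    (integrableOn_tail hβ hM hc hC hs hx.le) (aestronglyMeasurable_tail hβ hc' hx.le) ?_
    ((integrableOn_one_add_rpow hs').const_mul _) ?_).2
  · filter_upwards [Ioi_mem_nhds hx] with z hz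
    exact aestronglyMeasurable_tail hβ hc (le_of_lt hz)
  · filter_upwards [ae_restrict_mem measurableSet_Ioi] with t ht z hz
    have hz : 0 < z := hz
    have ht : 0 < t := ht
    refine (norm_tail_le hM hC' hz.le ht).trans ?_
    refine mul_le_mul_of_nonneg_left ?_ (mul_nonneg hM0 hC0)
    exact Real.rpow_le_rpow_of_nonpos (by linarith) (by linarith) (by linarith)
  · filter_upwards [ae_restrict_mem measurableSet_Ioi] with t ht z hz
    have hz : 0 < z := hz
    have ht : 0 < t := ht
    exact ((hd (z + t) (by linarith)).comp_add_const z t).const_mul _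

variable {f : NNReal → ℂ} {m : ℝ} {J : ℕ}

/-- The `k`-th derivative of `remainder J f`. -/
def remainderDeriv (J : ℕ) (f : NNReal → ℂ) (k : ℕ) (x : ℝ) : ℂ :=
  ∫ t in Ioi (0 : ℝ), periodic J t * dx (J + k) f (x + t)

theorem IsSym.hasDerivAt_remainderDeriv (hf : IsSym m f) (hJ : m + 1 < J) (k : ℕ) {x : ℝ}
    (hx : 0 < x) :
    HasDerivAt (remainderDeriv J f k) (remainderDeriv J f (k + 1) x) x := by
  obtain ⟨M, -, hM⟩ := exists_periodic_bound J
  obtain ⟨C, hC⟩ := hf.bound (J + k)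
  obtain ⟨C', hC'⟩ := hf.bound (J + (k + 1))
  refine hasDerivAt_tail (measurable_periodic J) hM (hf.smooth.continuousOn _)
    (hf.smooth.continuousOn _) (fun t ht => hf.smooth.hasDerivAt _ ht) hC hC' ?_ ?_ hx <;>
  · push_cast
    linarith [(Nat.cast_nonneg k : (0 : ℝ) ≤ k)]

theorem IsSym.contDiffOn_remainder (hf : IsSym m f) (hJ : m + 1 < J) :
    ContDiffOn ℝ ((⊤ : ℕ∞) : WithTop ℕ∞) (remainder J f) (Ioi 0) :=
  contDiffOn_of_tower (G := remainderDeriv J f) isOpen_Ioi fun k _ hx =>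
    hf.hasDerivAt_remainderDeriv hJ k hx

theorem Smooth.contDiffOn_dx (hf : Smooth f) (j : ℕ) :
    ContDiffOn ℝ ((⊤ : ℕ∞) : WithTop ℕ∞) (dx j f) (Ioi 0) :=
  contDiffOn_of_tower (G := fun k => dx (j + k) f) isOpen_Ioi fun k _ hx =>
    hf.hasDerivAt (j + k) hx

theorem Smooth.hasDerivAt_primitive (hf : Smooth f) {x : ℝ} (hx : 0 < x) :
    HasDerivAt (fun x => ∫ t in (1 : ℝ)..x, ext f t) (ext f x) x := by
  refine intervalIntegral.integral_hasDerivAt_right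
    (hf.intervalIntegrable zero_le_one hx.le) ?_ (hf.contDiffAt hx).continuousAt
  have h := (hf.continuousOn 0).mono Ioi_subset_Ici_self
  rw [dx_zero] at h
  exact h.stronglyMeasurableAtFilter isOpen_Ioi x hx

theorem Smooth.contDiffOn_primitive (hf : Smooth f) :
    ContDiffOn ℝ ((⊤ : ℕ∞) : WithTop ℕ∞) (fun x => ∫ t in (1 : ℝ)..x, ext f t) (Ioi 0) := by
  refine contDiffOn_of_tower
    (G := fun k => Nat.casesOn k (fun x => ∫ t in (1 : ℝ)..x, ext f t) fun k => dx k f)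
    isOpen_Ioi fun k x hx => ?_
  cases k with
  | zero =>
    change HasDerivAt (fun x => ∫ t in (1 : ℝ)..x, ext f t) (dx 0 f x) x
    rw [dx_zero]
    exact hf.hasDerivAt_primitive hx
  | succ k => exact hf.hasDerivAt k hx

theorem IsSym.contDiffOn_eulerMaclaurin (hf : IsSym m f) (hJ : m + 1 < J) :
    ContDiffOn ℝ ((⊤ : ℕ∞) : WithTop ℕ∞) (eulerMaclaurin J f) (Ioi 0) := by
  refine (hf.smooth.contDiffOn_primitive.add ?_).add
    (contDiffOn_const.mul (hf.contDiffOn_remainder hJ))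
  exact ContDiffOn.sum fun j _ => contDiffOn_const.mul (hf.smooth.contDiffOn_dx j)

/-- The formula for the interpolated sum gives smoothness on the open half-line. The difference
equation, read as `u x = v (x + 1)`, carries it to the endpoint `0`. -/
theorem contDiffOn_Ici_of_shift {u v : ℝ → ℂ} (hv : ContDiffOn ℝ ((⊤ : ℕ∞) : WithTop ℕ∞) v (Ioi 0))
    (h : ∀ x, 0 ≤ x → u x = v (x + 1)) : ContDiffOn ℝ ((⊤ : ℕ∞) : WithTop ℕ∞) u (Ici 0) := by
  refine ContDiffOn.congr (f := fun x => v (x + 1)) ?_ fun x hx => h x hx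
  refine hv.comp (by fun_prop) fun x hx => ?_
  have : 0 ≤ x := hx
  exact (by linarith : 0 < x + 1)

theorem IsSym.ext_sumOne (hf : IsSym m f) (hJ : m + 1 < J) (hJ0 : J ≠ 0) {x : ℝ} (hx : 0 ≤ x) :
    ext (sumOne f) x = f 1 + (eulerMaclaurin J f x - eulerMaclaurin J f 1) := by
  rw [ext, hf.sumOne_eq hJ hJ0, Real.coe_toNNReal x hx]

theorem IsSym.ext_sumOne_eq_sub (hf : IsSym m f) {x : ℝ} (hx : 0 ≤ x) :
    ext (sumOne f) x = ext (sumOne f) (x + 1) - ext f (x + 1) := by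
  rw [eq_sub_iff_add_eq, ext, ext, ext, Real.toNNReal_add hx zero_le_one, Real.toNNReal_one,
    hf.sumOne_add_one]

theorem IsSym.contDiffOn_sumOne (hf : IsSym m f) :
    ContDiffOn ℝ ((⊤ : ℕ∞) : WithTop ℕ∞) (ext (sumOne f)) (Ioi 0) := by
  obtain ⟨J, hJ, hJ0⟩ := exists_level m
  refine ContDiffOn.congr (f := fun x => f 1 + (eulerMaclaurin J f x - eulerMaclaurin J f 1)) ?_
    fun x hx => hf.ext_sumOne hJ hJ0 (le_of_lt hx)
  exact contDiffOn_const.add ((hf.contDiffOn_eulerMaclaurin hJ).sub contDiffOn_const)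

theorem IsSym.smooth_sumOne (hf : IsSym m f) : Smooth (sumOne f) :=
  contDiffOn_Ici_of_shift (hf.contDiffOn_sumOne.sub (hf.smooth.mono Ioi_subset_Ici_self))
    fun _ hx => hf.ext_sumOne_eq_sub hx

end Tower

end Locality

end

noncomputable section

namespace Locality

open Filter Topology MeasureTheory Set

/-! ### Uniform symbol estimates at infinity -/

section SymBound

variable {Y : Type*} {B : Set Y} {s s' : Y → ℝ} {g h : Y → ℝ → ℂ}

/-- The functions `g y` on `(0, ∞)` are smooth and are symbols of order `s y` at infinity, uniformly
in `y ∈ B`. -/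
def SymBound (B : Set Y) (s : Y → ℝ) (g : Y → ℝ → ℂ) : Prop :=
  (∀ y ∈ B, ContDiffOn ℝ ((⊤ : ℕ∞) : WithTop ℕ∞) (g y) (Ioi 0)) ∧
    ∀ k : ℕ, ∃ C : ℝ, ∀ y ∈ B, ∀ x : ℝ, 1 ≤ x → ‖iteratedDeriv k (g y) x‖ ≤ C * x ^ (s y - k)

/-- The function `c` is bounded on `B`. -/
def BddFun (B : Set Y) (c : Y → ℂ) : Prop := ∃ C : ℝ, ∀ y ∈ B, ‖c y‖ ≤ C

theorem contDiffAt_of_Ioi {u : ℝ → ℂ} (hu : ContDiffOn ℝ ((⊤ : ℕ∞) : WithTop ℕ∞) u (Ioi 0)) {x : ℝ}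
    (hx : 1 ≤ x) (k : ℕ) : ContDiffAt ℝ k u x :=
  ((hu x (zero_lt_one.trans_le hx)).contDiffAt
    (Ioi_mem_nhds (zero_lt_one.trans_le hx))).of_le (mod_cast le_top)

theorem SymBound.exists_nonneg (hg : SymBound B s g) (k : ℕ) : ∃ C : ℝ, 0 ≤ C ∧ ∀ y ∈ B, ∀ x : ℝ,
    1 ≤ x → ‖iteratedDeriv k (g y) x‖ ≤ C * x ^ (s y - k) := by
  obtain ⟨C, hC⟩ := hg.2 k
  refine ⟨|C|, abs_nonneg C, fun y hy x hx => (hC y hy x hx).trans ?_⟩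
  exact mul_le_mul_of_nonneg_right (le_abs_self C) (Real.rpow_nonneg (by linarith) _)

theorem SymBound.mono (hg : SymBound B s g) (h : ∀ y ∈ B, s y ≤ s' y) : SymBound B s' g := by
  refine ⟨hg.1, fun k => ?_⟩
  obtain ⟨C, hC0, hC⟩ := hg.exists_nonneg k
  refine ⟨C, fun y hy x hx => (hC y hy x hx).trans (mul_le_mul_of_nonneg_left ?_ hC0)⟩
  exact Real.rpow_le_rpow_of_exponent_le hx (by linarith [h y hy])

theorem SymBound.subset {B' : Set Y} (hg : SymBound B s g) (h : B' ⊆ B) : SymBound B' s g :=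
  ⟨fun y hy => hg.1 y (h hy), fun k => (hg.2 k).imp fun _ hC y hy => hC y (h hy)⟩

theorem SymBound.congr (hg : SymBound B s g) (h' : ∀ y ∈ B, ∀ x, 0 < x → h y x = g y x) :
    SymBound B s h := by
  refine ⟨fun y hy => (hg.1 y hy).congr fun x hx => h' y hy x hx, fun k => ?_⟩
  obtain ⟨C, hC⟩ := hg.2 k
  refine ⟨C, fun y hy x hx => ?_⟩
  have : EqOn (h y) (g y) (Ioi 0) := fun x hx => h' y hy x hx
  rw [this.iteratedDeriv_of_isOpen isOpen_Ioi k (zero_lt_one.trans_le hx)]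
  exact hC y hy x hx

theorem SymBound.add (hg : SymBound B s g) (hh : SymBound B s h) :
    SymBound B s (fun y x => g y x + h y x) := by
  refine ⟨fun y hy => (hg.1 y hy).add (hh.1 y hy), fun k => ?_⟩
  obtain ⟨C, hC⟩ := hg.2 k
  obtain ⟨D, hD⟩ := hh.2 k
  refine ⟨C + D, fun y hy x hx => ?_⟩
  have := iteratedDeriv_add (contDiffAt_of_Ioi (hg.1 y hy) hx k)
    (contDiffAt_of_Ioi (hh.1 y hy) hx k)
  have e : (fun x => g y x + h y x) = g y + h y := rfl
  beta_reduce
  rw [e, this, add_mul]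
  exact (norm_add_le _ _).trans (add_le_add (hC y hy x hx) (hD y hy x hx))

theorem SymBound.const_mul {c : Y → ℂ} (hc : BddFun B c) (hg : SymBound B s g) :
    SymBound B s (fun y x => c y * g y x) := by
  obtain ⟨D, hD⟩ := hc
  refine ⟨fun y hy => contDiffOn_const.mul (hg.1 y hy), fun k => ?_⟩
  obtain ⟨C, hC0, hC⟩ := hg.exists_nonneg k
  refine ⟨D * C, fun y hy x hx => ?_⟩
  beta_reduce
  rw [iteratedDeriv_const_mul_field, norm_mul, mul_assoc]
  exact mul_le_mul (hD y hy) (hC y hy x hx) (norm_nonneg _) ((norm_nonneg _).trans (hD y hy))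

theorem bddFun_const (c : ℂ) : BddFun B fun _ => c := ⟨‖c‖, fun _ _ => le_rfl⟩

theorem BddFun.add {c d : Y → ℂ} (hc : BddFun B c) (hd : BddFun B d) :
    BddFun B fun y => c y + d y := by
  obtain ⟨C, hC⟩ := hc
  obtain ⟨D, hD⟩ := hd
  exact ⟨C + D, fun y hy => (norm_add_le _ _).trans (add_le_add (hC y hy) (hD y hy))⟩

theorem BddFun.mul {c d : Y → ℂ} (hc : BddFun B c) (hd : BddFun B d) :
    BddFun B fun y => c y * d y := by
  obtain ⟨C, hC⟩ := hc
  obtain ⟨D, hD⟩ := hd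
  refine ⟨C * D, fun y hy => ?_⟩
  rw [norm_mul]
  exact mul_le_mul (hC y hy) (hD y hy) (norm_nonneg _) ((norm_nonneg _).trans (hC y hy))

theorem BddFun.prod {ι : Type*} (t : Finset ι) {c : ι → Y → ℂ} (hc : ∀ i ∈ t, BddFun B (c i)) :
    BddFun B fun y => ∏ i ∈ t, c i y := by
  classical
  induction t using Finset.induction_on with
  | empty => exact ⟨1, by simp⟩
  | insert a t ha ih =>
    simp only [Finset.prod_insert ha]
    exact (hc a (Finset.mem_insert_self _ _)).mul (ih fun i hi => hc i (Finset.mem_insert_of_mem hi))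

theorem BddFun.sub_const {c : Y → ℂ} (hc : BddFun B c) (d : ℂ) : BddFun B fun y => c y - d := by
  simpa only [sub_eq_add_neg] using hc.add (bddFun_const (-d))

theorem symBound_zero : SymBound B s fun _ _ => 0 := by
  refine ⟨fun y _ => contDiffOn_const, fun k => ⟨0, fun y _ x _ => ?_⟩⟩
  simp

theorem SymBound.sum {ι : Type*} (t : Finset ι) {g : ι → Y → ℝ → ℂ}
    (hg : ∀ i ∈ t, SymBound B s (g i)) : SymBound B s fun y x => ∑ i ∈ t, g i y x := by
  classical
  induction t using Finset.induction_on with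
  | empty => simpa using symBound_zero
  | insert a t ha ih =>
    simp only [Finset.sum_insert ha]
    exact (hg a (Finset.mem_insert_self _ _)).add (ih fun i hi => hg i (Finset.mem_insert_of_mem hi))

theorem SymBound.sub (hg : SymBound B s g) (hh : SymBound B s h) :
    SymBound B s (fun y x => g y x - h y x) :=
  (hg.add (hh.const_mul (bddFun_const (-1)))).congr fun y _ x _ => by ring

theorem SymBound.mul (hg : SymBound B s g) (hh : SymBound B s' h) :
    SymBound B (fun y => s y + s' y) (fun y x => g y x * h y x) := by
  refine ⟨fun y hy => (hg.1 y hy).mul (hh.1 y hy), fun k => ?_⟩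
  choose C hC0 hC using hg.exists_nonneg
  choose D hD0 hD using hh.exists_nonneg
  refine ⟨∑ i ∈ Finset.range (k + 1), (k.choose i : ℝ) * C i * D (k - i), fun y hy x hx => ?_⟩
  have hx0 : 0 < x := zero_lt_one.trans_le hx
  have := iteratedDeriv_mul (contDiffAt_of_Ioi (hg.1 y hy) hx k)
    (contDiffAt_of_Ioi (hh.1 y hy) hx k)
  have e : (fun x => g y x * h y x) = g y * h y := rfl
  beta_reduce
  rw [e, this, Finset.sum_mul]
  refine (norm_sum_le _ _).trans (Finset.sum_le_sum fun i hi => ?_)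
  have hik : i ≤ k := Nat.lt_succ_iff.1 (Finset.mem_range.1 hi)
  have hpow : x ^ (s y - i) * x ^ (s' y - (k - i : ℕ)) = x ^ (s y + s' y - k) := by
    rw [← Real.rpow_add hx0]
    congr 1
    push_cast [Nat.cast_sub hik]
    ring
  rw [norm_mul, norm_mul, ← hpow]
  calc ‖(k.choose i : ℂ)‖ * ‖iteratedDeriv i (g y) x‖ * ‖iteratedDeriv (k - i) (h y) x‖
      ≤ (k.choose i : ℝ) * (C i * x ^ (s y - i)) * (D (k - i) * x ^ (s' y - (k - i : ℕ))) := by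
        have h1 := hC i y hy x hx
        have h2 := hD (k - i) y hy x hx
        have h3 : 0 ≤ C i * x ^ (s y - i) := (norm_nonneg _).trans h1
        rw [Complex.norm_natCast]
        gcongr
    _ = _ := by ring

theorem SymBound.deriv (hg : SymBound B s g) {g' : Y → ℝ → ℂ}
    (hd : ∀ y ∈ B, ∀ x, 0 < x → HasDerivAt (g y) (g' y x) x) :
    SymBound B (fun y => s y - 1) g' := by
  have hg' : SymBound B (fun y => s y - 1) fun y => _root_.deriv (g y) := by
    refine ⟨fun y hy => ?_, fun k => ?_⟩
    · exact ((contDiffOn_infty_iff_deriv_of_isOpen isOpen_Ioi).1 (hg.1 y hy)).2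
    · obtain ⟨C, hC⟩ := hg.2 (k + 1)
      refine ⟨C, fun y hy x hx => ?_⟩
      rw [← iteratedDeriv_succ']
      refine (hC y hy x hx).trans (le_of_eq ?_)
      push_cast
      ring_nf
  exact hg'.congr fun y hy x hx => (hd y hy x hx).deriv.symm

/-- The derivative `g'` satisfies symbol estimates and `g` decays as expected. -/
theorem SymBound.of_deriv {g' : Y → ℝ → ℂ} (hg' : SymBound B (fun y => s y - 1) g')
    (hd : ∀ y ∈ B, ∀ x, 0 < x → HasDerivAt (g y) (g' y x) x)
    (h0 : ∃ C : ℝ, ∀ y ∈ B, ∀ x : ℝ, 1 ≤ x → ‖g y x‖ ≤ C * x ^ (s y)) : SymBound B s g := by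
  have heq : ∀ y ∈ B, EqOn (_root_.deriv (g y)) (g' y) (Ioi 0) :=
    fun y hy x hx => (hd y hy x hx).deriv
  refine ⟨fun y hy => ?_, fun k => ?_⟩
  · rw [contDiffOn_infty_iff_deriv_of_isOpen isOpen_Ioi]
    exact ⟨fun x hx => (hd y hy x hx).differentiableAt.differentiableWithinAt,
      (hg'.1 y hy).congr (heq y hy)⟩
  · cases k with
    | zero => simpa using h0
    | succ k =>
      obtain ⟨C, hC⟩ := hg'.2 k
      refine ⟨C, fun y hy x hx => ?_⟩
      rw [iteratedDeriv_succ',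
        (heq y hy).iteratedDeriv_of_isOpen isOpen_Ioi k (zero_lt_one.trans_le hx)]
      refine (hC y hy x hx).trans (le_of_eq ?_)
      push_cast
      ring_nf

theorem norm_ofReal_cpow {x : ℝ} (hx : 0 < x) (z : ℂ) : ‖(x : ℂ) ^ z‖ = x ^ z.re :=
  Complex.norm_cpow_eq_rpow_re_of_pos hx z

theorem ofReal_cpow_add {x : ℝ} (hx : 0 < x) (z w : ℂ) :
    (x : ℂ) ^ (z + w) = (x : ℂ) ^ z * (x : ℂ) ^ w :=
  Complex.cpow_add _ _ (Complex.ofReal_ne_zero.2 hx.ne')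

theorem hasDerivAt_cpow {x : ℝ} (hx : 0 < x) (z : ℂ) :
    HasDerivAt (fun x : ℝ => (x : ℂ) ^ z) (z * (x : ℂ) ^ (z - 1)) x := by
  by_cases hz : z = 0
  · subst hz
    simpa using hasDerivAt_const x (1 : ℂ)
  · exact hasDerivAt_ofReal_cpow_const hx.ne' hz

theorem hasDerivAt_cpow_tower (z : ℂ) (k : ℕ) {x : ℝ} (hx : x ∈ Ioi (0 : ℝ)) :
    HasDerivAt (fun x : ℝ => (∏ i ∈ Finset.range k, (z - i)) * (x : ℂ) ^ (z - k))
      ((∏ i ∈ Finset.range (k + 1), (z - i)) * (x : ℂ) ^ (z - (k + 1 : ℕ))) x := by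
  refine ((hasDerivAt_cpow hx (z - k)).const_mul (∏ i ∈ Finset.range k, (z - i))).congr_deriv ?_
  rw [Finset.prod_range_succ, mul_assoc]
  push_cast
  rw [sub_sub]

theorem symBound_cpow {α : Y → ℂ} (hα : BddFun B α) :
    SymBound B (fun y => (α y).re) fun y x => (x : ℂ) ^ α y := by
  have key : ∀ y, (fun x : ℝ => (x : ℂ) ^ α y) =
      (fun k : ℕ => fun x : ℝ => (∏ i ∈ Finset.range k, (α y - i)) * (x : ℂ) ^ (α y - k)) 0 := by
    intro y; simp
  refine ⟨fun y _ => ?_, fun k => ?_⟩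
  · beta_reduce
    rw [key]
    exact contDiffOn_of_tower isOpen_Ioi fun k x hx => hasDerivAt_cpow_tower (α y) k hx
  · obtain ⟨C, hC⟩ := BddFun.prod (Finset.range k) (c := fun i y => α y - i)
      fun i _ => hα.sub_const i
    refine ⟨C, fun y hy x hx => ?_⟩
    have hx0 : 0 < x := zero_lt_one.trans_le hx
    beta_reduce
    rw [key, iteratedDeriv_of_tower isOpen_Ioi (fun k x hx => hasDerivAt_cpow_tower (α y) k hx) k
      (mem_Ioi.2 hx0), norm_mul, norm_ofReal_cpow hx0]
    refine mul_le_mul_of_nonneg_right (hC y hy) ?_ |>.trans (le_of_eq ?_)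
    · exact Real.rpow_nonneg hx0.le _
    · simp

theorem symBound_monomial {α c : Y → ℂ} (hα : BddFun B α) (hc : BddFun B c) (j : ℕ) :
    SymBound B (fun y => (α y).re - j) fun y x => c y * (x : ℂ) ^ (α y - j) := by
  refine ((symBound_cpow (hα.sub_const (j : ℂ))).const_mul hc).mono fun y _ => ?_
  simp

end SymBound

/-! ### Asymptotic expansions -/

section Expands

variable {Y : Type*} {B : Set Y} {α α' : Y → ℂ} {a b : ℕ → Y → ℂ} {g h : Y → ℝ → ℂ}

/-- The functions `g y` have the asymptotic expansion `∑ a_j(y) x ^ (α(y) - j)` at infinity,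
uniformly in `y ∈ B`. -/
def Expands (B : Set Y) (α : Y → ℂ) (a : ℕ → Y → ℂ) (g : Y → ℝ → ℂ) : Prop :=
  ∀ N : ℕ, SymBound B (fun y => (α y).re - N) fun y x =>
    g y x - ∑ j ∈ Finset.range N, a j y * (x : ℂ) ^ (α y - j)

theorem Expands.symBound (h : Expands B α a g) : SymBound B (fun y => (α y).re) g := by
  simpa using h 0

theorem Expands.subset {B' : Set Y} (h : Expands B α a g) (hB : B' ⊆ B) : Expands B' α a g :=
  fun N => (h N).subset hB

/-- At `x = 1` all powers equal `1`, and two consecutive remainders differ there by the coefficient.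
-/
theorem Expands.bddFun (h : Expands B α a g) (j : ℕ) : BddFun B (a j) := by
  obtain ⟨C, hC⟩ := (h j).2 0
  obtain ⟨D, hD⟩ := (h (j + 1)).2 0
  refine ⟨C + D, fun y hy => ?_⟩
  have h1 := hC y hy 1 le_rfl
  have h2 := hD y hy 1 le_rfl
  simp only [iteratedDeriv_zero, Finset.sum_range_succ, Complex.ofReal_one, Complex.one_cpow,
    mul_one, Real.one_rpow] at h1 h2
  refine le_trans ?_ (add_le_add h1 h2)
  refine le_trans (le_of_eq ?_) (norm_sub_le _ _)
  congr 1
  ring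

theorem symBound_partialSum (hα : BddFun B α) (ha : ∀ j, BddFun B (a j)) (N : ℕ) :
    SymBound B (fun y => (α y).re) fun y x =>
      ∑ j ∈ Finset.range N, a j y * (x : ℂ) ^ (α y - j) :=
  SymBound.sum _ fun j _ => (symBound_monomial hα (ha j) j).mono fun y _ => by simp

/-- A remainder of low level is one of high level plus finitely many monomials. So estimates are
needed only where the integrals defining the remainder converge. -/
theorem expands_of_large (hα : BddFun B α) (ha : ∀ j, BddFun B (a j)) (N₀ : ℕ)
    (h : ∀ N ≥ N₀, SymBound B (fun y => (α y).re - N) fun y x =>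
      g y x - ∑ j ∈ Finset.range N, a j y * (x : ℂ) ^ (α y - j)) : Expands B α a g := by
  intro N
  have h1 := (h (max N N₀) (le_max_right _ _)).mono (s' := fun y => (α y).re - N) fun y _ => by
    have : (N : ℝ) ≤ (max N N₀ : ℕ) := by exact_mod_cast le_max_left _ _
    linarith
  have h2 : SymBound B (fun y => (α y).re - N) fun y x =>
      ∑ j ∈ Finset.Ico N (max N N₀), a j y * (x : ℂ) ^ (α y - j) := by
    refine SymBound.sum _ fun j hj => (symBound_monomial hα (ha j) j).mono fun y _ => ?_
    have : (N : ℝ) ≤ j := by exact_mod_cast (Finset.mem_Ico.1 hj).1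
    linarith
  refine (h1.add h2).congr fun y _ x _ => ?_
  rw [← Finset.sum_range_add_sum_Ico _ (le_max_left N N₀)]
  ring

theorem Expands.add (hg : Expands B α a g) (hh : Expands B α b h) :
    Expands B α (fun j y => a j y + b j y) (fun y x => g y x + h y x) := by
  refine fun N => ((hg N).add (hh N)).congr fun y _ x _ => ?_
  simp only [add_mul, Finset.sum_add_distrib]
  ring

theorem Expands.const_mul {c : Y → ℂ} (hc : BddFun B c) (hg : Expands B α a g) :
    Expands B α (fun j y => c y * a j y) (fun y x => c y * g y x) := by
  refine fun N => ((hg N).const_mul hc).congr fun y _ x _ => ?_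
  simp only [mul_sub, Finset.mul_sum, mul_assoc]

theorem Expands.congr (hg : Expands B α a g) (h' : ∀ y ∈ B, ∀ x, 0 < x → h y x = g y x) :
    Expands B α a h :=
  fun N => (hg N).congr fun y hy x hx => by rw [h' y hy x hx]

theorem Expands.congr_coeff (hg : Expands B α a g) (h' : ∀ j, ∀ y ∈ B, b j y = a j y) :
    Expands B α b g :=
  fun N => (hg N).congr fun y hy x _ => by simp only [h' _ y hy]

theorem Expands.congr_order (hg : Expands B α a g) (h' : ∀ y ∈ B, α' y = α y) :
    Expands B α' a g :=
  fun N => ((hg N).congr fun y hy x _ => by simp only [h' y hy]).mono fun y hy => by rw [h' y hy]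

theorem sum_range_antidiagonal {M : Type*} [AddCommMonoid M] (φ : ℕ × ℕ → M) (N : ℕ) :
    ∑ j ∈ Finset.range N, ∑ p ∈ Finset.HasAntidiagonal.antidiagonal j, φ p =
      ∑ p ∈ (Finset.range N ×ˢ Finset.range N) with p.1 + p.2 < N, φ p := by
  rw [← Finset.sum_fiberwise_of_maps_to (t := Finset.range N) (g := fun p : ℕ × ℕ => p.1 + p.2)]
  · refine Finset.sum_congr rfl fun j hj => Finset.sum_congr ?_ fun _ _ => rfl
    ext p
    simp only [Finset.HasAntidiagonal.mem_antidiagonal, Finset.mem_filter, Finset.mem_product, Finset.mem_range] at *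
    omega
  · intro p hp
    simpa using (Finset.mem_filter.1 hp).2

/-- With `g_N` and `h_N` the partial sums, `g h` is `g_N h_N + (g - g_N) h + g_N (h - h_N)`. The
products of monomials in `g_N h_N` with `i + j < N` form the partial sum of the product, and the
others are of the order of the remainder. -/
theorem Expands.mul (hα : BddFun B α) (hα' : BddFun B α') (hg : Expands B α a g)
    (hh : Expands B α' b h) :
    Expands B (fun y => α y + α' y)
      (fun j y => ∑ p ∈ Finset.HasAntidiagonal.antidiagonal j, a p.1 y * b p.2 y) (fun y x => g y x * h y x) := by
  intro N
  have h1 := (hg N).mul hh.symBound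
  have h2 := (symBound_partialSum hα hg.bddFun N).mul (hh N)
  have h3 : SymBound B (fun y => (α y + α' y).re - N) fun y x =>
      ∑ p ∈ (Finset.range N ×ˢ Finset.range N) with ¬ p.1 + p.2 < N,
        (a p.1 y * (x : ℂ) ^ (α y - p.1)) * (b p.2 y * (x : ℂ) ^ (α' y - p.2)) := by
    refine SymBound.sum _ fun p hp => ((symBound_monomial hα (hg.bddFun p.1) p.1).mul
      (symBound_monomial hα' (hh.bddFun p.2) p.2)).mono fun y _ => ?_
    have : (N : ℝ) ≤ p.1 + p.2 := by exact_mod_cast not_lt.1 (Finset.mem_filter.1 hp).2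
    rw [Complex.add_re]
    linarith
  refine (((h1.mono fun y _ => ?_).add (h2.mono fun y _ => ?_)).add h3).congr fun y _ x hx => ?_
  · rw [Complex.add_re]; linarith
  · rw [Complex.add_re]; linarith
  · have e1 : ∑ j ∈ Finset.range N, (∑ p ∈ Finset.HasAntidiagonal.antidiagonal j, a p.1 y * b p.2 y) *
        (x : ℂ) ^ (α y + α' y - j) = ∑ p ∈ (Finset.range N ×ˢ Finset.range N) with p.1 + p.2 < N,
          (a p.1 y * (x : ℂ) ^ (α y - p.1)) * (b p.2 y * (x : ℂ) ^ (α' y - p.2)) := by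
      rw [← sum_range_antidiagonal]
      refine Finset.sum_congr rfl fun j _ => ?_
      rw [Finset.sum_mul]
      refine Finset.sum_congr rfl fun p hp => ?_
      rw [← Finset.HasAntidiagonal.mem_antidiagonal.1 hp, mul_mul_mul_comm, ← ofReal_cpow_add hx]
      push_cast
      ring_nf
    have e2 := Finset.sum_filter_add_sum_filter_not (Finset.range N ×ˢ Finset.range N)
      (fun p => p.1 + p.2 < N)
      (fun p => (a p.1 y * (x : ℂ) ^ (α y - p.1)) * (b p.2 y * (x : ℂ) ^ (α' y - p.2)))
    have e3 := Finset.sum_mul_sum (Finset.range N) (Finset.range N)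
      (fun i => a i y * (x : ℂ) ^ (α y - i)) (fun i => b i y * (x : ℂ) ^ (α' y - i))
    rw [← Finset.sum_product'] at e3
    rw [e1]
    linear_combination e3 - e2

theorem Expands.deriv (hg : Expands B α a g) {g' : Y → ℝ → ℂ}
    (hd : ∀ y ∈ B, ∀ x, 0 < x → HasDerivAt (g y) (g' y x) x) :
    Expands B (fun y => α y - 1) (fun j y => a j y * (α y - j)) g' := by
  intro N
  refine ((hg N).deriv fun y hy x hx => (hd y hy x hx).sub ?_).mono fun y _ => ?_
  · have : HasDerivAt (fun x : ℝ => ∑ j ∈ Finset.range N, a j y * (x : ℂ) ^ (α y - j))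
        (∑ j ∈ Finset.range N, a j y * ((α y - j) * (x : ℂ) ^ (α y - j - 1))) x :=
      HasDerivAt.fun_sum fun j _ => (hasDerivAt_cpow hx (α y - j)).const_mul (a j y)
    refine this.congr_deriv ?_
    refine Finset.sum_congr rfl fun j _ => ?_
    rw [mul_assoc, sub_right_comm]
  · rw [Complex.sub_re, Complex.one_re]
    linarith

/-- An expansion of order `α` is an expansion of order `α + i`, `i ∈ ℕ`. -/
theorem Expands.shift (i : ℕ) (hg : Expands B α a g) :
    Expands B (fun y => α y + i) (fun j y => if i ≤ j then a (j - i) y else 0) g := by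
  intro N
  by_cases hN : i ≤ N
  · obtain ⟨M, rfl⟩ := Nat.exists_eq_add_of_le hN
    refine ((hg M).mono fun y _ => ?_).congr fun y _ x _ => ?_
    · simp only [Complex.add_re, Complex.natCast_re, Nat.cast_add]
      linarith
    · rw [Finset.sum_range_add, Finset.sum_eq_zero (s := Finset.range i), zero_add]
      · congr 1
        refine Finset.sum_congr rfl fun j _ => ?_
        beta_reduce
        rw [if_pos (Nat.le_add_right i j), Nat.add_sub_cancel_left]
        congr 2
        push_cast
        ring
      · intro j hj
        beta_reduce
        rw [if_neg (not_le.2 (Finset.mem_range.1 hj)), zero_mul]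
  · refine (hg.symBound.mono fun y _ => ?_).congr fun y _ x _ => ?_
    · have : (N : ℝ) ≤ i := by exact_mod_cast (not_le.1 hN).le
      simp
      linarith
    · rw [Finset.sum_eq_zero, sub_zero]
      intro j hj
      have := Finset.mem_range.1 hj
      beta_reduce
      rw [if_neg (by omega), zero_mul]

/-- The coefficients of an asymptotic expansion are limits. -/
theorem Expands.tendsto_coeff (hg : Expands B α a g) {y : Y} (hy : y ∈ B) (N : ℕ) :
    Tendsto (fun x : ℝ => (g y x - ∑ j ∈ Finset.range N, a j y * (x : ℂ) ^ (α y - j)) *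
      (x : ℂ) ^ (-(α y - N))) atTop (𝓝 (a N y)) := by
  obtain ⟨C, hC⟩ := (hg (N + 1)).2 0
  rw [tendsto_iff_norm_sub_tendsto_zero]
  refine squeeze_zero' (g := fun x : ℝ => C * x⁻¹) (Eventually.of_forall fun x => norm_nonneg _) ?_
    (by simpa using tendsto_inv_atTop_zero.const_mul C)
  filter_upwards [eventually_ge_atTop 1] with x hx
  have hx0 : 0 < x := zero_lt_one.trans_le hx
  have h1 := hC y hy x hx
  simp only [iteratedDeriv_zero, Finset.sum_range_succ] at h1
  have e : (g y x - ∑ j ∈ Finset.range N, a j y * (x : ℂ) ^ (α y - j)) * (x : ℂ) ^ (-(α y - N)) -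
      a N y = (g y x - (∑ j ∈ Finset.range N, a j y * (x : ℂ) ^ (α y - j) +
        a N y * (x : ℂ) ^ (α y - N))) * (x : ℂ) ^ (-(α y - N)) := by
    have : (x : ℂ) ^ (α y - N) * (x : ℂ) ^ (-(α y - N)) = 1 := by
      rw [← ofReal_cpow_add hx0, add_neg_cancel, Complex.cpow_zero]
    linear_combination a N y * this
  rw [e, norm_mul, norm_ofReal_cpow hx0]
  calc _ ≤ C * x ^ ((α y).re - (N + 1 : ℕ) - (0 : ℕ)) * x ^ (-(α y - N)).re :=
        mul_le_mul_of_nonneg_right h1 (Real.rpow_nonneg hx0.le _)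
    _ = C * x⁻¹ := by
        rw [mul_assoc, ← Real.rpow_add hx0, ← Real.rpow_neg_one]
        congr 2
        simp

theorem star_ofReal_cpow {x : ℝ} (hx : 0 < x) (z : ℂ) :
    star ((x : ℂ) ^ z) = (x : ℂ) ^ (star z) := by
  have h : (x : ℂ).arg ≠ Real.pi := by
    rw [Complex.arg_ofReal_of_nonneg hx.le]
    exact Real.pi_ne_zero.symm
  have := Complex.cpow_conj (x : ℂ) z h
  rw [Complex.conj_ofReal] at this
  exact this.symm

/-- The expansion of a family with real coefficients has real coefficients. -/
theorem Expands.star_coeff [Star Y] (hg : Expands B α a g) (hB : ∀ y ∈ B, star y ∈ B)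
    (hα : ∀ y ∈ B, α (star y) = star (α y))
    (hreal : ∀ y ∈ B, ∀ x, 0 < x → g (star y) x = star (g y x)) (j : ℕ) {y : Y} (hy : y ∈ B) :
    a j (star y) = star (a j y) := by
  -- The coefficient `N` is a limit of an expression containing the earlier coefficients, so reality
  -- passes from these to the next one.
  induction j using Nat.strong_induction_on with
  | _ N ih =>
    have h1 := hg.tendsto_coeff (hB y hy) N
    have h2 := (continuous_star.tendsto _).comp (hg.tendsto_coeff hy N)
    refine tendsto_nhds_unique h1 (h2.congr' ?_)
    filter_upwards [eventually_gt_atTop 0] with x hx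
    simp only [Function.comp_apply, star_mul', star_sub, star_sum, star_ofReal_cpow hx,
      hα y hy, hreal y hy x hx, star_neg, star_natCast]
    congr 2
    refine Finset.sum_congr rfl fun j hj => ?_
    rw [ih j (Finset.mem_range.1 hj)]

end Expands

end Locality

end

noncomputable section

namespace Locality

open Filter Topology MeasureTheory Set

/-! ### Holomorphic families of symbols -/

section Family

variable {n : ℕ} {B : Set (Fin n → ℂ)} {α α' : (Fin n → ℂ) → ℂ} {a b : ℕ → (Fin n → ℂ) → ℂ}
  {T S : (Fin n → ℂ) → NNReal → ℂ}

/-- A holomorphic family, with real coefficients, of polyhomogeneous symbols of order `α`. -/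
structure Family (B : Set (Fin n → ℂ)) (α : (Fin n → ℂ) → ℂ) (a : ℕ → (Fin n → ℂ) → ℂ)
    (T : (Fin n → ℂ) → NNReal → ℂ) : Prop where
  holomorphic : ∀ x, DifferentiableOn ℂ (fun y => T y x) B
  holomorphic_coeff : ∀ j, DifferentiableOn ℂ (a j) B
  real : ∀ y ∈ B, ∀ x, T (star y) x = star (T y x)
  smooth : ∀ y ∈ B, Smooth (T y)
  bound : ∀ k : ℕ, ∃ C : ℝ, ∀ y ∈ B, ∀ x ∈ Icc (0 : ℝ) 1, ‖dx k (T y) x‖ ≤ C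
  expands : Expands B α a fun y => ext (T y)

theorem affineOrder_eq (ℓ : Fin n → ℝ) (c : ℝ) (y : Fin n → ℂ) :
    affineOrder ℓ c y = dot ℓ y + c := rfl

theorem bddFun_dot (u : Fin n → ℝ) (r : ℝ) : BddFun (Metric.ball 0 r) (dot u) := by
  refine ⟨∑ i, |u i| * r, fun y hy => (norm_sum_le _ _).trans (Finset.sum_le_sum fun i _ => ?_)⟩
  rw [norm_mul, Complex.norm_real, Real.norm_eq_abs]
  refine mul_le_mul_of_nonneg_left ((norm_le_pi_norm y i).trans ?_) (abs_nonneg _)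
  exact (mem_ball_zero_iff.1 hy).le

theorem bddFun_affineOrder (ℓ : Fin n → ℝ) (c r : ℝ) :
    BddFun (Metric.ball 0 r) (affineOrder ℓ c) :=
  (bddFun_dot ℓ r).add (bddFun_const _)

theorem BddFun.subset {Y : Type*} {B B' : Set Y} {c : Y → ℂ} (h : BddFun B c) (hB : B' ⊆ B) :
    BddFun B' c := h.imp fun _ hC y hy => hC y (hB hy)

/-- A holomorphic function on a ball is bounded on a smaller ball. -/
theorem exists_bddFun {c : (Fin n → ℂ) → ℂ} {r : ℝ} (hr : 0 < r)
    (h : DifferentiableOn ℂ c (Metric.ball 0 r)) : BddFun (Metric.ball 0 (r / 2)) c := by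
  have hc : ContinuousOn c (Metric.closedBall 0 (r / 2)) :=
    h.continuousOn.mono (Metric.closedBall_subset_ball (by linarith))
  obtain ⟨C, hC⟩ := (isCompact_closedBall (0 : Fin n → ℂ) (r / 2)).exists_bound_of_continuousOn hc
  exact ⟨C, fun y hy => hC y (Metric.ball_subset_closedBall hy)⟩

theorem star_mem_ball {y : Fin n → ℂ} {r : ℝ} (hy : y ∈ Metric.ball 0 r) :
    star y ∈ Metric.ball 0 r := by
  rw [mem_ball_zero_iff] at *
  rwa [norm_star]

theorem affineOrder_star (ℓ : Fin n → ℝ) (c : ℝ) (y : Fin n → ℂ) :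
    affineOrder ℓ c (star y) = star (affineOrder ℓ c y) := by
  rw [affineOrder_eq, affineOrder_eq, dot_star, star_add]
  congr 1
  exact (Complex.conj_ofReal c).symm

/-- On `[0, 1]` all powers of `1 + x` are comparable with `1`, and for `x ≥ 1` those of `1 + x` are
comparable with those of `x`. So a bound on `[0, 1]` and an expansion at infinity, as in `Family`,
are equivalent to the symbol estimates on `[0, ∞)`. -/
theorem one_le_two_rpow_mul {x : ℝ} (hx : x ∈ Icc (0 : ℝ) 1) (p : ℝ) :
    1 ≤ 2 ^ |p| * (1 + x) ^ p := by
  have h0 : 0 < 1 + x := by linarith [hx.1]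
  have := rpow_le_of_mem (m := -p) (x := 1 + x) (R := 2) (by linarith [hx.1]) (by linarith [hx.2])
  rw [abs_neg] at this
  calc (1 : ℝ) = (1 + x) ^ (-p) * (1 + x) ^ p := by
        rw [← Real.rpow_add h0, neg_add_cancel, Real.rpow_zero]
    _ ≤ _ := mul_le_mul_of_nonneg_right this (Real.rpow_nonneg h0.le _)

theorem rpow_le_two_rpow_mul {x : ℝ} (hx : 1 ≤ x) (p : ℝ) :
    x ^ p ≤ 2 ^ |p| * (1 + x) ^ p := by
  have hx0 : 0 < x := by linarith
  have h0 : 0 < 1 + x := by linarith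
  have := rpow_le_of_mem (m := -p) (x := (1 + x) / x) (R := 2) (by rw [le_div_iff₀ hx0]; linarith)
    (by rw [div_le_iff₀ hx0]; linarith)
  rw [abs_neg] at this
  calc x ^ p = ((1 + x) / x) ^ (-p) * (1 + x) ^ p := by
        rw [Real.rpow_neg (by positivity), Real.div_rpow h0.le hx0.le]
        have h1 := (Real.rpow_pos_of_pos h0 p).ne'
        have h2 := (Real.rpow_pos_of_pos hx0 p).ne'
        field_simp
    _ ≤ _ := mul_le_mul_of_nonneg_right this (Real.rpow_nonneg h0.le _)

theorem contDiffOn_cpow (z : ℂ) :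
    ContDiffOn ℝ ((⊤ : ℕ∞) : WithTop ℕ∞) (fun x : ℝ => (x : ℂ) ^ z) (Ioi 0) :=
  (symBound_cpow (B := univ) (α := fun _ : Unit => z) (bddFun_const z)).1 () trivial

theorem IsHolSymbolFamily.family {r : ℝ} {ℓ : Fin n → ℝ} {c : ℝ}
    (h : IsHolSymbolFamily r ℓ c a T) : Family (Metric.ball 0 r) (affineOrder ℓ c) a T where
  holomorphic := h.holomorphic
  holomorphic_coeff := h.holomorphic_coeff
  real := h.real_coeff
  smooth := h.smooth
  bound k := by
    obtain ⟨C, hC⟩ := h.symbol k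
    obtain ⟨A, hA⟩ := bddFun_affineOrder ℓ c r
    refine ⟨|C| * 2 ^ (A + k), fun y hy x hx => (hC y hy x hx.1).trans ?_⟩
    have h0 : 0 < 1 + x := by linarith [hx.1]
    have h1 : |(affineOrder ℓ c y).re - k| ≤ A + k := by
      refine (abs_sub _ _).trans (add_le_add ((Complex.abs_re_le_norm _).trans (hA y hy)) ?_)
      rw [abs_of_nonneg (Nat.cast_nonneg k)]
    refine mul_le_mul (le_abs_self C) ?_ (Real.rpow_nonneg h0.le _) (abs_nonneg _)
    exact (rpow_le_of_mem (by linarith [hx.1]) (by linarith [hx.2])).trans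
      (Real.rpow_le_rpow_of_exponent_le one_le_two h1)
  expands N := by
    refine ⟨fun y hy => ((h.smooth y hy).mono Ioi_subset_Ici_self).sub ?_, fun k =>
      h.asymptotic N k⟩
    exact ContDiffOn.sum fun j _ => contDiffOn_const.mul (contDiffOn_cpow _)

/-- Families are symbols of order the real part of `α`, uniformly on `[0, ∞)`. -/
theorem Family.exists_bound (h : Family B α a T) (hα : BddFun B α) (k : ℕ) :
    ∃ C : ℝ, ∀ y ∈ B, ∀ x : ℝ, 0 ≤ x → ‖dx k (T y) x‖ ≤ C * (1 + x) ^ ((α y).re - k) := by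
  obtain ⟨C, hC⟩ := h.bound k
  obtain ⟨D, hD0, hD⟩ := h.expands.symBound.exists_nonneg k
  obtain ⟨A, hA⟩ := hα
  refine ⟨(|C| + D) * 2 ^ (A + k), fun y hy x hx => ?_⟩
  have hp : (2 : ℝ) ^ |(α y).re - k| ≤ 2 ^ (A + k) := by
    refine Real.rpow_le_rpow_of_exponent_le one_le_two ?_
    refine (abs_sub _ _).trans (add_le_add ((Complex.abs_re_le_norm _).trans (hA y hy)) ?_)
    rw [abs_of_nonneg (Nat.cast_nonneg k)]
  have h0 : 0 ≤ (1 + x) ^ ((α y).re - k) := Real.rpow_nonneg (by linarith) _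
  rcases le_total x 1 with hx1 | hx1
  · calc ‖dx k (T y) x‖ ≤ |C| * 1 := by
          rw [mul_one]; exact (hC y hy x ⟨hx, hx1⟩).trans (le_abs_self C)
      _ ≤ (|C| + D) * (2 ^ (A + k) * (1 + x) ^ ((α y).re - k)) := by
          refine mul_le_mul (by linarith) ((one_le_two_rpow_mul ⟨hx, hx1⟩ _).trans
            (mul_le_mul_of_nonneg_right hp h0)) zero_le_one (by positivity)
      _ = _ := by ring
  · rw [(h.smooth y hy).dx_eq k (by linarith)]
    calc ‖iteratedDeriv k (ext (T y)) x‖ ≤ D * x ^ ((α y).re - k) := hD y hy x hx1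
      _ ≤ (|C| + D) * (2 ^ (A + k) * (1 + x) ^ ((α y).re - k)) := by
          refine mul_le_mul (by linarith [abs_nonneg C]) ((rpow_le_two_rpow_mul hx1 _).trans
            (mul_le_mul_of_nonneg_right hp h0)) (Real.rpow_nonneg (by linarith) _) (by positivity)
      _ = _ := by ring

theorem Family.isHolSymbolFamily {r : ℝ} {ℓ : Fin n → ℝ} {c : ℝ}
    (h : Family (Metric.ball 0 r) (affineOrder ℓ c) a T) : IsHolSymbolFamily r ℓ c a T where
  holomorphic := h.holomorphic
  holomorphic_coeff := h.holomorphic_coeff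
  real_coeff := h.real
  smooth := h.smooth
  symbol := h.exists_bound (bddFun_affineOrder ℓ c r)
  asymptotic N k := (h.expands N).2 k

theorem Family.unifSym (h : Family B α a T) (hα : BddFun B α) {m : ℝ}
    (hm : ∀ y ∈ B, (α y).re ≤ m) : UnifSym B m T := by
  refine ⟨h.smooth, fun k => ?_⟩
  obtain ⟨C, hC⟩ := h.exists_bound hα k
  refine ⟨|C|, fun y hy x hx => (hC y hy x hx).trans (mul_le_mul (le_abs_self C) ?_
    (Real.rpow_nonneg (by linarith) _) (abs_nonneg C))⟩
  exact Real.rpow_le_rpow_of_exponent_le (by linarith) (by linarith [hm y hy])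

theorem Family.subset {B' : Set (Fin n → ℂ)} (h : Family B α a T) (hB : B' ⊆ B) :
    Family B' α a T where
  holomorphic x := (h.holomorphic x).mono hB
  holomorphic_coeff j := (h.holomorphic_coeff j).mono hB
  real y hy := h.real y (hB hy)
  smooth y hy := h.smooth y (hB hy)
  bound k := (h.bound k).imp fun _ hC y hy => hC y (hB hy)
  expands := h.expands.subset hB

theorem Family.congr_order (h : Family B α a T) (hα : ∀ y ∈ B, α' y = α y) :
    Family B α' a T where
  holomorphic := h.holomorphic
  holomorphic_coeff := h.holomorphic_coeff
  real := h.real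
  smooth := h.smooth
  bound := h.bound
  expands := h.expands.congr_order hα

theorem Family.add (hT : Family B α a T) (hS : Family B α b S) :
    Family B α (fun j y => a j y + b j y) (fun y => T y + S y) where
  holomorphic x := (hT.holomorphic x).add (hS.holomorphic x)
  holomorphic_coeff j := (hT.holomorphic_coeff j).add (hS.holomorphic_coeff j)
  real y hy x := by
    rw [Pi.add_apply, Pi.add_apply, hT.real y hy, hS.real y hy, star_add]
  smooth y hy := by
    have := ContDiffOn.add (hT.smooth y hy) (hS.smooth y hy)
    rwa [Smooth, ext_add]
  bound k := by
    obtain ⟨C, hC⟩ := hT.bound k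
    obtain ⟨D, hD⟩ := hS.bound k
    refine ⟨C + D, fun y hy x hx => ?_⟩
    rw [dx_add (hT.smooth y hy) (hS.smooth y hy) k hx.1]
    exact (norm_add_le _ _).trans (add_le_add (hC y hy x hx) (hD y hy x hx))
  expands := (hT.expands.add hS.expands).congr fun y _ x _ => by rw [ext_add, Pi.add_apply]

theorem ext_mul (f g : NNReal → ℂ) : ext (f * g) = ext f * ext g := rfl

theorem Family.mul (hα : BddFun B α) (hα' : BddFun B α') (hT : Family B α a T)
    (hS : Family B α' b S) : Family B (fun y => α y + α' y)
      (fun j y => ∑ p ∈ Finset.HasAntidiagonal.antidiagonal j, a p.1 y * b p.2 y)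
      (fun y => T y * S y) where
  holomorphic x := (hT.holomorphic x).mul (hS.holomorphic x)
  holomorphic_coeff j := DifferentiableOn.fun_sum fun p _ =>
    (hT.holomorphic_coeff p.1).mul (hS.holomorphic_coeff p.2)
  real y hy x := by
    rw [Pi.mul_apply, Pi.mul_apply, hT.real y hy, hS.real y hy, star_mul']
  smooth y hy := by
    have := ContDiffOn.mul (hT.smooth y hy) (hS.smooth y hy)
    rwa [Smooth, ext_mul]
  bound k := by
    choose C hC using hT.bound
    choose D hD using hS.bound
    refine ⟨∑ i ∈ Finset.range (k + 1), (k.choose i : ℝ) * C i * D (k - i), fun y hy x hx => ?_⟩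
    have hsm : ∀ {f : NNReal → ℂ}, Smooth f → ContDiffWithinAt ℝ k (ext f) (Ici 0) x :=
      fun hf => (hf x hx.1).of_le (mod_cast le_top)
    have := iteratedDerivWithin_mul (mem_Ici.2 hx.1) (uniqueDiffOn_Ici (0 : ℝ))
      (hsm (hT.smooth y hy)) (hsm (hS.smooth y hy))
    change ‖iteratedDerivWithin k (ext (T y) * ext (S y)) (Ici 0) x‖ ≤ _
    rw [this]
    refine (norm_sum_le _ _).trans (Finset.sum_le_sum fun i _ => ?_)
    rw [norm_mul, norm_mul, Complex.norm_natCast]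
    have h1 := hC i y hy x hx
    refine mul_le_mul (mul_le_mul_of_nonneg_left h1 (Nat.cast_nonneg _)) (hD (k - i) y hy x hx)
      (norm_nonneg _) (mul_nonneg (Nat.cast_nonneg _) ((norm_nonneg _).trans h1))
  expands := hT.expands.mul hα hα' hS.expands

/-- Families of functions that are constant in `x`. -/
theorem family_const {h : (Fin n → ℂ) → ℂ} (hd : DifferentiableOn ℂ h B) (hb : BddFun B h)
    (hr : ∀ y ∈ B, h (star y) = star (h y)) :
    Family B (fun _ => 0) (fun j y => if j = 0 then h y else 0) (fun y _ => h y) where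
  holomorphic _ := hd
  holomorphic_coeff j := by
    by_cases hj : j = 0
    · simpa [hj] using hd
    · simp only [hj, if_false]
      exact differentiableOn_const 0
  real y hy _ := hr y hy
  smooth _ _ := contDiffOn_const
  bound k := by
    obtain ⟨C, hC⟩ := hb
    refine ⟨|C|, fun y hy x _ => ?_⟩
    change ‖iteratedDerivWithin k (fun _ : ℝ => h y) (Ici 0) x‖ ≤ |C|
    rw [iteratedDerivWithin_const]
    split_ifs
    · exact (hC y hy).trans (le_abs_self C)
    · simp
  expands := by
    refine expands_of_large (bddFun_const 0) (fun j => ?_) 1 fun N hN => ?_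
    · by_cases hj : j = 0
      · simpa [hj] using hb
      · simp only [hj, if_false]
        exact bddFun_const 0
    · refine symBound_zero.congr fun y _ x _ => ?_
      rw [Finset.sum_eq_single_of_mem 0 (Finset.mem_range.2 hN)]
      · simp [ext]
      · intro j _ hj
        simp [hj]

theorem Family.const_mul {h : (Fin n → ℂ) → ℂ} (hd : DifferentiableOn ℂ h B) (hb : BddFun B h)
    (hr : ∀ y ∈ B, h (star y) = star (h y)) (hT : Family B α a T) :
    Family B α (fun j y => h y * a j y) (fun y => h y • T y) where
  holomorphic x := hd.mul (hT.holomorphic x)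
  holomorphic_coeff j := hd.mul (hT.holomorphic_coeff j)
  real y hy x := by
    simp only [Pi.smul_apply, smul_eq_mul]
    rw [hT.real y hy, hr y hy, star_mul']
  smooth y hy := contDiffOn_const.mul (hT.smooth y hy)
  bound k := by
    obtain ⟨C, hC⟩ := hT.bound k
    obtain ⟨D, hD⟩ := hb
    refine ⟨D * C, fun y hy x hx => ?_⟩
    rw [dx_smul, norm_mul]
    exact mul_le_mul (hD y hy) (hC y hy x hx) (norm_nonneg _) ((norm_nonneg _).trans (hD y hy))
  expands := (hT.expands.const_mul hb).congr fun y _ x _ => rfl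

theorem family_zero : Family B α (fun _ _ => 0) (fun _ => 0) where
  holomorphic _ := differentiableOn_const 0
  holomorphic_coeff _ := differentiableOn_const 0
  real _ _ _ := by simp
  smooth _ _ := contDiffOn_const
  bound k := ⟨0, fun y _ x _ => by
    change ‖iteratedDerivWithin k (fun _ : ℝ => (0 : ℂ)) (Ici 0) x‖ ≤ 0
    rw [iteratedDerivWithin_const]; simp⟩
  expands N := symBound_zero.congr fun y _ x _ => by simp [ext]

theorem Family.shift (i : ℕ) (h : Family B α a T) :
    Family B (fun y => α y + i) (fun j y => if i ≤ j then a (j - i) y else 0) T where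
  holomorphic := h.holomorphic
  holomorphic_coeff j := by
    by_cases hj : i ≤ j
    · simpa [hj] using h.holomorphic_coeff (j - i)
    · simp only [hj, if_false]
      exact differentiableOn_const 0
  real := h.real
  smooth := h.smooth
  bound := h.bound
  expands := h.expands.shift i

/-- Pullback of a family by a real holomorphic map of the parameters. -/
theorem Family.comp {m : ℕ} {B' : Set (Fin m → ℂ)} {φ : (Fin m → ℂ) → Fin n → ℂ}
    (h : Family B α a T) (hφ : DifferentiableOn ℂ φ B') (hB : ∀ y ∈ B', φ y ∈ B)
    (hr : ∀ y ∈ B', φ (star y) = star (φ y)) :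
    Family B' (fun y => α (φ y)) (fun j y => a j (φ y)) (fun y => T (φ y)) where
  holomorphic x := (h.holomorphic x).comp hφ hB
  holomorphic_coeff j := (h.holomorphic_coeff j).comp hφ hB
  real y hy x := by rw [hr y hy, h.real _ (hB y hy)]
  smooth y hy := h.smooth _ (hB y hy)
  bound k := (h.bound k).imp fun _ hC y hy => hC _ (hB y hy)
  expands N := ⟨fun y hy => (h.expands N).1 _ (hB y hy),
    fun k => ((h.expands N).2 k).imp fun _ hC y hy => hC _ (hB y hy)⟩

end Family

end Locality

end

noncomputable section

namespace Locality

open Filter Topology MeasureTheory Set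

/-! ### Expansion of primitives -/

section Primitive

variable {n : ℕ} {B : Set (Fin n → ℂ)} {α : (Fin n → ℂ) → ℂ} {a d : ℕ → (Fin n → ℂ) → ℂ}
  {w : (Fin n → ℂ) → ℂ} {T : (Fin n → ℂ) → NNReal → ℂ} {m : ℝ} {N₀ : ℕ}

/-- The remainder of the expansion at level `N`. -/
def tailTerm (α : (Fin n → ℂ) → ℂ) (a : ℕ → (Fin n → ℂ) → ℂ) (T : (Fin n → ℂ) → NNReal → ℂ) (N : ℕ)
    (y : Fin n → ℂ) (x : ℝ) : ℂ :=
  ext (T y) x - ∑ j ∈ Finset.range N, a j y * (x : ℂ) ^ (α y - j)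

/-- The constant for which `primitiveConst + w ∫_1^x T` has no constant term at infinity other than
those prescribed by `d`. -/
def primitiveConst (α : (Fin n → ℂ) → ℂ) (a d : ℕ → (Fin n → ℂ) → ℂ) (w : (Fin n → ℂ) → ℂ)
    (T : (Fin n → ℂ) → NNReal → ℂ) (N₀ : ℕ) (y : Fin n → ℂ) : ℂ :=
  ∑ j ∈ Finset.range N₀, d j y - w y * ∫ t in Ioi (1 : ℝ), tailTerm α a T N₀ y t

theorem Family.exists_norm_tailTerm_le (hT : Family B α a T) (N : ℕ) :
    ∃ C : ℝ, 0 ≤ C ∧ ∀ y ∈ B, ∀ x : ℝ, 1 ≤ x → ‖tailTerm α a T N y x‖ ≤ C * x ^ ((α y).re - N) := by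
  obtain ⟨C, hC0, hC⟩ := (hT.expands N).exists_nonneg 0
  exact ⟨C, hC0, fun y hy x hx => by simpa [tailTerm] using hC y hy x hx⟩

theorem Family.continuousOn_tailTerm (hT : Family B α a T) (N : ℕ) {y : Fin n → ℂ} (hy : y ∈ B) :
    ContinuousOn (tailTerm α a T N y) (Ioi 0) :=
  ((hT.expands N).1 y hy).continuousOn

theorem Family.integrableOn_tailTerm (hT : Family B α a T) {N : ℕ} {y : Fin n → ℂ} (hy : y ∈ B)
    (hN : (α y).re + 1 < N) {x : ℝ} (hx : 1 ≤ x) : IntegrableOn (tailTerm α a T N y) (Ioi x) := by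
  obtain ⟨C, hC0, hC⟩ := hT.exists_norm_tailTerm_le N
  have hx0 : 0 < x := zero_lt_one.trans_le hx
  refine Integrable.mono' ((integrableOn_Ioi_rpow_of_lt (a := (α y).re - N) (by linarith)
    hx0).const_mul C) (((hT.continuousOn_tailTerm N hy).mono
      (Ioi_subset_Ioi hx0.le)).aestronglyMeasurable measurableSet_Ioi) ?_
  filter_upwards [ae_restrict_mem measurableSet_Ioi] with t ht
  exact hC y hy t (hx.trans (le_of_lt ht))

/-- The difference between a primitive and a partial sum of its expansion. -/
def primitiveTail (α : (Fin n → ℂ) → ℂ) (a d : ℕ → (Fin n → ℂ) → ℂ) (w : (Fin n → ℂ) → ℂ)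
    (T : (Fin n → ℂ) → NNReal → ℂ) (N₀ N : ℕ) (y : Fin n → ℂ) (x : ℝ) : ℂ :=
  (primitiveConst α a d w T N₀ y + w y * ∫ t in (1 : ℝ)..x, ext (T y) t) -
    ∑ j ∈ Finset.range N, d j y * (x : ℂ) ^ (α y + 1 - j)

/-- The relation `hwd` says that the powers with coefficients `d` are a termwise primitive of `w`
times the expansion. The factor `w` allows a zero of `α + 1 - j` to be cleared instead of divided
by. -/
theorem Family.hasDerivAt_primitiveTail (hT : Family B α a T)
    (hwd : ∀ j, ∀ y ∈ B, d j y * (α y + 1 - j) = w y * a j y) (N : ℕ) {y : Fin n → ℂ} (hy : y ∈ B)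
    {x : ℝ} (hx : 0 < x) :
    HasDerivAt (primitiveTail α a d w T N₀ N y) (w y * tailTerm α a T N y x) x := by
  have h1 : HasDerivAt (fun x : ℝ => ∑ j ∈ Finset.range N, d j y * (x : ℂ) ^ (α y + 1 - j))
      (∑ j ∈ Finset.range N, d j y * ((α y + 1 - j) * (x : ℂ) ^ (α y + 1 - j - 1))) x :=
    HasDerivAt.fun_sum fun j _ => (hasDerivAt_cpow hx (α y + 1 - j)).const_mul (d j y)
  have h2 := ((((hT.smooth y hy).hasDerivAt_primitive hx).const_mul (w y)).const_add
    (primitiveConst α a d w T N₀ y)).sub h1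
  refine h2.congr_deriv ?_
  rw [tailTerm, mul_sub, Finset.mul_sum]
  congr 1
  refine Finset.sum_congr rfl fun j _ => ?_
  rw [← mul_assoc, hwd j y hy, mul_assoc]
  congr 3
  ring

theorem tendsto_cpow_zero {z : ℂ} (hz : z.re < 0) :
    Tendsto (fun x : ℝ => (x : ℂ) ^ z) atTop (𝓝 0) := by
  rw [tendsto_zero_iff_norm_tendsto_zero]
  refine Tendsto.congr' ?_ (tendsto_rpow_neg_atTop (y := -z.re) (by linarith))
  filter_upwards [eventually_gt_atTop 0] with x hx
  rw [norm_ofReal_cpow hx, neg_neg]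

/-- For `N = N₀` the choice of `primitiveConst` makes the function equal to `w` times `∫_1^x -
∫_1^∞` of the tail. The powers with `N₀ ≤ j < N` have exponents of negative real part. -/
theorem Family.tendsto_primitiveTail (hT : Family B α a T)
    (hwd : ∀ j, ∀ y ∈ B, d j y * (α y + 1 - j) = w y * a j y) {y : Fin n → ℂ} (hy : y ∈ B)
    (hN₀ : (α y).re + 1 < N₀) {N : ℕ} (hN : N₀ ≤ N) :
    Tendsto (primitiveTail α a d w T N₀ N y) atTop (𝓝 0) := by
  have hcont : ContinuousOn (fun t => w y * tailTerm α a T N₀ y t) (Ioi 0) :=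
    continuousOn_const.mul (hT.continuousOn_tailTerm N₀ hy)
  have hint := (hT.integrableOn_tailTerm hy hN₀ le_rfl).const_mul (w y)
  have h0 : Tendsto (primitiveTail α a d w T N₀ N₀ y) atTop (𝓝 0) := by
    have h1 := (intervalIntegral_tendsto_integral_Ioi 1 hint tendsto_id).sub_const
      (∫ t in Ioi (1 : ℝ), w y * tailTerm α a T N₀ y t)
    rw [sub_self] at h1
    refine h1.congr' ?_
    filter_upwards [eventually_ge_atTop 1] with x hx
    have hsub : uIcc 1 x ⊆ Ioi 0 := by
      rw [uIcc_of_le hx]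
      exact fun t ht => zero_lt_one.trans_le ht.1
    rw [id, intervalIntegral.integral_eq_sub_of_hasDerivAt
      (fun t ht => hT.hasDerivAt_primitiveTail (N₀ := N₀) hwd N₀ hy (hsub ht))
      (hcont.mono hsub).intervalIntegrable, integral_const_mul]
    simp [primitiveTail, primitiveConst]
  have h2 : Tendsto (fun x : ℝ => ∑ j ∈ Finset.Ico N₀ N, d j y * (x : ℂ) ^ (α y + 1 - j)) atTop
      (𝓝 (∑ j ∈ Finset.Ico N₀ N, d j y * 0)) := by
    refine tendsto_finsetSum _ fun j hj => (tendsto_cpow_zero ?_).const_mul _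
    have : (N₀ : ℝ) ≤ j := by exact_mod_cast (Finset.mem_Ico.1 hj).1
    simp
    linarith
  have h3 := h0.sub h2
  simp only [mul_zero, Finset.sum_const_zero, sub_zero] at h3
  refine h3.congr fun x => ?_
  rw [primitiveTail, primitiveTail, ← Finset.sum_range_add_sum_Ico _ hN, sub_sub]

/-- Termwise integration of asymptotic expansions. -/
theorem Family.expands_primitive (hT : Family B α a T) (hα : BddFun B α)
    (hm : ∀ y ∈ B, (α y).re ≤ m) (hN₀ : m + 1 < N₀) (hw : BddFun B w) (hd : ∀ j, BddFun B (d j))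
    (hwd : ∀ j, ∀ y ∈ B, d j y * (α y + 1 - j) = w y * a j y) :
    Expands B (fun y => α y + 1) d
      (fun y x => primitiveConst α a d w T N₀ y + w y * ∫ t in (1 : ℝ)..x, ext (T y) t) := by
  refine expands_of_large (hα.add (bddFun_const 1)) hd N₀ fun N hN => ?_
  have hNm : ∀ y ∈ B, (α y).re + 1 < N := fun y hy => by
    have : (N₀ : ℝ) ≤ N := by exact_mod_cast hN
    linarith [hm y hy]
  -- The derivatives are controlled by the expansion of `T`; the size of the function itself is
  -- found by integrating its derivative from `x` to infinity, where it vanishes.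
  refine SymBound.of_deriv (g := primitiveTail α a d w T N₀ N)
    (g' := fun y x => w y * tailTerm α a T N y x) ?_
    (fun y hy x hx => hT.hasDerivAt_primitiveTail hwd N hy hx) ?_
  · refine ((hT.expands N).const_mul hw).mono fun y _ => ?_
    rw [Complex.add_re, Complex.one_re]
    linarith
  · obtain ⟨C, hC0, hC⟩ := hT.exists_norm_tailTerm_le N
    obtain ⟨D, hD⟩ := hw
    -- Integrating `t ^ (Re α - N)` over `(x, ∞)` divides by `N - Re α - 1`, which is at least `N₀ -
    -- m - 1 > 0` uniformly in `y`.
    refine ⟨D * C / (N₀ - m - 1), fun y hy x hx => ?_⟩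
    have hx0 : 0 < x := zero_lt_one.trans_le hx
    have hD0 : 0 ≤ D := (norm_nonneg _).trans (hD y hy)
    have hp : (α y).re - N < -1 := by linarith [hNm y hy]
    have hint := hT.integrableOn_tailTerm hy (hNm y hy) hx
    have h1 := integral_Ioi_of_hasDerivAt_of_tendsto'
      (fun t (ht : t ∈ Ici x) => hT.hasDerivAt_primitiveTail (N₀ := N₀) hwd N hy
        (hx0.trans_le ht)) (hint.const_mul (w y))
      (hT.tendsto_primitiveTail hwd hy (by linarith [hm y hy]) hN)
    have h2 : ‖primitiveTail α a d w T N₀ N y x‖ =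
        ‖∫ t in Ioi x, w y * tailTerm α a T N y t‖ := by
      rw [h1, zero_sub, norm_neg]
    have h3 : ‖∫ t in Ioi x, w y * tailTerm α a T N y t‖ ≤
        ∫ t in Ioi x, D * C * t ^ ((α y).re - N) := by
      refine norm_integral_le_of_norm_le ((integrableOn_Ioi_rpow_of_lt hp hx0).const_mul _) ?_
      filter_upwards [ae_restrict_mem measurableSet_Ioi] with t ht
      rw [norm_mul, mul_assoc]
      exact mul_le_mul (hD y hy) (hC y hy t (hx.trans (le_of_lt ht))) (norm_nonneg _) hD0
    rw [h2]
    refine h3.trans ?_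
    rw [integral_const_mul, integral_Ioi_rpow_of_lt hp hx0, neg_div, ← div_neg, Complex.add_re,
      Complex.one_re]
    have e : (α y).re - N + 1 = (α y).re + 1 - N := by ring
    have h5 : (N₀ : ℝ) ≤ N := by exact_mod_cast hN
    rw [e, div_mul_eq_mul_div, ← mul_div_assoc]
    have h4 : 0 ≤ D * C * x ^ ((α y).re + 1 - N) := by positivity
    exact div_le_div_of_nonneg_left h4 (by linarith) (by linarith [hm y hy])

theorem UnifSym.symBound_remainder {Y : Type*} {B : Set Y} {T : Y → NNReal → ℂ}
    (h : UnifSym B m T) {J : ℕ} (hJ : m + 1 < J) :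
    SymBound B (fun _ => m - J + 1) fun y => remainder J (T y) := by
  refine ⟨fun y hy => (h.isSym hy).contDiffOn_remainder hJ, fun k => ?_⟩
  obtain ⟨M, hM0, hM⟩ := exists_periodic_bound J
  obtain ⟨C, hC⟩ := h.bound (J + k)
  have hp : m - (J + k : ℕ) + 1 < 0 := by
    push_cast
    linarith [(Nat.cast_nonneg k : (0 : ℝ) ≤ k)]
  refine ⟨M * |C| / (-(m - (J + k : ℕ) + 1)), fun y hy x hx => ?_⟩
  have hx0 : 0 < x := zero_lt_one.trans_le hx
  have e := iteratedDeriv_of_tower (G := remainderDeriv J (T y)) isOpen_Ioi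
    (fun k x hx => (h.isSym hy).hasDerivAt_remainderDeriv hJ k hx) k (mem_Ioi.2 hx0)
  change ‖iteratedDeriv k (remainderDeriv J (T y) 0) x‖ ≤ _
  rw [e]
  refine (norm_integral_tail_le hM (C := |C|) (fun t ht => (hC y hy t ht).trans
    (mul_le_mul_of_nonneg_right (le_abs_self C) (Real.rpow_nonneg (by linarith) _)))
      (by linarith) hx0.le).trans ?_
  have e2 : m - J + 1 - k = m - (J + k : ℕ) + 1 := by push_cast; ring
  rw [e2, div_mul_eq_mul_div, ← mul_div_assoc]
  refine div_le_div_of_nonneg_right (mul_le_mul_of_nonneg_left ?_ (by positivity)) (by linarith)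
  exact Real.rpow_le_rpow_of_nonpos hx0 (by linarith) hp.le

end Primitive

end Locality

end

noncomputable section

namespace Locality

open Filter Topology MeasureTheory Set

/-! ### Expansion of interpolated sums -/

section Sum

variable {n : ℕ} {B : Set (Fin n → ℂ)} {α : (Fin n → ℂ) → ℂ} {a d : ℕ → (Fin n → ℂ) → ℂ}
  {w : (Fin n → ℂ) → ℂ} {T : (Fin n → ℂ) → NNReal → ℂ} {m : ℝ} {J : ℕ}

theorem differentiableOn_finsetProd {ι : Type*} (t : Finset ι) {f : ι → (Fin n → ℂ) → ℂ}
    (hf : ∀ i ∈ t, DifferentiableOn ℂ (f i) B) :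
    DifferentiableOn ℂ (fun y => ∏ i ∈ t, f i y) B := by
  classical
  induction t using Finset.induction_on with
  | empty => simp only [Finset.prod_empty]; exact differentiableOn_const 1
  | insert i t hi ih =>
    simp only [Finset.prod_insert hi]
    exact (hf i (Finset.mem_insert_self _ _)).mul (ih fun j hj => hf j (Finset.mem_insert_of_mem hj))

theorem Family.expands_dx (hT : Family B α a T) (i : ℕ) :
    Expands B (fun y => α y - i) (fun j y => a j y * ∏ l ∈ Finset.range i, (α y - j - l))
      (fun y => dx i (T y)) := by
  induction i with
  | zero => simpa [dx_zero] using hT.expands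
  | succ i ih =>
    have h1 := ih.deriv (g' := fun y => dx (i + 1) (T y))
      fun y hy x hx => (hT.smooth y hy).hasDerivAt i hx
    refine (h1.congr_order fun y _ => ?_).congr_coeff fun j y _ => ?_
    · push_cast
      ring
    · rw [Finset.prod_range_succ]
      ring

/-- The coefficients of the expansion of the `i`-th derivative, as an expansion of order `α + 1`. -/
def derivCoeff (α : (Fin n → ℂ) → ℂ) (a : ℕ → (Fin n → ℂ) → ℂ) (i k : ℕ) (y : Fin n → ℂ) : ℂ :=
  if i + 1 ≤ k then a (k - (i + 1)) y *
    ∏ l ∈ Finset.range i, (α y - (k - (i + 1) : ℕ) - l) else 0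

theorem Family.expands_derivCoeff (hT : Family B α a T) (i : ℕ) :
    Expands B (fun y => α y + 1) (derivCoeff α a i) (fun y => dx i (T y)) := by
  refine (((hT.expands_dx i).shift (i + 1)).congr_order fun y _ => ?_).congr_coeff fun j y _ => rfl
  push_cast
  ring

/-- The coefficients of the expansion of the Euler-MacLaurin sum. -/
def sumCoeff (α : (Fin n → ℂ) → ℂ) (a d : ℕ → (Fin n → ℂ) → ℂ) (w : (Fin n → ℂ) → ℂ) (k : ℕ)
    (y : Fin n → ℂ) : ℂ :=
  d k y + w y * ∑ i ∈ Finset.range k, emCoeff i * derivCoeff α a i k y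

/-- Coefficients `d` of the expansion of a primitive of `w` times a family with coefficients `a`. -/
structure IsPrimitiveCoeff (B : Set (Fin n → ℂ)) (α : (Fin n → ℂ) → ℂ)
    (a d : ℕ → (Fin n → ℂ) → ℂ) (w : (Fin n → ℂ) → ℂ) : Prop where
  holomorphic : DifferentiableOn ℂ w B
  bdd : BddFun B w
  real : ∀ y ∈ B, w (star y) = star (w y)
  holomorphic_coeff : ∀ j, DifferentiableOn ℂ (d j) B
  bdd_coeff : ∀ j, BddFun B (d j)
  real_coeff : ∀ j, ∀ y ∈ B, d j (star y) = star (d j y)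
  mul_eq : ∀ j, ∀ y ∈ B, d j y * (α y + 1 - j) = w y * a j y

/-- The value of the sum does not depend on the level once this is large. So for each `N` it is
computed at a level `M` for which the remainder is negligible, and only the primitive and finitely
many derivatives have to be expanded. -/
theorem Family.expands_eulerMaclaurin (hT : Family B α a T) (hα : BddFun B α)
    (hm : ∀ y ∈ B, (α y).re ≤ m) (hJ : m + 1 < J) (hJ0 : J ≠ 0)
    (hd : IsPrimitiveCoeff B α a d w) :
    Expands B (fun y => α y + 1) (sumCoeff α a d w)
      (fun y x => primitiveConst α a d w T J y + w y * eulerMaclaurin J (T y) x) := by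
  intro N
  obtain ⟨A, hA⟩ := id hα
  -- Since `Re α ≥ -A`, this gives `m - M + 1 ≤ Re α + 1 - N` for every `M ≥ J'`: the remainder of
  -- level `M` is of the order required at level `N`.
  obtain ⟨J', hJ'⟩ := exists_nat_ge (m + A + N)
  let M := J + N + J'
  have hJM : J ≤ M := by omega
  have hNM : N ≤ M := by omega
  have hM : m + 1 < M := hJ.trans_le (by exact_mod_cast hJM)
  have hU := hT.unifSym hα hm
  have h1 := hT.expands_primitive hα hm hJ hd.bdd hd.bdd_coeff hd.mul_eq N
  have h2 : SymBound B (fun y => (α y + 1).re - N) fun y x => w y * ∑ i ∈ Finset.range M,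
      emCoeff i * (dx i (T y) x - ∑ k ∈ Finset.range N,
        derivCoeff α a i k y * (x : ℂ) ^ (α y + 1 - k)) :=
    SymBound.const_mul hd.bdd (SymBound.sum _ fun i _ =>
      (hT.expands_derivCoeff i N).const_mul (bddFun_const (emCoeff i)))
  have h3 := (((hU.symBound_remainder hM).const_mul
    (bddFun_const ((-1) ^ M / (M.factorial : ℂ)))).const_mul hd.bdd).mono
      (s' := fun y => (α y + 1).re - N) fun y hy => by
        have := (abs_le.1 ((Complex.abs_re_le_norm _).trans (hA y hy))).1
        have h4 : (J' : ℝ) ≤ M := by exact_mod_cast (by omega : J' ≤ M)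
        rw [Complex.add_re, Complex.one_re]
        linarith
  refine ((h1.add h2).add h3).congr fun y hy x hx => ?_
  -- The `i`-th derivative contributes to the coefficient `k` only if `i + 1 ≤ k`, so the
  -- coefficients do not depend on `M`.
  have e1 : ∀ k ∈ Finset.range N, ∑ i ∈ Finset.range k, emCoeff i * derivCoeff α a i k y =
      ∑ i ∈ Finset.range M, emCoeff i * derivCoeff α a i k y := by
    intro k hk
    have := Finset.mem_range.1 hk
    refine Finset.sum_subset (Finset.range_mono (by omega)) fun i _ hi => ?_
    have := Finset.mem_range.not.1 hi
    rw [derivCoeff, if_neg (by omega), mul_zero]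
  have e2 : ∑ k ∈ Finset.range N, sumCoeff α a d w k y * (x : ℂ) ^ (α y + 1 - k) =
      ∑ k ∈ Finset.range N, d k y * (x : ℂ) ^ (α y + 1 - k) + w y * ∑ i ∈ Finset.range M,
        emCoeff i * ∑ k ∈ Finset.range N, derivCoeff α a i k y * (x : ℂ) ^ (α y + 1 - k) := by
    have e3 : ∑ i ∈ Finset.range M, emCoeff i * ∑ k ∈ Finset.range N,
        derivCoeff α a i k y * (x : ℂ) ^ (α y + 1 - k) = ∑ k ∈ Finset.range N,
          (∑ i ∈ Finset.range M, emCoeff i * derivCoeff α a i k y) * (x : ℂ) ^ (α y + 1 - k) := by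
      simp only [Finset.mul_sum, Finset.sum_mul]
      rw [Finset.sum_comm]
      simp only [mul_assoc]
    rw [e3, Finset.mul_sum, ← Finset.sum_add_distrib]
    refine Finset.sum_congr rfl fun k hk => ?_
    rw [sumCoeff, e1 k hk]
    ring
  beta_reduce
  rw [← (hU.isSym hy).eulerMaclaurin_eq_of_le hJ hJ0 hx.le hJM, eulerMaclaurin_eq, e2]
  simp only [mul_sub, Finset.sum_sub_distrib]
  ring

theorem SymBound.exists_bound_Icc {Y : Type*} {B : Set Y} {s : Y → ℝ} {g : Y → ℝ → ℂ}
    (hg : SymBound B s g) (hs : ∃ A, ∀ y ∈ B, |s y| ≤ A) (k : ℕ) :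
    ∃ C : ℝ, ∀ y ∈ B, ∀ x ∈ Icc (1 : ℝ) 2, ‖iteratedDeriv k (g y) x‖ ≤ C := by
  obtain ⟨C, hC0, hC⟩ := hg.exists_nonneg k
  obtain ⟨A, hA⟩ := hs
  refine ⟨C * 2 ^ (A + k), fun y hy x hx => (hC y hy x hx.1).trans
    (mul_le_mul_of_nonneg_left ?_ hC0)⟩
  refine (rpow_le_of_mem hx.1 hx.2).trans (Real.rpow_le_rpow_of_exponent_le one_le_two ?_)
  refine (abs_sub _ _).trans (add_le_add (hA y hy) ?_)
  rw [abs_of_nonneg (Nat.cast_nonneg k)]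

/-- The part of `w 𝔖_1 T` that is constant in `x` and is not accounted for by the expansion. -/
def sumConst (α : (Fin n → ℂ) → ℂ) (a d : ℕ → (Fin n → ℂ) → ℂ) (w : (Fin n → ℂ) → ℂ)
    (T : (Fin n → ℂ) → NNReal → ℂ) (J : ℕ) (y : Fin n → ℂ) : ℂ :=
  w y * T y 1 - primitiveConst α a d w T J y - w y * eulerMaclaurin J (T y) 1

theorem Family.differentiableOn_integral_tailTerm (hB : IsOpen B) (hT : Family B α a T)
    (hm : ∀ y ∈ B, (α y).re ≤ m) (hα : Differentiable ℂ α) (hJ : m + 1 < J) :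
    DifferentiableOn ℂ (fun y => ∫ t in Ioi (1 : ℝ), tailTerm α a T J y t) B := by
  obtain ⟨C, hC0, hC⟩ := hT.exists_norm_tailTerm_le J
  refine differentiableOn_integral hB (bound := fun t => C * t ^ (m - J)) (fun y hy =>
    ((hT.continuousOn_tailTerm J hy).mono (Ioi_subset_Ioi zero_le_one)).aestronglyMeasurable
      measurableSet_Ioi) ?_ ?_
    ((integrableOn_Ioi_rpow_of_lt (a := m - J) (by linarith) one_pos).const_mul C)
  · filter_upwards [ae_restrict_mem measurableSet_Ioi] with t ht
    have ht0 : (t : ℂ) ≠ 0 := Complex.ofReal_ne_zero.2 (zero_lt_one.trans ht).ne'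
    refine (hT.holomorphic _).sub (DifferentiableOn.fun_sum fun j _ =>
      (hT.holomorphic_coeff j).mul ?_)
    exact ((hα.sub_const _).const_cpow (Or.inl ht0)).differentiableOn
  · filter_upwards [ae_restrict_mem measurableSet_Ioi] with t ht y hy
    refine (hC y hy t (le_of_lt ht)).trans (mul_le_mul_of_nonneg_left ?_ hC0)
    exact Real.rpow_le_rpow_of_exponent_le (le_of_lt ht) (by linarith [hm y hy])

variable {r : ℝ} {ℓ : Fin n → ℝ} {c : ℝ}

theorem Family.star_coeff (hT : Family (Metric.ball 0 r) (affineOrder ℓ c) a T) (j : ℕ)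
    {y : Fin n → ℂ} (hy : y ∈ Metric.ball 0 r) : a j (star y) = star (a j y) :=
  hT.expands.star_coeff (fun _ => star_mem_ball) (fun y _ => affineOrder_star ℓ c y)
    (fun y hy _ _ => hT.real y hy _) j hy

theorem differentiable_affineOrder (ℓ : Fin n → ℝ) (c : ℝ) :
    Differentiable ℂ (affineOrder ℓ c) := (differentiable_dot ℓ).add_const _

theorem Family.star_tailTerm (hT : Family (Metric.ball 0 r) (affineOrder ℓ c) a T) (N : ℕ)
    {y : Fin n → ℂ} (hy : y ∈ Metric.ball 0 r) {x : ℝ} (hx : 0 < x) :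
    tailTerm (affineOrder ℓ c) a T N (star y) x =
      star (tailTerm (affineOrder ℓ c) a T N y x) := by
  rw [tailTerm, tailTerm, star_sub, star_sum]
  congr 1
  · exact hT.real y hy _
  · refine Finset.sum_congr rfl fun j _ => ?_
    rw [star_mul', star_ofReal_cpow hx, hT.star_coeff j hy, star_sub, star_natCast,
      affineOrder_star]

theorem Family.differentiableOn_sumConst
    (hT : Family (Metric.ball 0 r) (affineOrder ℓ c) a T)
    (hm : ∀ y ∈ Metric.ball 0 r, (affineOrder ℓ c y).re ≤ m) (hJ : m + 1 < J)
    (hd : IsPrimitiveCoeff (Metric.ball 0 r) (affineOrder ℓ c) a d w) :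
    DifferentiableOn ℂ (sumConst (affineOrder ℓ c) a d w T J) (Metric.ball 0 r) := by
  have hU := hT.unifSym (bddFun_affineOrder ℓ c r) hm
  refine ((hd.holomorphic.mul (hT.holomorphic 1)).sub ?_).sub (hd.holomorphic.mul
    (hU.differentiableOn_eulerMaclaurin Metric.isOpen_ball hT.holomorphic hJ zero_le_one))
  refine DifferentiableOn.sub (DifferentiableOn.fun_sum fun j _ => hd.holomorphic_coeff j)
    (hd.holomorphic.mul (hT.differentiableOn_integral_tailTerm Metric.isOpen_ball hm
      (differentiable_affineOrder ℓ c) hJ))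

theorem Family.star_sumConst (hT : Family (Metric.ball 0 r) (affineOrder ℓ c) a T)
    (hd : IsPrimitiveCoeff (Metric.ball 0 r) (affineOrder ℓ c) a d w) {y : Fin n → ℂ}
    (hy : y ∈ Metric.ball 0 r) :
    sumConst (affineOrder ℓ c) a d w T J (star y) =
      star (sumConst (affineOrder ℓ c) a d w T J y) := by
  have h1 : T (star y) = star (T y) := funext fun x => hT.real y hy x
  have h2 : ∫ t in Ioi (1 : ℝ), tailTerm (affineOrder ℓ c) a T J (star y) t =
      star (∫ t in Ioi (1 : ℝ), tailTerm (affineOrder ℓ c) a T J y t) := by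
    refine Eq.trans ?_ (integral_conj (f := fun t => tailTerm (affineOrder ℓ c) a T J y t))
    refine setIntegral_congr_fun measurableSet_Ioi fun t ht => ?_
    exact hT.star_tailTerm J hy (zero_lt_one.trans ht)
  simp only [sumConst, primitiveConst, h1, h2, eulerMaclaurin_star, hd.real y hy, star_sub,
    star_mul', star_sum, hd.real_coeff _ y hy, Pi.star_apply]

/-- The family `w 𝔖_1 T` up to a function of the parameters only. -/
theorem Family.sumOne (hT : Family (Metric.ball 0 r) (affineOrder ℓ c) a T)
    (hm : ∀ y ∈ Metric.ball 0 r, (affineOrder ℓ c y).re ≤ m) (hJ : m + 1 < J) (hJ0 : J ≠ 0)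
    (hd : IsPrimitiveCoeff (Metric.ball 0 r) (affineOrder ℓ c) a d w) :
    Family (Metric.ball 0 r) (affineOrder ℓ (c + 1)) (sumCoeff (affineOrder ℓ c) a d w)
      (fun y x => w y * Locality.sumOne (T y) x - sumConst (affineOrder ℓ c) a d w T J y) := by
  have hα := bddFun_affineOrder ℓ c r
  have hU := hT.unifSym hα hm
  have hsmooth : ∀ y ∈ Metric.ball (0 : Fin n → ℂ) r, Smooth fun x =>
      w y * Locality.sumOne (T y) x - sumConst (affineOrder ℓ c) a d w T J y := fun y hy =>
    (contDiffOn_const.mul (hU.isSym hy).smooth_sumOne).sub contDiffOn_const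
  have hexp : Expands (Metric.ball 0 r) (affineOrder ℓ (c + 1))
      (sumCoeff (affineOrder ℓ c) a d w) (fun y => ext fun x =>
        w y * Locality.sumOne (T y) x - sumConst (affineOrder ℓ c) a d w T J y) := by
    refine ((hT.expands_eulerMaclaurin hα hm hJ hJ0 hd).congr_order fun y _ => ?_).congr
      fun y hy x hx => ?_
    · rw [affineOrder_eq, affineOrder_eq, Complex.ofReal_add, Complex.ofReal_one, add_assoc]
    · change w y * ext (Locality.sumOne (T y)) x - sumConst (affineOrder ℓ c) a d w T J y = _
      rw [(hU.isSym hy).ext_sumOne hJ hJ0 hx.le, sumConst]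
      ring
  refine ⟨fun x => ?_, fun k => ?_, fun y hy x => ?_, hsmooth, fun k => ?_, hexp⟩
  · exact (hd.holomorphic.mul (hU.differentiableOn_sumOne Metric.isOpen_ball hT.holomorphic x)).sub
      (hT.differentiableOn_sumConst hm hJ hd)
  · refine (hd.holomorphic_coeff k).add (hd.holomorphic.mul
      (DifferentiableOn.fun_sum fun i _ => DifferentiableOn.const_mul ?_ _))
    unfold derivCoeff
    split_ifs
    · refine (hT.holomorphic_coeff _).mul (differentiableOn_finsetProd _ fun l _ => ?_)
      exact (((differentiable_affineOrder ℓ c).sub_const _).sub_const _).differentiableOn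
    · exact differentiableOn_const 0
  · have h1 : T (star y) = star (T y) := funext fun x => hT.real y hy x
    rw [h1, sumOne_star (hU.isSym hy), hd.real y hy, hT.star_sumConst hd hy, star_sub, star_mul',
      Pi.star_apply]
  -- Bounds on `[0, 1]` come from the difference equation, which expresses the sum at `x` by the sum
  -- and `T` at `x + 1` in `[1, 2]`, where the estimates at infinity apply.
  · have hG : SymBound (Metric.ball 0 r) (fun y => (affineOrder ℓ (c + 1) y).re) fun y x =>
        ext (fun x => w y * Locality.sumOne (T y) x - sumConst (affineOrder ℓ c) a d w T J y) x -
          w y * ext (T y) x :=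
      hexp.symBound.sub ((hT.expands.symBound.const_mul hd.bdd).mono fun y _ => by
        simp [affineOrder_eq])
    obtain ⟨A, hA⟩ := bddFun_affineOrder ℓ (c + 1) r
    obtain ⟨C, hC⟩ := hG.exists_bound_Icc
      ⟨A, fun y hy => (Complex.abs_re_le_norm _).trans (hA y hy)⟩ k
    refine ⟨C, fun y hy x hx => ?_⟩
    have hx1 : x + 1 ∈ Icc (1 : ℝ) 2 := ⟨by linarith [hx.1], by linarith [hx.2]⟩
    refine le_trans (le_of_eq ?_) (hC y hy (x + 1) hx1)
    congr 1
    have e1 : EqOn (ext fun x => w y * Locality.sumOne (T y) x -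
          sumConst (affineOrder ℓ c) a d w T J y)
        (fun x => ext (fun x => w y * Locality.sumOne (T y) x -
          sumConst (affineOrder ℓ c) a d w T J y) (x + 1) - w y * ext (T y) (x + 1)) (Ici 0) := by
      intro t ht
      change w y * ext (Locality.sumOne (T y)) t - _ =
        w y * ext (Locality.sumOne (T y)) (t + 1) - _ - _
      rw [(hU.isSym hy).ext_sumOne_eq_sub ht]
      ring
    change iteratedDerivWithin k _ (Ici 0) x = _
    rw [iteratedDerivWithin_congr e1 (mem_Ici.2 hx.1), iteratedDerivWithin_eq_iteratedDeriv
      (uniqueDiffOn_Ici 0) _ (mem_Ici.2 hx.1)]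
    · exact congrFun (iteratedDeriv_comp_add_const k (fun x =>
        ext (fun x => w y * Locality.sumOne (T y) x - sumConst (affineOrder ℓ c) a d w T J y) x -
          w y * ext (T y) x) 1) x
    · have h2 := contDiffAt_of_Ioi (hG.1 y hy) hx1.1 k
      exact h2.comp x (contDiffAt_id.add contDiffAt_const)

end Sum

end Locality

end

noncomputable section

namespace Locality

open Filter Topology MeasureTheory Set

/-! ### Summation of meromorphic germs of symbols -/

section Summation

variable {n : ℕ} {a : ℕ → (Fin n → ℂ) → ℂ} {T : (Fin n → ℂ) → NNReal → ℂ} {r : ℝ}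
  {ℓ : Fin n → ℝ} {c : ℝ}

/-- The nonzero numbers `s - j` stay away from `0` uniformly in `j`, so that a single ball of
parameters serves all the denominators `α + 1 - j`. -/
theorem exists_dist_nat_le (s : ℝ) :
    ∃ δ : ℝ, 0 < δ ∧ ∀ j : ℕ, s - j ≠ 0 → δ ≤ |s - j| := by
  by_cases h : s - round s = 0
  · refine ⟨1, one_pos, fun j hj => ?_⟩
    have e : s - j = ((round s - j : ℤ) : ℝ) := by
      push_cast
      linarith
    rw [e] at hj ⊢
    rw [← Int.cast_abs]
    exact_mod_cast Int.one_le_abs (by exact_mod_cast hj)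
  · exact ⟨|s - round s|, abs_pos.2 h, fun j _ => round_le s j⟩

/-- For constant order, only powers of `x` with exponent a natural number occur. -/
def IsIntegral (r : ℝ) (ℓ : Fin n → ℝ) (c : ℝ) (a : ℕ → (Fin n → ℂ) → ℂ) : Prop :=
  ℓ ≠ 0 ∨ ∀ j : ℕ, (∀ m : ℕ, c - j ≠ m) → ∀ y ∈ Metric.ball (0 : Fin n → ℂ) r, a j y = 0

/-- The factor by which sums of families of order `ℓ + c` are multiplied to make them
holomorphic. -/
def poleFactor (ℓ : Fin n → ℝ) (y : Fin n → ℂ) : ℂ := if ℓ = 0 then 1 else dot ℓ y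

/-- Coefficients of the expansion of primitives. -/
def primitiveCoeff (ℓ : Fin n → ℝ) (c : ℝ) (a : ℕ → (Fin n → ℂ) → ℂ) (j : ℕ) (y : Fin n → ℂ) : ℂ :=
  if c + 1 - j = 0 then (if ℓ = 0 then 0 else a j y)
  else poleFactor ℓ y * a j y * (affineOrder ℓ c y + 1 - j)⁻¹

theorem exists_isPrimitiveCoeff (hr : 0 < r)
    (hT : Family (Metric.ball 0 r) (affineOrder ℓ c) a T) (hint : IsIntegral r ℓ c a) :
    ∃ r' : ℝ, 0 < r' ∧ r' ≤ r ∧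
      IsPrimitiveCoeff (Metric.ball 0 r') (affineOrder ℓ c) a (primitiveCoeff ℓ c a)
        (poleFactor ℓ) := by
  obtain ⟨δ, hδ, hδj⟩ := exists_dist_nat_le (c + 1)
  -- With the linear part of the order below `δ / 2`, every denominator whose constant term is
  -- nonzero has modulus at least `δ / 2`.
  have hnear : {y : Fin n → ℂ | ‖dot ℓ y‖ < δ / 2} ∈ 𝓝 0 := by
    refine (isOpen_lt (continuous_dot ℓ).norm continuous_const).mem_nhds ?_
    simpa [dot] using hδ
  obtain ⟨ε, hε, hball⟩ := Metric.mem_nhds_iff.1 hnear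
  have hsub : Metric.ball (0 : Fin n → ℂ) (min r ε) ⊆ Metric.ball 0 r :=
    Metric.ball_subset_ball (min_le_left _ _)
  have hinv : ∀ j : ℕ, c + 1 - j ≠ 0 → ∀ y ∈ Metric.ball (0 : Fin n → ℂ) (min r ε),
      δ / 2 ≤ ‖affineOrder ℓ c y + 1 - j‖ := by
    intro j hj y hy
    have h1 : ‖dot ℓ y‖ < δ / 2 := hball (Metric.ball_subset_ball (min_le_right _ _) hy)
    have h2 : affineOrder ℓ c y + 1 - j = ((c + 1 - j : ℝ) : ℂ) - -dot ℓ y := by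
      rw [affineOrder_eq]
      push_cast
      ring
    have h3 := norm_sub_norm_le ((c + 1 - j : ℝ) : ℂ) (-dot ℓ y)
    rw [norm_neg, Complex.norm_real, Real.norm_eq_abs] at h3
    rw [h2]
    linarith [hδj j hj]
  have hne : ∀ j : ℕ, c + 1 - j ≠ 0 → ∀ y ∈ Metric.ball (0 : Fin n → ℂ) (min r ε),
      affineOrder ℓ c y + 1 - j ≠ 0 := fun j hj y hy => by
    rw [← norm_pos_iff]
    linarith [hinv j hj y hy]
  have hwd : Differentiable ℂ (poleFactor ℓ) := by
    unfold poleFactor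
    split_ifs
    · exact differentiable_const 1
    · exact differentiable_dot ℓ
  have hwb : BddFun (Metric.ball 0 (min r ε)) (poleFactor ℓ) := by
    unfold poleFactor
    split_ifs
    · exact bddFun_const 1
    · exact bddFun_dot ℓ _
  have hwr : ∀ y, poleFactor ℓ (star y) = star (poleFactor ℓ y) := by
    intro y
    unfold poleFactor
    split_ifs
    · exact star_one _ |>.symm
    · exact dot_star ℓ y
  refine ⟨min r ε, lt_min hr hε, min_le_left _ _, hwd.differentiableOn, hwb, fun y _ => hwr y,
    fun j => ?_, fun j => ?_, fun j y hy => ?_, fun j y hy => ?_⟩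
  · unfold primitiveCoeff
    split_ifs with h1 h2
    · exact differentiableOn_const 0
    · exact (hT.holomorphic_coeff j).mono hsub
    · refine (hwd.differentiableOn.mul ((hT.holomorphic_coeff j).mono hsub)).mul ?_
      exact (((differentiable_affineOrder ℓ c).add_const 1).sub_const _).differentiableOn.inv
        (hne j h1)
  · unfold primitiveCoeff
    split_ifs with h1 h2
    · exact bddFun_const 0
    · exact (hT.expands.bddFun j).subset hsub
    · refine (hwb.mul ((hT.expands.bddFun j).subset hsub)).mul ⟨(δ / 2)⁻¹, fun y hy => ?_⟩
      rw [norm_inv]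
      exact inv_anti₀ (by positivity) (hinv j h1 y hy)
  · unfold primitiveCoeff
    split_ifs with h1 h2
    · exact (star_zero _).symm
    · exact hT.star_coeff j (hsub hy)
    · rw [hwr, hT.star_coeff j (hsub hy), affineOrder_star, star_mul', star_mul', star_inv₀,
        star_sub, star_add, star_one, star_natCast]
  · unfold primitiveCoeff
    split_ifs with h1 h2
    · rcases hint with h | h
      · exact absurd h2 h
      -- Constant order and `c - j = -1`: by integrality `x ^ (-1)` does not occur, so no logarithm
      -- arises.
      · rw [h j (fun m hm => ?_) y (hsub hy), mul_zero, zero_mul]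
        have : (0 : ℝ) ≤ m := Nat.cast_nonneg m
        linarith
    -- At the critical index the denominator is the linear form `ℓ` itself, which is exactly the
    -- factor `poleFactor`.
    · have h3 : affineOrder ℓ c y + 1 - j = dot ℓ y := by
        have : (c : ℂ) + 1 - j = 0 := by exact_mod_cast congrArg (fun x : ℝ => (x : ℂ)) h1
        rw [affineOrder_eq]
        linear_combination this
      rw [h3, poleFactor, if_neg h2, mul_comm]
    · rw [inv_mul_cancel_right₀ (hne j h1 y hy)]

/-- For constant order the surviving powers are `x ^ m` with `m` natural. Their derivatives of order
greater than `m` vanish because the falling product contains the factor `m - m`, and their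
primitives have natural exponents. -/
theorem isIntegral_sumCoeff {r' : ℝ} (hr' : r' ≤ r) (hint : IsIntegral r ℓ c a) :
    IsIntegral r' ℓ (c + 1)
      (sumCoeff (affineOrder ℓ c) a (primitiveCoeff ℓ c a) (poleFactor ℓ)) := by
  rcases hint with h | h
  · exact Or.inl h
  by_cases hℓ : ℓ = 0
  swap
  · exact Or.inl hℓ
  refine Or.inr fun k hk y hy => ?_
  have hy' := Metric.ball_subset_ball hr' hy
  have h1 : primitiveCoeff ℓ c a k y = 0 := by
    have h2 : a k y = 0 := h k (fun m hm => hk (m + 1) (by push_cast; linarith)) y hy'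
    unfold primitiveCoeff
    split_ifs <;> simp [h2]
  rw [sumCoeff, h1, zero_add, Finset.sum_eq_zero, mul_zero]
  intro i hi
  have hik : i + 1 ≤ k := Finset.mem_range.1 hi
  rw [derivCoeff, if_pos hik]
  by_cases hm : ∃ m : ℕ, c - (k - (i + 1) : ℕ) = m
  · obtain ⟨m, hm⟩ := hm
    have hmi : m < i := by
      by_contra hmi
      refine hk (m - i) ?_
      push_cast [Nat.cast_sub (not_lt.1 hmi), Nat.cast_sub hik] at hm ⊢
      linarith
    have h3 : affineOrder ℓ c y - (k - (i + 1) : ℕ) - (m : ℕ) = 0 := by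
      have : (c : ℂ) - (k - (i + 1) : ℕ) = m := by
        exact_mod_cast congrArg (fun x : ℝ => (x : ℂ)) hm
      rw [affineOrder_eq, hℓ]
      simp only [dot, Pi.zero_apply, Complex.ofReal_zero, zero_mul, Finset.sum_const_zero]
      linear_combination this
    rw [Finset.prod_eq_zero (Finset.mem_range.2 hmi) h3, mul_zero, mul_zero]
  · push Not at hm
    rw [h _ hm y hy', zero_mul, mul_zero]

variable {Q : LinearMap.BilinForm ℝ (ℕ →₀ ℝ)}

/-- The germ of a quotient of a family by a product of linear forms. -/
def quotientGerm (Q : LinearMap.BilinForm ℝ (ℕ →₀ ℝ)) (w : List (ℕ →₀ ℝ))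
    (T : (Fin n → ℂ) → NNReal → ℂ) : FunGerm Q :=
  ((fun z x => ((w.map fun v => linForm Q v z).prod)⁻¹ * T (coords Q n z) x :
      (ℕ →₀ ℂ) → NNReal → ℂ) : FunGerm Q)

theorem quotientGerm_mem (hr : 0 < r) (hT : Family (Metric.ball 0 r) (affineOrder ℓ c) a T)
    (hint : IsIntegral r ℓ c a) {w : List (ℕ →₀ ℝ)} (hw : ∀ v ∈ w, v ≠ 0) :
    quotientGerm Q w T ∈ symbolGerms Q :=
  Submodule.subset_span ⟨n, r, ℓ, c, a, T, w, hr, hT.isHolSymbolFamily, hw, hint, rfl⟩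

theorem exists_re_le (ℓ : Fin n → ℝ) (c r : ℝ) :
    ∃ m : ℝ, ∀ y ∈ Metric.ball (0 : Fin n → ℂ) r, (affineOrder ℓ c y).re ≤ m := by
  obtain ⟨A, hA⟩ := bddFun_affineOrder ℓ c r
  exact ⟨A, fun y hy => (Complex.re_le_norm _).trans (hA y hy)⟩

theorem Family.exists_eventually_isSym (hr : 0 < r)
    (hT : Family (Metric.ball 0 r) (affineOrder ℓ c) a T) :
    ∃ m : ℝ, ∀ᶠ z in genericNhds Q, IsSym m (T (coords Q n z)) := by
  obtain ⟨m, hm⟩ := exists_re_le ℓ c r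
  refine ⟨m, (eventually_coords_mem_ball n hr).mono fun z hz => ?_⟩
  exact (hT.unifSym (bddFun_affineOrder ℓ c r) hm).isSym hz

theorem isIntegral_const (K : (Fin n → ℂ) → ℂ) (r : ℝ) :
    IsIntegral r (0 : Fin n → ℝ) 0 (fun j y => if j = 0 then K y else 0) := by
  refine Or.inr fun j hj y _ => if_neg ?_
  rintro rfl
  exact hj 0 (by simp)

theorem quotientGerm_const_mem (hr : 0 < r) {K : (Fin n → ℂ) → ℂ}
    (hd : DifferentiableOn ℂ K (Metric.ball 0 r))
    (hreal : ∀ y ∈ Metric.ball 0 r, K (star y) = star (K y)) {w : List (ℕ →₀ ℝ)}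
    (hw : ∀ v ∈ w, v ≠ 0) : quotientGerm Q w (fun y _ => K y) ∈ symbolGerms Q := by
  -- `K` may be unbounded on the given open ball, but it is bounded on the ball of half the radius.
  have hsub : Metric.ball (0 : Fin n → ℂ) (r / 2) ⊆ Metric.ball 0 r :=
    Metric.ball_subset_ball (by linarith)
  refine quotientGerm_mem (half_pos hr) ((family_const (hd.mono hsub) (exists_bddFun hr hd)
    fun y hy => hreal y (hsub hy)).congr_order (α' := affineOrder 0 0) fun y _ => ?_)
    (isIntegral_const K _) hw
  simp [affineOrder]

/-- After multiplication by `poleFactor`, the sum is a family of order `α + 1` plus a function of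
the parameters alone. The latter is split off because `x ^ 0` need not be among the powers `x ^ (α +
1 - j)`. Dividing again adds the linear form `ℓ` to the denominator if `ℓ ≠ 0`. -/
theorem map_sumOne_mem (hr : 0 < r) (hT : Family (Metric.ball 0 r) (affineOrder ℓ c) a T)
    (hint : IsIntegral r ℓ c a) {w : List (ℕ →₀ ℝ)} (hw : ∀ v ∈ w, v ≠ 0) :
    Germ.map sumOne (quotientGerm Q w T) ∈ symbolGerms Q := by
  obtain ⟨r', hr'0, hr', hd⟩ := exists_isPrimitiveCoeff hr hT hint
  have hT' := hT.subset (Metric.ball_subset_ball hr')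
  obtain ⟨m, hm⟩ := exists_re_le ℓ c r'
  obtain ⟨J, hJ, hJ0⟩ := exists_level m
  let w' : List (ℕ →₀ ℝ) := if ℓ = 0 then w else emb n ℓ :: w
  have hw' : ∀ v ∈ w', v ≠ 0 := by
    intro v hv
    by_cases hℓ : ℓ = 0
    · rw [show w' = w from if_pos hℓ] at hv
      exact hw v hv
    · rw [show w' = emb n ℓ :: w from if_neg hℓ, List.mem_cons] at hv
      rcases hv with rfl | hv
      · exact fun h => hℓ (emb_eq_zero.1 h)
      · exact hw v hv
  have hprod : ∀ z, (w'.map fun v => linForm Q v z).prod =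
      poleFactor ℓ (coords Q n z) * (w.map fun v => linForm Q v z).prod := by
    intro z
    by_cases hℓ : ℓ = 0
    · rw [show w' = w from if_pos hℓ, poleFactor, if_pos hℓ, one_mul]
    · rw [show w' = emb n ℓ :: w from if_neg hℓ, poleFactor, if_neg hℓ, List.map_cons,
        List.prod_cons, linForm_emb]
  have hne : ∀ᶠ z in genericNhds Q, poleFactor ℓ (coords Q n z) ≠ 0 := by
    unfold poleFactor
    by_cases hℓ : ℓ = 0
    · simp [hℓ]
    · simp only [hℓ, if_false]
      exact eventually_dot_ne_zero hℓ
  have h1 := quotientGerm_mem (Q := Q) hr'0 (hT'.sumOne hm hJ hJ0 hd)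
    (isIntegral_sumCoeff hr' hint) hw'
  have h2 := quotientGerm_const_mem (Q := Q) hr'0 (hT'.differentiableOn_sumConst hm hJ hd)
    (fun y hy => hT'.star_sumConst (J := J) hd hy) hw'
  have h3 := (symbolGerms Q).add_mem h1 h2
  convert h3 using 1
  refine Germ.coe_eq.2 ?_
  obtain ⟨m', hm'⟩ := hT.exists_eventually_isSym (Q := Q) hr
  filter_upwards [hne, hm'] with z hz hsym
  have h4 := hsym.sumOne_smul ((w.map fun v => linForm Q v z).prod)⁻¹
  refine h4.trans ?_
  ext x
  change _ * sumOne (T (coords Q n z)) x = _ * (_ - _) + _ * _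
  rw [hprod, mul_inv]
  field_simp
  ring

/-- The summation of functions is shown to be linear only on symbols. For linearity on germs, the
generic values of a germ have to be symbols of a common order. -/
theorem exists_eventually_isSym {σ : FunGerm Q} (hσ : σ ∈ symbolGerms Q) :
    ∃ m : ℝ, σ.LiftPred (IsSym m) := by
  induction hσ using Submodule.span_induction with
  | mem σ h =>
    obtain ⟨n, r, ℓ, c, a, T, w, hr, hT, -, -, rfl⟩ := h
    obtain ⟨m, hm⟩ := hT.family.exists_eventually_isSym (Q := Q) hr
    exact ⟨m, hm.mono fun z hz => hz.smul _⟩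
  | zero => exact ⟨0, Eventually.of_forall fun _ => isSym_zero 0⟩
  | add σ τ _ _ hσ hτ =>
    obtain ⟨m, hm⟩ := hσ
    obtain ⟨m', hm'⟩ := hτ
    refine ⟨max m m', ?_⟩
    induction σ using Germ.inductionOn with | _ s
    induction τ using Germ.inductionOn with | _ t
    exact (hm.and hm').mono fun z hz =>
      (hz.1.mono (le_max_left _ _)).add (hz.2.mono (le_max_right _ _))
  | smul c σ _ hσ =>
    obtain ⟨m, hm⟩ := hσ
    induction σ using Germ.inductionOn with | _ s
    exact ⟨m, hm.mono fun z hz => hz.smul (c : ℂ)⟩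

theorem summationGerm_add (lam : ℤ) {σ τ : FunGerm Q} (hσ : σ ∈ symbolGerms Q)
    (hτ : τ ∈ symbolGerms Q) :
    summationGerm Q lam (σ + τ) = summationGerm Q lam σ + summationGerm Q lam τ := by
  obtain ⟨m, hm⟩ := exists_eventually_isSym hσ
  obtain ⟨m', hm'⟩ := exists_eventually_isSym hτ
  induction σ using Germ.inductionOn with | _ s
  induction τ using Germ.inductionOn with | _ t
  exact Germ.coe_eq.2 ((hm.and hm').mono fun z hz =>
    (hz.1.mono (le_max_left m m')).summation_add lam (hz.2.mono (le_max_right m m')))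

theorem summationGerm_smul (lam : ℤ) (c : ℝ) {σ : FunGerm Q} (hσ : σ ∈ symbolGerms Q) :
    summationGerm Q lam (c • σ) = c • summationGerm Q lam σ := by
  obtain ⟨m, hm⟩ := exists_eventually_isSym hσ
  induction σ using Germ.inductionOn with | _ s
  exact Germ.coe_eq.2 (hm.mono fun z hz => hz.summation_smul lam (c : ℂ))

theorem summationGerm_mem (lam : ℤ) {σ : FunGerm Q} (hσ : σ ∈ symbolGerms Q) :
    summationGerm Q lam σ ∈ symbolGerms Q := by
  induction hσ using Submodule.span_induction with
  | mem σ h =>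
    have hσ := Submodule.subset_span (R := ℝ) h
    obtain ⟨n, r, ℓ, c, a, T, w, hr, hT, hw, hint, rfl⟩ := h
    have h1 := map_sumOne_mem (Q := Q) hr hT.family hint hw
    by_cases hlam : lam = 1
    · convert h1 using 1
      rw [summationGerm]
      congr 1
      ext f
      rw [summation, if_pos hlam]
    · convert (symbolGerms Q).sub_mem h1 hσ using 1
      refine Germ.coe_eq.2 (Eventually.of_forall fun z => ?_)
      exact if_neg hlam
  | zero =>
    have h := summationGerm_smul (Q := Q) lam 0 (symbolGerms Q).zero_mem
    rw [zero_smul, zero_smul] at h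
    rw [h]
    exact (symbolGerms Q).zero_mem
  | add σ τ hσ hτ ihσ ihτ =>
    rw [summationGerm_add lam hσ hτ]
    exact (symbolGerms Q).add_mem ihσ ihτ
  | smul c σ hσ ih =>
    rw [summationGerm_smul lam c hσ]
    exact (symbolGerms Q).smul_mem c ih

/-- The summation map on the space of meromorphic germs of symbols. -/
def summationMap (Q : LinearMap.BilinForm ℝ (ℕ →₀ ℝ)) (lam : ℤ) :
    symbolGerms Q →ₗ[ℝ] symbolGerms Q where
  toFun σ := ⟨summationGerm Q lam σ, summationGerm_mem lam σ.2⟩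
  map_add' σ τ := Subtype.ext (summationGerm_add lam σ.2 τ.2)
  map_smul' c σ := Subtype.ext (summationGerm_smul lam c σ.2)

theorem one_mem_symbolGerms : (1 : FunGerm Q) ∈ symbolGerms Q := by
  have h := quotientGerm_const_mem (Q := Q) (n := 0) (r := 1) (K := fun _ => 1) (w := []) one_pos
    (differentiableOn_const 1) (fun _ _ => (star_one ℂ).symm) (by simp)
  convert h using 1
  refine Germ.coe_eq.2 (Eventually.of_forall fun z => ?_)
  ext x
  simp

end Summation

end Locality

end

noncomputable section

namespace Locality

open Filter Topology MeasureTheory Set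

/-! ### Uniqueness of asymptotic expansions -/

section Unique

/-- If the two powers agreed on `[1, ∞)`, their one-sided derivatives at `1`, which are `e` and
`e'`, would agree. -/
theorem exists_dilation_ne {e e' : ℂ} (h : e ≠ e') :
    ∃ x : ℝ, 1 ≤ x ∧ (x : ℂ) ^ e ≠ (x : ℂ) ^ e' := by
  by_contra! hall
  have h1 : ∀ᶠ x : ℝ in 𝓝[≥] 1, (x : ℂ) ^ e = (x : ℂ) ^ e' :=
    eventually_mem_nhdsWithin.mono fun x hx => hall x hx
  have hd := fun z : ℂ => (hasDerivAt_cpow one_pos z).hasDerivWithinAt (s := Ici 1)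
  have h2 := (hd e).congr_of_eventuallyEq (h1.mono fun x hx => hx.symm) (by simp)
  have h3 := (uniqueDiffWithinAt_Ici (1 : ℝ)).eq_deriv _ h2 (hd e')
  simp at h3
  exact h h3

/-- If a finite sum of powers of `x` decays faster than one of them, that one has coefficient `0`. -/
theorem eq_zero_of_sum_cpow_le {κ : Type*} {e₀ c₀ : ℂ} {ρ : ℝ} (hρ : ρ < e₀.re) (P : Finset κ)
    {e c : κ → ℂ} {C : ℝ} (he : ∀ p ∈ P, e p ≠ e₀)
    (hC : ∀ x : ℝ, 1 ≤ x → ‖c₀ * (x : ℂ) ^ e₀ + ∑ p ∈ P, c p * (x : ℂ) ^ e p‖ ≤ C * x ^ ρ) :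
    c₀ = 0 := by
  classical
  induction P using Finset.induction_on generalizing c₀ c C with
  | empty =>
    have h1 : Tendsto (fun x : ℝ => C * x ^ (-(e₀.re - ρ))) atTop (𝓝 (C * 0)) :=
      (tendsto_rpow_neg_atTop (by linarith)).const_mul C
    rw [mul_zero] at h1
    have h2 : ‖c₀‖ ≤ 0 := by
      refine ge_of_tendsto h1 ?_
      filter_upwards [eventually_ge_atTop 1] with x hx
      have hx0 : 0 < x := zero_lt_one.trans_le hx
      have h3 := hC x hx
      rw [Finset.sum_empty, add_zero, norm_mul, norm_ofReal_cpow hx0] at h3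
      have h4 : ‖c₀‖ = ‖c₀‖ * x ^ e₀.re * x ^ (-e₀.re) := by
        rw [mul_assoc, ← Real.rpow_add hx0, add_neg_cancel, Real.rpow_zero, mul_one]
      rw [h4, neg_sub, sub_eq_add_neg, Real.rpow_add hx0, ← mul_assoc]
      exact mul_le_mul_of_nonneg_right h3 (Real.rpow_nonneg hx0.le _)
    exact norm_le_zero_iff.1 h2
  | insert q P hq ih =>
    -- Subtracting `l ^ (e q)` times the sum at `x` from the sum at `l x` removes the power with
    -- exponent `e q`. It preserves the decay and multiplies `c₀` by a nonzero number.
    obtain ⟨l, hl, hne⟩ := exists_dilation_ne (he q (Finset.mem_insert_self q P))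
    have hl0 : 0 < l := zero_lt_one.trans_le hl
    have key := ih (c₀ := c₀ * ((l : ℂ) ^ e₀ - (l : ℂ) ^ e q))
      (c := fun p => c p * ((l : ℂ) ^ e p - (l : ℂ) ^ e q))
      (C := C * l ^ ρ + ‖(l : ℂ) ^ e q‖ * C) (fun p hp => he p (Finset.mem_insert_of_mem hp))
      fun x hx => ?_
    · exact (mul_eq_zero.1 key).resolve_right (sub_ne_zero.2 hne.symm)
    · have hx0 : 0 < x := zero_lt_one.trans_le hx
      have h1 := hC (l * x) (one_le_mul_of_one_le_of_one_le hl hx)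
      have h2 := hC x hx
      rw [Real.mul_rpow hl0.le hx0.le, ← mul_assoc] at h1
      have hpow : ∀ z : ℂ, ((l * x : ℝ) : ℂ) ^ z = (l : ℂ) ^ z * (x : ℂ) ^ z := fun z => by
        rw [Complex.ofReal_mul, Complex.mul_cpow_ofReal_nonneg hl0.le hx0.le]
      have e1 : c₀ * ((l : ℂ) ^ e₀ - (l : ℂ) ^ e q) * (x : ℂ) ^ e₀ +
          ∑ p ∈ P, c p * ((l : ℂ) ^ e p - (l : ℂ) ^ e q) * (x : ℂ) ^ e p =
          (c₀ * ((l * x : ℝ) : ℂ) ^ e₀ + ∑ p ∈ insert q P, c p * ((l * x : ℝ) : ℂ) ^ e p) -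
            (l : ℂ) ^ e q * (c₀ * (x : ℂ) ^ e₀ + ∑ p ∈ insert q P, c p * (x : ℂ) ^ e p) := by
        simp only [Finset.sum_insert hq, hpow, mul_sub, sub_mul, Finset.sum_sub_distrib, mul_add,
          Finset.mul_sum]
        have e2 : ∀ p, (l : ℂ) ^ e q * (c p * (x : ℂ) ^ e p) =
            c p * (l : ℂ) ^ e q * (x : ℂ) ^ e p := fun p => by ring
        simp only [e2, ← mul_assoc]
        ring
      rw [e1, add_mul]
      refine (norm_sub_le _ _).trans (add_le_add h1 ?_)
      rw [norm_mul, mul_assoc]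
      exact mul_le_mul_of_nonneg_left h2 (norm_nonneg _)

/-- If a finite sum of functions with asymptotic expansions vanishes, the coefficients of an
expansion whose exponents differ from those of the others vanish. -/
theorem coeff_eq_zero_of_sum_eq_zero {κ : Type*} {I : Finset κ} {β : κ → ℂ} {a : κ → ℕ → ℂ}
    {g : κ → ℝ → ℂ} (hg : ∀ i ∈ I, ∀ N : ℕ, ∃ C : ℝ, ∀ x : ℝ, 1 ≤ x →
      ‖g i x - ∑ j ∈ Finset.range N, a i j * (x : ℂ) ^ (β i - j)‖ ≤ C * x ^ ((β i).re - N))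
    (hsum : ∀ x : ℝ, 1 ≤ x → ∑ i ∈ I, g i x = 0) {i₀ : κ} (hi₀ : i₀ ∈ I)
    (hne : ∀ i ∈ I, i ≠ i₀ → ∀ m : ℤ, β i - β i₀ ≠ m) (k : ℕ) : a i₀ k = 0 := by
  classical
  -- One less than the real part of the exponent to be isolated; `N` is then taken so large that
  -- every remainder decays like `x ^ ρ`.
  let ρ : ℝ := (β i₀).re - k - 1
  have hN : ∃ N : ℕ, k < N ∧ ∀ i ∈ I, (β i).re - N ≤ ρ := by
    obtain ⟨N, hN⟩ := exists_nat_ge (∑ i ∈ I, |(β i).re - ρ|)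
    refine ⟨max N (k + 1), by omega, fun i hi => ?_⟩
    have h1 := Finset.single_le_sum (f := fun i => |(β i).re - ρ|) (fun i _ => abs_nonneg _) hi
    have h2 := le_abs_self ((β i).re - ρ)
    have h3 : (N : ℝ) ≤ (max N (k + 1) : ℕ) := by exact_mod_cast le_max_left _ _
    have h4 : |(β i).re - ρ| ≤ ∑ i ∈ I, |(β i).re - ρ| := h1
    linarith
  obtain ⟨N, hkN, hN⟩ := hN
  have hC : ∃ C : κ → ℝ, ∀ i ∈ I, ∀ x : ℝ, 1 ≤ x →
      ‖g i x - ∑ j ∈ Finset.range N, a i j * (x : ℂ) ^ (β i - j)‖ ≤ C i * x ^ ((β i).re - N) := by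
    have : ∀ i, ∃ C : ℝ, i ∈ I → ∀ x : ℝ, 1 ≤ x →
        ‖g i x - ∑ j ∈ Finset.range N, a i j * (x : ℂ) ^ (β i - j)‖ ≤
          C * x ^ ((β i).re - N) := by
      intro i
      by_cases hi : i ∈ I
      · obtain ⟨C, hC⟩ := hg i hi N
        exact ⟨C, fun _ => hC⟩
      · exact ⟨0, fun h => absurd h hi⟩
    choose C hC using this
    exact ⟨C, hC⟩
  obtain ⟨C, hC⟩ := hC
  have hmem : (i₀, k) ∈ I ×ˢ Finset.range N :=
    Finset.mem_product.2 ⟨hi₀, Finset.mem_range.2 hkN⟩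
  refine eq_zero_of_sum_cpow_le (e₀ := β i₀ - k) (ρ := ρ) (C := ∑ i ∈ I, |C i|) ?_
    ((I ×ˢ Finset.range N).erase (i₀, k)) (e := fun p => β p.1 - p.2) (c := fun p => a p.1 p.2)
    (fun p hp => ?_) fun x hx => ?_
  · simp [ρ]
  · obtain ⟨hp1, hp2⟩ := Finset.mem_erase.1 hp
    -- An exponent equal to `β i₀ - k` would come from the same `i₀`, hence from `j = k`, or make `β
    -- i - β i₀` an integer.
    intro h
    by_cases hi : p.1 = i₀
    · refine hp1 (Prod.ext hi ?_)
      rw [hi] at h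
      have : (p.2 : ℂ) = k := by linear_combination -h
      exact_mod_cast this
    · refine hne p.1 (Finset.mem_product.1 hp2).1 hi (p.2 - k) ?_
      push_cast
      linear_combination h
  · have e1 : a i₀ k * (x : ℂ) ^ (β i₀ - k) + ∑ p ∈ (I ×ˢ Finset.range N).erase (i₀, k),
        a p.1 p.2 * (x : ℂ) ^ (β p.1 - p.2) =
        ∑ i ∈ I, ∑ j ∈ Finset.range N, a i j * (x : ℂ) ^ (β i - j) := by
      rw [Finset.add_sum_erase _ (fun p : κ × ℕ => a p.1 p.2 * (x : ℂ) ^ (β p.1 - p.2)) hmem,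
        Finset.sum_product]
    have e2 : ∑ i ∈ I, ∑ j ∈ Finset.range N, a i j * (x : ℂ) ^ (β i - j) =
        -∑ i ∈ I, (g i x - ∑ j ∈ Finset.range N, a i j * (x : ℂ) ^ (β i - j)) := by
      rw [Finset.sum_sub_distrib, hsum x hx]
      ring
    rw [e1, e2, norm_neg, Finset.sum_mul]
    refine (norm_sum_le _ _).trans (Finset.sum_le_sum fun i hi => (hC i hi x hx).trans ?_)
    exact mul_le_mul (le_abs_self _) (Real.rpow_le_rpow_of_exponent_le hx (hN i hi))
      (Real.rpow_nonneg (by linarith) _) (abs_nonneg _)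

end Unique

end Locality

end

noncomputable section

namespace Locality

open Filter Topology MeasureTheory Set

/-! ### Presentations of germs with independent orders -/

section Presentation

variable {Q : LinearMap.BilinForm ℝ (ℕ →₀ ℝ)} {n : ℕ} {a b : ℕ → (Fin n → ℂ) → ℂ}
  {T : (Fin n → ℂ) → NNReal → ℂ} {r : ℝ} {ℓ : Fin n → ℝ} {c : ℝ}

theorem IsIntegral.shift (h : IsIntegral r ℓ c a) (i : ℕ) :
    IsIntegral r ℓ (c + i) (fun j y => if i ≤ j then a (j - i) y else 0) := by
  refine h.imp id fun h j hj y hy => ?_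
  beta_reduce
  split_ifs with hij
  · refine h (j - i) (fun m hm => hj m ?_) y hy
    rw [← hm, Nat.cast_sub hij]
    ring
  · rfl

theorem IsIntegral.add (h : IsIntegral r ℓ c a) (h' : IsIntegral r ℓ c b) :
    IsIntegral r ℓ c (fun j y => a j y + b j y) := by
  rcases h with h | h
  · exact Or.inl h
  rcases h' with h' | h'
  · exact Or.inl h'
  exact Or.inr fun j hj y hy => by
    beta_reduce
    rw [h j hj y hy, h' j hj y hy, add_zero]

theorem IsIntegral.mul (h : IsIntegral r ℓ c a) (d : (Fin n → ℂ) → ℂ) :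
    IsIntegral r ℓ c (fun j y => d y * a j y) :=
  h.imp id fun h j hj y hy => by
    beta_reduce
    rw [h j hj y hy, mul_zero]

theorem IsIntegral.subset {r' : ℝ} (h : IsIntegral r ℓ c a) (hr : r' ≤ r) :
    IsIntegral r' ℓ c a :=
  h.imp id fun h j hj y hy => h j hj y (Metric.ball_subset_ball hr hy)

/-- The product of the linear forms in `w`. -/
def formProd (w : List (Fin n → ℝ)) (y : Fin n → ℂ) : ℂ := (w.map fun u => dot u y).prod

theorem formProd_append (w w' : List (Fin n → ℝ)) (y : Fin n → ℂ) :
    formProd (w ++ w') y = formProd w y * formProd w' y := by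
  rw [formProd, List.map_append, List.prod_append, formProd, formProd]

theorem differentiable_formProd (w : List (Fin n → ℝ)) : Differentiable ℂ (formProd w) := by
  induction w with
  | nil => exact differentiable_const 1
  | cons u w ih =>
    have : formProd (u :: w) = fun y => dot u y * formProd w y := by
      ext y
      simp [formProd]
    rw [this]
    exact (differentiable_dot u).mul ih

theorem formProd_star (w : List (Fin n → ℝ)) (y : Fin n → ℂ) :
    formProd w (star y) = star (formProd w y) := by
  induction w with
  | nil => exact (star_one ℂ).symm
  | cons u w ih =>
    have : ∀ y, formProd (u :: w) y = dot u y * formProd w y := fun y => by simp [formProd]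
    rw [this, this, ih, dot_star, star_mul']

theorem bddFun_formProd (w : List (Fin n → ℝ)) (r : ℝ) :
    BddFun (Metric.ball 0 r) (formProd w) := by
  induction w with
  | nil => exact bddFun_const 1
  | cons u w ih =>
    have : formProd (u :: w) = fun y => dot u y * formProd w y := by
      ext y
      simp [formProd]
    rw [this]
    exact (bddFun_dot u r).mul ih

theorem formProd_ne_zero {w : List (Fin n → ℝ)} {y : Fin n → ℂ} (h : ∀ u ∈ w, dot u y ≠ 0) :
    formProd w y ≠ 0 := by
  refine List.prod_ne_zero fun h0 => ?_
  obtain ⟨u, hu, h0⟩ := List.mem_map.1 h0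
  exact h u hu h0

theorem prod_linForm_emb (w : List (Fin n → ℝ)) (z : ℕ →₀ ℂ) :
    ((w.map (emb n)).map fun v => linForm Q v z).prod = formProd w (coords Q n z) := by
  rw [List.map_map, formProd]
  congr 2
  ext u
  exact linForm_emb Q u z

theorem map_emb_ne_zero {w : List (Fin n → ℝ)} (hw : ∀ u ∈ w, u ≠ 0) :
    ∀ v ∈ w.map (emb n), v ≠ 0 := by
  intro v hv
  obtain ⟨u, hu, rfl⟩ := List.mem_map.1 hv
  exact fun h => hw u hu (emb_eq_zero.1 h)

theorem Family.formProd_smul (hT : Family (Metric.ball 0 r) (affineOrder ℓ c) a T)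
    (w : List (Fin n → ℝ)) : Family (Metric.ball 0 r) (affineOrder ℓ c)
      (fun j y => formProd w y * a j y) (fun y => formProd w y • T y) :=
  hT.const_mul (differentiable_formProd w).differentiableOn (bddFun_formProd w r)
    fun y _ => formProd_star w y

theorem Family.affine_shift (hT : Family (Metric.ball 0 r) (affineOrder ℓ c) a T) (i : ℕ) :
    Family (Metric.ball 0 r) (affineOrder ℓ (c + i))
      (fun j y => if i ≤ j then a (j - i) y else 0) T :=
  (hT.shift i).congr_order fun y _ => by
    rw [affineOrder_eq, affineOrder_eq, Complex.ofReal_add, Complex.ofReal_natCast, add_assoc]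

/-- A presentation of a germ as a quotient of a sum of families by a product of linear forms,
such that the orders of distinct families do not differ by integers. -/
structure Presentation (Q : LinearMap.BilinForm ℝ (ℕ →₀ ℝ)) (n : ℕ) (σ : FunGerm Q) where
  radius : ℝ
  forms : List (Fin n → ℝ)
  level : ℕ
  keys : Finset ((Fin n → ℝ) × ℝ)
  coeff : (Fin n → ℝ) × ℝ → ℕ → (Fin n → ℂ) → ℂ
  fam : (Fin n → ℝ) × ℝ → (Fin n → ℂ) → NNReal → ℂ
  radius_pos : 0 < radius
  forms_ne_zero : ∀ u ∈ forms, u ≠ 0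
  fract : ∀ p ∈ keys, 0 ≤ p.2 ∧ p.2 < 1
  family : ∀ p, Family (Metric.ball 0 radius) (affineOrder p.1 (p.2 + level)) (coeff p) (fam p)
  integral : ∀ p, IsIntegral radius p.1 (p.2 + level) (coeff p)
  fam_eq_zero : ∀ p ∉ keys, fam p = 0
  eq : σ = quotientGerm Q (forms.map (emb n)) fun y => ∑ p ∈ keys, fam p y

theorem quotientGerm_emb (w : List (Fin n → ℝ)) (T : (Fin n → ℂ) → NNReal → ℂ) :
    quotientGerm Q (w.map (emb n)) T =
      ((fun z => (formProd w (coords Q n z))⁻¹ • T (coords Q n z) : (ℕ →₀ ℂ) → NNReal → ℂ) :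
        FunGerm Q) := by
  refine Germ.coe_eq.2 (Eventually.of_forall fun z => ?_)
  ext x
  beta_reduce
  rw [prod_linForm_emb, Pi.smul_apply, smul_eq_mul]

theorem family_fun_zero : Family (Metric.ball 0 r) (affineOrder ℓ c) (fun _ _ => 0)
    (0 : (Fin n → ℂ) → NNReal → ℂ) := family_zero

theorem nonempty_presentation_zero : Nonempty (Presentation Q n 0) :=
  ⟨{ radius := 1
     forms := []
     level := 0
     keys := ∅
     coeff := fun _ _ _ => 0
     fam := 0
     radius_pos := one_pos
     forms_ne_zero := by simp
     fract := by simp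
     family := fun _ => family_fun_zero
     integral := fun _ => Or.inr fun _ _ _ _ => rfl
     fam_eq_zero := fun _ _ => rfl
     eq := by
       refine Germ.coe_eq.2 (Eventually.of_forall fun z => ?_)
       ext x
       simp }⟩

theorem nonempty_presentation_smul {σ : FunGerm Q} (s : ℝ) (h : Nonempty (Presentation Q n σ)) :
    Nonempty (Presentation Q n (s • σ)) := by
  obtain ⟨P⟩ := h
  refine ⟨{ P with
    coeff := fun p j y => (s : ℂ) * P.coeff p j y
    fam := fun p y => (s : ℂ) • P.fam p y
    family := fun p => (P.family p).const_mul (differentiableOn_const _) (bddFun_const _)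
      fun y _ => (Complex.conj_ofReal s).symm
    integral := fun p => (P.integral p).mul _
    fam_eq_zero := fun p hp => ?_
    eq := ?_ }⟩
  · ext y x
    simp [P.fam_eq_zero p hp]
  · refine (congrArg (s • ·) P.eq).trans ?_
    refine Germ.coe_eq.2 (Eventually.of_forall fun z => ?_)
    ext x
    change s • (_ * (∑ p ∈ P.keys, P.fam p (coords Q n z)) x) =
      _ * (∑ p ∈ P.keys, (s : ℂ) • P.fam p (coords Q n z)) x
    rw [← Finset.smul_sum, Pi.smul_apply, smul_eq_mul, Complex.real_smul]
    ring

/-- The denominators are brought to a common one by multiplying each family by the denominator of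
the other germ. The levels are added, so that families with the same key acquire the same order and
can be added. -/
theorem nonempty_presentation_add {σ τ : FunGerm Q} (h : Nonempty (Presentation Q n σ))
    (h' : Nonempty (Presentation Q n τ)) : Nonempty (Presentation Q n (σ + τ)) := by
  classical
  obtain ⟨P⟩ := h
  obtain ⟨P'⟩ := h'
  have hsub : Metric.ball (0 : Fin n → ℂ) (min P.radius P'.radius) ⊆ Metric.ball 0 P.radius :=
    Metric.ball_subset_ball (min_le_left _ _)
  have hsub' : Metric.ball (0 : Fin n → ℂ) (min P.radius P'.radius) ⊆ Metric.ball 0 P'.radius :=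
    Metric.ball_subset_ball (min_le_right _ _)
  have hlev : ∀ x : ℝ, x + P.level + P'.level = x + (P.level + P'.level : ℕ) := fun x => by
    push_cast
    ring
  have hlev' : ∀ x : ℝ, x + P'.level + P.level = x + (P.level + P'.level : ℕ) := fun x => by
    push_cast
    ring
  refine ⟨{
    radius := min P.radius P'.radius
    forms := P.forms ++ P'.forms
    level := P.level + P'.level
    keys := P.keys ∪ P'.keys
    coeff := fun p j y =>
      formProd P'.forms y * (if P'.level ≤ j then P.coeff p (j - P'.level) y else 0) +
        formProd P.forms y * (if P.level ≤ j then P'.coeff p (j - P.level) y else 0)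
    fam := fun p y => formProd P'.forms y • P.fam p y + formProd P.forms y • P'.fam p y
    radius_pos := lt_min P.radius_pos P'.radius_pos
    forms_ne_zero := fun u hu => (List.mem_append.1 hu).elim (P.forms_ne_zero u)
      (P'.forms_ne_zero u)
    fract := fun p hp => (Finset.mem_union.1 hp).elim (P.fract p) (P'.fract p)
    family := fun p => ?_
    integral := fun p => ?_
    fam_eq_zero := fun p hp => ?_
    eq := ?_ }⟩
  · have h1 := (((P.family p).subset hsub).affine_shift P'.level).formProd_smul P'.forms
    have h2 := (((P'.family p).subset hsub').affine_shift P.level).formProd_smul P.forms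
    rw [hlev] at h1
    rw [hlev'] at h2
    exact h1.add h2
  · have h1 := (((P.integral p).subset (min_le_left _ P'.radius)).shift P'.level).mul
      (formProd P'.forms)
    have h2 := (((P'.integral p).subset (min_le_right P.radius _)).shift P.level).mul
      (formProd P.forms)
    rw [hlev] at h1
    rw [hlev'] at h2
    exact h1.add h2
  · rw [Finset.mem_union, not_or] at hp
    ext y x
    simp [P.fam_eq_zero p hp.1, P'.fam_eq_zero p hp.2]
  · have hs : ∀ y, ∑ p ∈ P.keys ∪ P'.keys, P.fam p y = ∑ p ∈ P.keys, P.fam p y := fun y =>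
      (Finset.sum_subset Finset.subset_union_left fun p _ hp => by rw [P.fam_eq_zero p hp]; rfl).symm
    have hs' : ∀ y, ∑ p ∈ P.keys ∪ P'.keys, P'.fam p y = ∑ p ∈ P'.keys, P'.fam p y := fun y =>
      (Finset.sum_subset Finset.subset_union_right
        fun p _ hp => by rw [P'.fam_eq_zero p hp]; rfl).symm
    refine (congrArg₂ (· + ·) P.eq P'.eq).trans ?_
    rw [quotientGerm_emb, quotientGerm_emb, quotientGerm_emb]
    refine Germ.coe_eq.2 ?_
    filter_upwards [eventually_forall_dot_ne_zero (Q := Q) P.forms_ne_zero,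
      eventually_forall_dot_ne_zero (Q := Q) P'.forms_ne_zero] with z hz hz'
    have h1 := formProd_ne_zero hz
    have h2 := formProd_ne_zero hz'
    simp only [Finset.sum_add_distrib, ← Finset.smul_sum, hs, hs', formProd_append, smul_add,
      smul_smul]
    congr 2
    · field_simp
    · field_simp

theorem exists_emb_eq_of_list (w : List (ℕ →₀ ℝ)) :
    ∃ n₀, ∀ n ≥ n₀, ∃ w' : List (Fin n → ℝ), w'.map (emb n) = w := by
  induction w with
  | nil => exact ⟨0, fun n _ => ⟨[], rfl⟩⟩
  | cons v w ih =>
    obtain ⟨n₁, h₁⟩ := ih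
    obtain ⟨n₂, h₂⟩ := exists_emb_eq v
    refine ⟨max n₁ n₂, fun n hn => ?_⟩
    obtain ⟨w', hw'⟩ := h₁ n (le_trans (le_max_left _ _) hn)
    obtain ⟨u, hu⟩ := h₂ n (le_trans (le_max_right _ _) hn)
    exact ⟨u :: w', by rw [List.map_cons, hu, hw']⟩

theorem differentiable_restr {m : ℕ} (h : n ≤ m) : Differentiable ℂ (restr h) :=
  differentiable_pi.2 fun _ => differentiable_apply _

/-- Families of `n` parameters as families of `m ≥ n` parameters. -/
theorem Family.restr {m : ℕ} (hT : Family (Metric.ball 0 r) (affineOrder ℓ c) a T) (h : n ≤ m)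
    {ℓ' : Fin m → ℝ} (hℓ : ∀ y, dot ℓ' y = dot ℓ (Locality.restr h y)) :
    Family (Metric.ball 0 r) (affineOrder ℓ' c) (fun j y => a j (Locality.restr h y))
      (fun y => T (Locality.restr h y)) :=
  (hT.comp (differentiable_restr h).differentiableOn (fun _ hy => restr_mem_ball h hy)
    fun _ _ => rfl).congr_order fun y _ => by rw [affineOrder_eq, affineOrder_eq, hℓ]

theorem exists_extension (hpos : ∀ v, v ≠ 0 → 0 < Q v v) (ℓ : Fin n → ℝ) :
    ∃ n₀, ∀ m ≥ n₀, ∃ (h : n ≤ m) (ℓ' : Fin m → ℝ), emb m ℓ' = emb n ℓ ∧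
      ∀ y, dot ℓ' y = dot ℓ (restr h y) := by
  obtain ⟨n₀, hn₀⟩ := exists_emb_eq (emb n ℓ)
  refine ⟨max n₀ n, fun m hm => ?_⟩
  obtain ⟨ℓ', hℓ'⟩ := hn₀ m (le_trans (le_max_left _ _) hm)
  have h : n ≤ m := le_trans (le_max_right _ _) hm
  refine ⟨h, ℓ', hℓ', fun y => ?_⟩
  obtain ⟨z, rfl⟩ := coords_surjective hpos m y
  rw [restr_coords, ← linForm_emb, ← linForm_emb, hℓ']

theorem IsIntegral.restr {m : ℕ} (hint : IsIntegral r ℓ c a) (h : n ≤ m) {ℓ' : Fin m → ℝ}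
    (hℓ : emb m ℓ' = emb n ℓ) : IsIntegral r ℓ' c (fun j y => a j (Locality.restr h y)) := by
  refine hint.imp (fun h0 h1 => h0 ?_) fun h0 j hj y hy => h0 j hj _ (restr_mem_ball h hy)
  rw [h1, map_zero] at hℓ
  exact emb_eq_zero.1 hℓ.symm

theorem exists_presentation (hpos : ∀ v, v ≠ 0 → 0 < Q v v) {σ : FunGerm Q}
    (hσ : σ ∈ symbolGerms Q) : ∃ n₀, ∀ n ≥ n₀, Nonempty (Presentation Q n σ) := by
  classical
  induction hσ using Submodule.span_induction with
  | zero => exact ⟨0, fun n _ => nonempty_presentation_zero⟩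
  | add σ τ _ _ hσ hτ =>
    obtain ⟨n₁, h₁⟩ := hσ
    obtain ⟨n₂, h₂⟩ := hτ
    exact ⟨max n₁ n₂, fun n hn => nonempty_presentation_add
      (h₁ n (le_trans (le_max_left _ _) hn)) (h₂ n (le_trans (le_max_right _ _) hn))⟩
  | smul s σ _ hσ =>
    obtain ⟨n₁, h₁⟩ := hσ
    exact ⟨n₁, fun n hn => nonempty_presentation_smul s (h₁ n hn)⟩
  | mem σ h =>
    obtain ⟨n, r, ℓ, c, a, T, w, hr, hT, hw, hint, rfl⟩ := h
    obtain ⟨n₁, h₁⟩ := exists_extension hpos ℓ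
    obtain ⟨n₂, h₂⟩ := exists_emb_eq_of_list w
    refine ⟨max n₁ n₂, fun m hm => ?_⟩
    obtain ⟨hnm, ℓ', hℓ', hdot⟩ := h₁ m (le_trans (le_max_left _ _) hm)
    obtain ⟨w', rfl⟩ := h₂ m (le_trans (le_max_right _ _) hm)
    have hF := hT.family.restr hnm hdot
    have hI := IsIntegral.restr hint hnm hℓ'
    -- The order constant is normalised to a number in `[0, 1)` plus a natural level. A negative
    -- integer part is raised to `0` by prepending `i` zero coefficients.
    let K : ℕ := ⌊c⌋.toNat
    let i : ℕ := (K - ⌊c⌋).toNat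
    have hc : c + i = Int.fract c + K := by
      have h1 : (i : ℤ) = K - ⌊c⌋ := Int.toNat_of_nonneg (sub_nonneg.2 (Int.self_le_toNat _))
      have h2 : (i : ℝ) = K - ⌊c⌋ := by exact_mod_cast congrArg (fun x : ℤ => (x : ℝ)) h1
      rw [h2, Int.fract]
      ring
    have hF' := hF.affine_shift i
    have hI' := hI.shift i
    rw [hc] at hF' hI'
    refine ⟨{
      radius := r
      forms := w'
      level := K
      keys := {(ℓ', Int.fract c)}
      coeff := fun p => if p = (ℓ', Int.fract c) then
        (fun j y => if i ≤ j then a (j - i) (restr hnm y) else 0) else fun _ _ => 0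
      fam := fun p => if p = (ℓ', Int.fract c) then (fun y => T (restr hnm y)) else 0
      radius_pos := hr
      forms_ne_zero := fun u hu h0 => hw _ (List.mem_map_of_mem hu) (by rw [h0, map_zero])
      fract := fun p hp => by
        rw [Finset.mem_singleton.1 hp]
        exact ⟨Int.fract_nonneg c, Int.fract_lt_one c⟩
      family := fun p => ?_
      integral := fun p => ?_
      fam_eq_zero := fun p hp => if_neg (mt Finset.mem_singleton.2 hp)
      eq := ?_ }⟩
    · split_ifs with hp
      · subst hp
        exact hF'
      · exact family_fun_zero
    · split_ifs with hp
      · subst hp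
        exact hI'
      · exact Or.inr fun _ _ _ _ => rfl
    · simp only [Finset.sum_singleton, if_true]
      rfl

end Presentation

end Locality

end

noncomputable section

namespace Locality

open Filter Topology MeasureTheory Set

/-! ### Orders of germs that depend on few linear forms -/

section Vanishing

variable {Q : LinearMap.BilinForm ℝ (ℕ →₀ ℝ)} {n m : ℕ} {σ : FunGerm Q}
  {V : Submodule ℝ (ℕ →₀ ℝ)}

theorem continuous_path (y x : Fin m → ℂ) :
    Continuous fun t : ℝ => y + ((t : ℂ) * Complex.I) • x := by fun_prop

theorem tendsto_path (y x : Fin m → ℂ) :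
    Tendsto (fun t : ℝ => y + ((t : ℂ) * Complex.I) • x) (𝓝[≠] 0) (𝓝 y) := by
  have h := ((continuous_path y x).tendsto 0).mono_left (nhdsWithin_le_nhds (s := {0}ᶜ))
  simpa using h

/-- The parameter moves in a purely imaginary direction because integers are real: exponents with
different imaginary parts never differ by an integer. -/
theorem eq_zero_of_eventually_path {f : (Fin m → ℂ) → ℂ} {y : Fin m → ℂ} (hf : ContinuousAt f y)
    (x : Fin m → ℂ) (h : ∀ᶠ t : ℝ in 𝓝[≠] 0, f (y + ((t : ℂ) * Complex.I) • x) = 0) : f y = 0 :=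
  tendsto_nhds_unique (hf.tendsto.comp (tendsto_path y x))
    (tendsto_const_nhds.congr' (h.mono fun _ ht => ht.symm))

theorem dot_path (u : Fin m → ℝ) (y : Fin m → ℂ) (x : Fin m → ℝ) (t : ℝ) :
    dot u (y + ((t : ℂ) * Complex.I) • cvec x) = dot u y + t * (Complex.I * dot u (cvec x)) := by
  rw [dot_add_right, dot_smul_right, mul_assoc]

theorem im_dot_path (u : Fin m → ℝ) (y : Fin m → ℂ) (x : Fin m → ℝ) (t : ℝ) :
    (dot u (y + ((t : ℂ) * Complex.I) • cvec x)).im = (dot u y).im + t * (u ⬝ᵥ x) := by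
  rw [dot_path, dot_cvec, Complex.add_im]
  simp [Complex.mul_im]

theorem eventually_forall_mem_list {X ι : Type*} {l : Filter X} (L : List ι) {p : ι → X → Prop}
    (h : ∀ i ∈ L, ∀ᶠ x in l, p i x) : ∀ᶠ x in l, ∀ i ∈ L, p i x := by
  induction L with
  | nil => simp
  | cons a L ih =>
    filter_upwards [h a (by simp), ih fun i hi => h i (List.mem_cons_of_mem _ hi)] with x h1 h2 i hi
    rcases List.mem_cons.1 hi with rfl | hi
    exacts [h1, h2 i hi]

theorem continuous_restr (h : n ≤ m) : Continuous (restr h) :=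
  (differentiable_restr h).continuous

theorem exists_restr_eq (h : n ≤ m) {y : Fin n → ℂ} {r : ℝ} (hr : 0 < r)
    (hy : y ∈ Metric.ball 0 r) : ∃ y' ∈ Metric.ball (0 : Fin m → ℂ) r, restr h y' = y := by
  refine ⟨fun i => if hi : (i : ℕ) < n then y ⟨i, hi⟩ else 0, ?_, ?_⟩
  · rw [mem_ball_zero_iff] at *
    rw [pi_norm_lt_iff hr] at *
    intro i
    by_cases hi : (i : ℕ) < n
    · simpa [hi] using hy ⟨i, hi⟩
    · simpa [hi] using hr
  · ext i
    simp [restr]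

theorem continuousAt_comp_restr {f : (Fin n → ℂ) → ℂ} {r : ℝ}
    (hf : DifferentiableOn ℂ f (Metric.ball 0 r)) (h : n ≤ m) {y : Fin m → ℂ}
    (hy : y ∈ Metric.ball 0 r) : ContinuousAt (fun y => f (restr h y)) y :=
  ((hf.continuousOn.continuousAt (Metric.isOpen_ball.mem_nhds (restr_mem_ball h hy)))).comp
    (f := restr h) (continuous_restr h).continuousAt

/-- Data of a presentation, of a function representing it that depends on few linear forms, and of
coordinates in which they are compared. -/
structure Comparison (P : Presentation Q n σ) (V : Submodule ℝ (ℕ →₀ ℝ)) (m : ℕ) where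
  le : n ≤ m
  radius : ℝ
  radius_pos : 0 < radius
  radius_le : radius ≤ P.radius
  forms : List (Fin m → ℝ)
  forms_ne_zero : ∀ u ∈ forms, u ≠ 0
  lift : (Fin n → ℝ) → Fin m → ℝ
  emb_lift : ∀ u, emb m (lift u) = emb n u
  dot_lift : ∀ u y, dot (lift u) y = dot u (restr le y)
  eq : ∀ y y' : Fin m → ℂ, y ∈ Metric.ball 0 radius → y' ∈ Metric.ball 0 radius →
    (∀ u ∈ forms, dot u y ≠ 0) → (∀ u ∈ forms, dot u y' ≠ 0) →
    (∀ v : Fin m → ℝ, emb m v ∈ V → dot v y = dot v y') →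
    (formProd P.forms (restr le y))⁻¹ • ∑ p ∈ P.keys, P.fam p (restr le y) =
      (formProd P.forms (restr le y'))⁻¹ • ∑ p ∈ P.keys, P.fam p (restr le y')

theorem exists_comparison (hpos : ∀ v, v ≠ 0 → 0 < Q v v) (P : Presentation Q n σ)
    (hV : FiniteDimensional ℝ V) (hσ : DependsOn Q σ V) : ∃ m, Nonempty (Comparison P V m) := by
  obtain ⟨s, hs, hsV⟩ := hσ
  have h1 : ∀ᶠ z in genericNhds Q, s z =
      (formProd P.forms (coords Q n z))⁻¹ • ∑ p ∈ P.keys, P.fam p (coords Q n z) := by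
    have h2 := hs.symm.trans P.eq
    rw [quotientGerm_emb] at h2
    exact Germ.coe_eq.1 h2
  obtain ⟨n₁, h₁⟩ := exists_of_eventually h1
  obtain ⟨n₂, h₂⟩ := exists_le_range_emb (LinearMap.range (emb n)) inferInstance
  obtain ⟨n₃, h₃⟩ := exists_le_range_emb V hV
  let m := max n (max n₁ (max n₂ n₃))
  have hnm : n ≤ m := le_max_left _ _
  obtain ⟨r, hr, L, hL, hgood⟩ := h₁ m (by omega)
  have hX : ∀ u : Fin n → ℝ, ∃ u' : Fin m → ℝ, emb m u' = emb n u := fun u =>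
    h₂ m (by omega) (LinearMap.mem_range_self _ u)
  choose X hX using hX
  refine ⟨m, ⟨⟨hnm, min r P.radius, lt_min hr P.radius_pos, min_le_right _ _, L, hL, X, hX,
    fun u y => ?_, fun y y' hy hy' hu hu' hyy' => ?_⟩⟩⟩
  · obtain ⟨z, rfl⟩ := coords_surjective hpos m y
    rw [restr_coords, ← linForm_emb, ← linForm_emb, hX]
  · obtain ⟨z, rfl⟩ := coords_surjective hpos m y
    obtain ⟨z', rfl⟩ := coords_surjective hpos m y'
    have e := hgood z (Metric.ball_subset_ball (min_le_left _ _) hy) hu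
    have e' := hgood z' (Metric.ball_subset_ball (min_le_left _ _) hy') hu'
    rw [restr_coords, restr_coords, ← e, ← e']
    refine hsV z z' fun v hv => ?_
    obtain ⟨u, rfl⟩ := h₃ m (by omega) hv
    rw [linForm_emb, linForm_emb]
    exact hyy' u hv

variable {P : Presentation Q n σ}

/-- Let `y' = y + i t x` with `x` orthogonal to `V` but not to the linear part of the order of `p₀`.
The germ takes the same value at `y` and `y'`, which gives a vanishing sum of expansions. For small
`t ≠ 0` the exponents of `p₀` at `y'` are isolated: those of other linear parts, and its own at `y`,
differ in imaginary part, while keys with the same linear part at `y'` have different fractional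
parts. So the coefficient vanishes at `y'`, and at `y` by continuity. -/
theorem Comparison.coeff_eq_zero_of_generic (C : Comparison P V m) {p₀ : (Fin n → ℝ) × ℝ}
    (hp₀ : p₀ ∈ P.keys) (hp₀V : emb n p₀.1 ∉ V) {y : Fin m → ℂ} (hy : y ∈ Metric.ball 0 C.radius)
    (hforms : ∀ u ∈ C.forms, dot u y ≠ 0) (hforms' : ∀ u ∈ P.forms, dot u (restr C.le y) ≠ 0)
    (him : ∀ p ∈ P.keys, p.1 ≠ p₀.1 → (dot (C.lift p.1) y).im ≠ (dot (C.lift p₀.1) y).im) (k : ℕ) :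
    P.coeff p₀ k (restr C.le y) = 0 := by
  classical
  obtain ⟨x, hxV, hx⟩ := exists_orthogonal_generic (V.comap (emb m)) [C.lift p₀.1]
  have hx0 : C.lift p₀.1 ⬝ᵥ x ≠ 0 := by
    have := hx (C.lift p₀.1) (by simp) (by rwa [Submodule.mem_comap, C.emb_lift])
    rw [dot_cvec] at this
    exact_mod_cast this
  have hball : ∀ {y : Fin m → ℂ}, y ∈ Metric.ball 0 C.radius →
      restr C.le y ∈ Metric.ball 0 P.radius := fun hy =>
    restr_mem_ball C.le (Metric.ball_subset_ball C.radius_le hy)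
  refine eq_zero_of_eventually_path (f := fun y => P.coeff p₀ k (restr C.le y))
    (continuousAt_comp_restr ((P.family p₀).holomorphic_coeff k) C.le
      (Metric.ball_subset_ball C.radius_le hy)) (cvec x) ?_
  have hpath := tendsto_path y (cvec x)
  have hdot : ∀ u : Fin m → ℝ, Tendsto
      (fun t : ℝ => dot u (y + ((t : ℂ) * Complex.I) • cvec x)) (𝓝[≠] 0) (𝓝 (dot u y)) := fun u =>
    ((continuous_dot u).tendsto y).comp hpath
  have hdotim : ∀ u : Fin m → ℝ, Tendsto
      (fun t : ℝ => (dot u (y + ((t : ℂ) * Complex.I) • cvec x)).im) (𝓝[≠] 0)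
        (𝓝 (dot u y).im) := fun u => (Complex.continuous_im.tendsto _).comp (hdot u)
  have ev1 := hpath.eventually (Metric.isOpen_ball.mem_nhds hy)
  have ev2 : ∀ᶠ t : ℝ in 𝓝[≠] 0, ∀ u ∈ C.forms, dot u (y + ((t : ℂ) * Complex.I) • cvec x) ≠ 0 :=
    eventually_forall_mem_list _ fun u hu => (hdot u).eventually_ne (hforms u hu)
  have ev3 : ∀ᶠ t : ℝ in 𝓝[≠] 0, ∀ u ∈ P.forms,
      dot u (restr C.le (y + ((t : ℂ) * Complex.I) • cvec x)) ≠ 0 :=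
    eventually_forall_mem_list _ fun u hu => by
      have := (hdot (C.lift u)).eventually_ne (by rw [C.dot_lift]; exact hforms' u hu)
      simpa only [C.dot_lift] using this
  -- The exponent of `p₀` at the moved point has to be compared with those of the other keys at the
  -- moved point, and in `ev5` with those at the original point.
  have ev4 : ∀ᶠ t : ℝ in 𝓝[≠] 0, ∀ p ∈ P.keys, p.1 ≠ p₀.1 →
      (dot (C.lift p.1) (y + ((t : ℂ) * Complex.I) • cvec x)).im -
        (dot (C.lift p₀.1) (y + ((t : ℂ) * Complex.I) • cvec x)).im ≠ 0 :=
    (eventually_all_finset _).2 fun p hp => by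
      by_cases h : p.1 = p₀.1
      · exact Eventually.of_forall fun t h' => absurd h h'
      · exact (((hdotim _).sub (hdotim _)).eventually_ne (sub_ne_zero.2 (him p hp h))).mono
          fun t ht _ => ht
  have ev5 : ∀ᶠ t : ℝ in 𝓝[≠] 0, ∀ p ∈ P.keys, p.1 ≠ p₀.1 →
      (dot (C.lift p.1) y).im -
        (dot (C.lift p₀.1) (y + ((t : ℂ) * Complex.I) • cvec x)).im ≠ 0 :=
    (eventually_all_finset _).2 fun p hp => by
      by_cases h : p.1 = p₀.1
      · exact Eventually.of_forall fun t h' => absurd h h'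
      · exact ((tendsto_const_nhds.sub (hdotim _)).eventually_ne
          (sub_ne_zero.2 (him p hp h))).mono fun t ht _ => ht
  filter_upwards [ev1, ev2, ev3, ev4, ev5, self_mem_nhdsWithin] with t ht1 ht2 ht3 ht4 ht5 ht6
  have ht0 : t ≠ 0 := ht6
  set y' := y + ((t : ℂ) * Complex.I) • cvec x with hy'
  -- The index `true` stands for the moved point and `false` for the original one. `ε` contains the
  -- inverse denominator and the sign, so that the sum over all indices is the difference of two
  -- equal values of the germ.
  let φ : Bool → Fin m → ℂ := fun b => if b then y' else y
  let ε : Bool → ℂ := fun b =>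
    (if b then 1 else -1) * (formProd P.forms (restr C.le (φ b)))⁻¹
  have hφ : ∀ b, φ b ∈ Metric.ball 0 C.radius := fun b => by
    cases b
    · exact hy
    · exact ht1
  have heq := C.eq y y' hy ht1 hforms ht2 fun v hv => by
    rw [hy', dot_path, hxV v hv, mul_zero, mul_zero, add_zero]
  have key := coeff_eq_zero_of_sum_eq_zero (I := Finset.univ ×ˢ P.keys) (i₀ := (true, p₀))
    (β := fun i : Bool × (Fin n → ℝ) × ℝ =>
      affineOrder i.2.1 (i.2.2 + P.level) (restr C.le (φ i.1)))
    (a := fun i j => ε i.1 * P.coeff i.2 j (restr C.le (φ i.1)))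
    (g := fun i x => ε i.1 * ext (P.fam i.2 (restr C.le (φ i.1))) x) ?_ ?_
    (Finset.mem_product.2 ⟨Finset.mem_univ _, hp₀⟩) ?_ k
  · have hε : ε true ≠ 0 :=
      mul_ne_zero (by simp) (inv_ne_zero (formProd_ne_zero ht3))
    exact (mul_eq_zero.1 key).resolve_left hε
  · intro i hi N
    obtain ⟨D, hD⟩ := ((P.family i.2).expands N).2 0
    refine ⟨‖ε i.1‖ * D, fun s hs => ?_⟩
    have h1 := hD _ (hball (hφ i.1)) s hs
    simp only [iteratedDeriv_zero, Nat.cast_zero, sub_zero] at h1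
    simp only [mul_assoc, ← Finset.mul_sum, ← mul_sub, norm_mul]
    exact mul_le_mul_of_nonneg_left h1 (norm_nonneg _)
  · intro s hs
    have h1 := congrFun heq s.toNNReal
    simp only [Pi.smul_apply, Finset.sum_apply, smul_eq_mul] at h1
    rw [Finset.sum_product, Fintype.sum_bool]
    simp only [← Finset.mul_sum, ε, φ, ext, if_true, Bool.false_eq_true, if_false]
    linear_combination -h1
  · rintro ⟨b, p⟩ hi hne l hl
    have hp := (Finset.mem_product.1 hi).2
    simp only [affineOrder_eq, ← C.dot_lift] at hl
    have him' := congrArg Complex.im hl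
    simp only [Complex.sub_im, Complex.add_im, Complex.ofReal_im, Complex.intCast_im,
      add_zero] at him'
    by_cases hpp : p.1 = p₀.1
    · cases b
      · rw [hpp] at him'
        simp only [φ, Bool.false_eq_true, if_false, if_true] at him'
        rw [hy', im_dot_path] at him'
        have : t * (C.lift p₀.1 ⬝ᵥ x) = 0 := by linarith
        exact mul_ne_zero ht0 hx0 this
      · rw [hpp] at hl
        have h1 : ((p.2 - p₀.2 : ℝ) : ℂ) = ((l : ℝ) : ℂ) := by
          push_cast at hl ⊢
          linear_combination hl
        have h2 : p.2 - p₀.2 = l := by exact_mod_cast h1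
        -- Same point and same linear part: the constants lie in `[0, 1)`, so an integral difference
        -- is `0` and the keys coincide.
        obtain ⟨h3, h4⟩ := P.fract p hp
        obtain ⟨h5, h6⟩ := P.fract p₀ hp₀
        have h7 : (-1 : ℝ) < l := by linarith
        have h8 : (l : ℝ) < 1 := by linarith
        have h9 : -1 < l := by exact_mod_cast h7
        have h10 : l < 1 := by exact_mod_cast h8
        have h11 : l = 0 := by omega
        rw [h11, Int.cast_zero, sub_eq_zero] at h2
        exact hne (Prod.ext rfl (Prod.ext hpp h2))
    · cases b
      · exact ht5 p hp hpp him'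
      · exact ht4 p hp hpp him'

/-- The families whose orders are not among the linear forms on which the germ depends have
vanishing expansions. -/
theorem Comparison.coeff_eq_zero (C : Comparison P V m) {p₀ : (Fin n → ℝ) × ℝ} (hp₀ : p₀ ∈ P.keys)
    (hp₀V : emb n p₀.1 ∉ V) (k : ℕ) {y : Fin n → ℂ} (hy : y ∈ Metric.ball 0 C.radius) :
    P.coeff p₀ k y = 0 := by
  classical
  obtain ⟨y, hy', rfl⟩ := exists_restr_eq C.le C.radius_pos hy
  -- A direction generic for both lists of forms and for the differences of the orders. Moving along
  -- it reaches points where the preceding lemma applies, and continuity does the rest.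
  obtain ⟨x, -, hx⟩ := exists_orthogonal_generic (⊥ : Submodule ℝ (Fin m → ℝ))
    (C.forms ++ P.forms.map C.lift ++ P.keys.toList.map fun p => C.lift p.1 - C.lift p₀.1)
  have hlift : ∀ {u}, C.lift u = 0 → u = 0 := fun {u} hu => by
    have := C.emb_lift u
    rw [hu, map_zero] at this
    exact emb_eq_zero.1 this.symm
  have hx1 : ∀ u ∈ C.forms, dot u (cvec x) ≠ 0 := fun u hu => hx u (by simp [hu])
    (by simpa using C.forms_ne_zero u hu)
  have hx2 : ∀ u ∈ P.forms, dot (C.lift u) (cvec x) ≠ 0 := fun u hu => hx _ (by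
      simp only [List.mem_append, List.mem_map]
      exact Or.inl (Or.inr ⟨u, hu, rfl⟩)) fun h => P.forms_ne_zero u hu (hlift (by simpa using h))
  have hx3 : ∀ p ∈ P.keys, p.1 ≠ p₀.1 → (C.lift p.1 - C.lift p₀.1) ⬝ᵥ x ≠ 0 := fun p hp hne => by
    have h1 := hx (C.lift p.1 - C.lift p₀.1) (by
      simp only [List.mem_append, List.mem_map, Finset.mem_toList]
      exact Or.inr ⟨p, hp, rfl⟩) fun h => hne ?_
    · rw [dot_cvec] at h1
      exact_mod_cast h1
    · have h2 : C.lift p.1 = C.lift p₀.1 := sub_eq_zero.1 (by simpa using h)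
      refine emb_injective n ?_
      rw [← C.emb_lift, ← C.emb_lift, h2]
  refine eq_zero_of_eventually_path (f := fun y => P.coeff p₀ k (restr C.le y))
    (continuousAt_comp_restr ((P.family p₀).holomorphic_coeff k) C.le
      (Metric.ball_subset_ball C.radius_le hy')) (cvec x) ?_
  have ev1 := (tendsto_path y (cvec x)).eventually (Metric.isOpen_ball.mem_nhds hy')
  have hdot : ∀ u : Fin m → ℝ, dot u (cvec x) ≠ 0 →
      ∀ᶠ t : ℝ in 𝓝[≠] 0, dot u (y + ((t : ℂ) * Complex.I) • cvec x) ≠ 0 := fun u hu => by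
    simp only [dot_path]
    exact eventually_affine_ne_zero _ _ (mul_ne_zero Complex.I_ne_zero hu)
  have ev2 := eventually_forall_mem_list C.forms fun u hu => hdot u (hx1 u hu)
  have ev3 := eventually_forall_mem_list P.forms fun u hu => hdot (C.lift u) (hx2 u hu)
  have ev4 : ∀ᶠ t : ℝ in 𝓝[≠] 0, ∀ p ∈ P.keys, p.1 ≠ p₀.1 →
      (dot (C.lift p.1) (y + ((t : ℂ) * Complex.I) • cvec x)).im ≠
        (dot (C.lift p₀.1) (y + ((t : ℂ) * Complex.I) • cvec x)).im :=
    (eventually_all_finset _).2 fun p hp => by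
      by_cases h : p.1 = p₀.1
      · exact Eventually.of_forall fun t h' => absurd h h'
      · have h1 := eventually_affine_ne_zero
          (((dot (C.lift p.1) y).im - (dot (C.lift p₀.1) y).im : ℝ) : ℂ)
          (((C.lift p.1 - C.lift p₀.1) ⬝ᵥ x : ℝ) : ℂ) (by exact_mod_cast hx3 p hp h)
        refine h1.mono fun t ht _ h2 => ht ?_
        rw [im_dot_path, im_dot_path] at h2
        have : (dot (C.lift p.1) y).im - (dot (C.lift p₀.1) y).im +
            t * ((C.lift p.1 - C.lift p₀.1) ⬝ᵥ x) = 0 := by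
          rw [sub_dotProduct]
          linear_combination h2
        exact_mod_cast this
  filter_upwards [ev1, ev2, ev3, ev4] with t ht1 ht2 ht3 ht4
  exact C.coeff_eq_zero_of_generic hp₀ hp₀V ht1 ht2
    (fun u hu => by rw [← C.dot_lift]; exact ht3 u hu) ht4 k

end Vanishing

end Locality

end

noncomputable section

namespace Locality

open Filter Topology MeasureTheory Set

/-! ### Products of independent germs -/

section Product

variable {Q : LinearMap.BilinForm ℝ (ℕ →₀ ℝ)} {n : ℕ} {a : ℕ → (Fin n → ℂ) → ℂ}
  {T : (Fin n → ℂ) → NNReal → ℂ} {r : ℝ} {ℓ : Fin n → ℝ} {c : ℝ}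
  {V V₁ V₂ : Submodule ℝ (ℕ →₀ ℝ)} {σ τ : FunGerm Q}

/-- Rapidly decreasing families may be considered as families of order `0`. -/
theorem Family.of_coeff_eq_zero {B : Set (Fin n → ℂ)} {α α' : (Fin n → ℂ) → ℂ}
    (hT : Family B α a T) (hα : BddFun B α) (hα' : BddFun B α') (h0 : ∀ j, ∀ y ∈ B, a j y = 0) :
    Family B α' (fun _ _ => 0) T where
  holomorphic := hT.holomorphic
  holomorphic_coeff _ := differentiableOn_const 0
  real := hT.real
  smooth := hT.smooth
  bound := hT.bound
  expands N := by
    obtain ⟨A, hA⟩ := hα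
    obtain ⟨A', hA'⟩ := hα'
    obtain ⟨M, hM⟩ := exists_nat_ge (A + A' + N)
    refine ((hT.expands M).mono fun y hy => ?_).congr fun y hy x _ => ?_
    · have h1 := (Complex.re_le_norm _).trans (hA y hy)
      have h2 := (abs_le.1 ((Complex.abs_re_le_norm _).trans (hA' y hy))).1
      linarith
    · simp [h0 _ y hy]

/-- The span of the quotients of families with order in `V`. -/
def spanIn (Q : LinearMap.BilinForm ℝ (ℕ →₀ ℝ)) (V : Submodule ℝ (ℕ →₀ ℝ)) :
    Submodule ℝ (FunGerm Q) :=
  Submodule.span ℝ {σ | ∃ (n : ℕ) (r : ℝ) (ℓ : Fin n → ℝ) (c : ℝ) (a : ℕ → (Fin n → ℂ) → ℂ)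
    (T : (Fin n → ℂ) → NNReal → ℂ) (w : List (ℕ →₀ ℝ)), 0 < r ∧
      Family (Metric.ball 0 r) (affineOrder ℓ c) a T ∧ IsIntegral r ℓ c a ∧ (∀ v ∈ w, v ≠ 0) ∧
      emb n ℓ ∈ V ∧ σ = quotientGerm Q w T}

theorem quotientGerm_sum {κ : Type*} (w : List (ℕ →₀ ℝ)) (S : Finset κ)
    (T : κ → (Fin n → ℂ) → NNReal → ℂ) :
    quotientGerm Q w (fun y => ∑ p ∈ S, T p y) = ∑ p ∈ S, quotientGerm Q w (T p) := by
  classical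
  induction S using Finset.induction_on with
  | empty =>
    refine Germ.coe_eq.2 (Eventually.of_forall fun z => ?_)
    ext x
    simp
  | insert p S hp ih =>
    rw [Finset.sum_insert hp, ← ih]
    refine Germ.coe_eq.2 (Eventually.of_forall fun z => ?_)
    ext x
    simp [Finset.sum_insert hp, mul_add]

/-- A germ of symbols that depends only on the linear forms in `V` is a combination of quotients of
families with order in `V`. -/
theorem mem_spanIn (hpos : ∀ v, v ≠ 0 → 0 < Q v v) (hσ : σ ∈ symbolGerms Q)
    (hV : FiniteDimensional ℝ V) (h : DependsOn Q σ V) : σ ∈ spanIn Q V := by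
  obtain ⟨n, hn⟩ := exists_presentation hpos hσ
  obtain ⟨P⟩ := hn n le_rfl
  obtain ⟨m, ⟨C⟩⟩ := exists_comparison hpos P hV h
  rw [P.eq, quotientGerm_sum]
  refine Submodule.sum_mem _ fun p hp => Submodule.subset_span ?_
  have hw := map_emb_ne_zero P.forms_ne_zero
  by_cases hpV : emb n p.1 ∈ V
  · exact ⟨n, P.radius, p.1, _, P.coeff p, P.fam p, _, P.radius_pos, P.family p, P.integral p, hw,
      hpV, rfl⟩
  -- A family with order outside `V` has zero expansion on the smaller ball, hence decreases
  -- rapidly. It is reinterpreted as a family of order `0`, whose linear part lies in `V`.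
  · refine ⟨n, C.radius, 0, 0, fun _ _ => 0, P.fam p, _, C.radius_pos, ?_,
      Or.inr fun _ _ _ _ => rfl, hw, by rw [map_zero]; exact V.zero_mem, rfl⟩
    exact ((P.family p).subset (Metric.ball_subset_ball C.radius_le)).of_coeff_eq_zero
      (bddFun_affineOrder _ _ _) (bddFun_affineOrder _ _ _)
      fun j y hy => C.coeff_eq_zero hp hpV j hy

/-- This is where independence matters. Two nonconstant orders could add up to a constant one with
arbitrary exponents, and `hℓ` rules this out. If both orders are constant, natural exponents add up
to natural exponents. -/
theorem IsIntegral.antidiagonal {b : ℕ → (Fin n → ℂ) → ℂ} {ℓ' : Fin n → ℝ} {c' : ℝ}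
    (h : IsIntegral r ℓ c a) (h' : IsIntegral r ℓ' c' b) (hℓ : ℓ + ℓ' = 0 → ℓ = 0 ∧ ℓ' = 0) :
    IsIntegral r (ℓ + ℓ') (c + c')
      (fun j y => ∑ p ∈ Finset.HasAntidiagonal.antidiagonal j, a p.1 y * b p.2 y) := by
  by_cases h0 : ℓ + ℓ' = 0
  · obtain ⟨h1, h2⟩ := hℓ h0
    have h3 := h.resolve_left (not_not.2 h1)
    have h4 := h'.resolve_left (not_not.2 h2)
    refine Or.inr fun j hj y hy => Finset.sum_eq_zero fun p hp => ?_
    have hpj : p.1 + p.2 = j := Finset.HasAntidiagonal.mem_antidiagonal.1 hp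
    by_cases h5 : ∃ m : ℕ, c - p.1 = m
    · by_cases h6 : ∃ m : ℕ, c' - p.2 = m
      · obtain ⟨m, hm⟩ := h5
        obtain ⟨m', hm'⟩ := h6
        refine absurd ?_ (hj (m + m'))
        rw [← hpj]
        push_cast
        linarith
      · push Not at h6
        rw [h4 p.2 h6 y hy, mul_zero]
    · push Not at h5
      rw [h3 p.1 h5 y hy, zero_mul]
  · exact Or.inl h0

theorem quotientGerm_mul_mem {n' : ℕ} {a' : ℕ → (Fin n' → ℂ) → ℂ} {T' : (Fin n' → ℂ) → NNReal → ℂ}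
    {r' : ℝ} {ℓ' : Fin n' → ℝ} {c' : ℝ} {w w' : List (ℕ →₀ ℝ)}
    (hpos : ∀ v, v ≠ 0 → 0 < Q v v) (hV : V₁ ⊓ V₂ = ⊥) (hr : 0 < r) (hr' : 0 < r')
    (hT : Family (Metric.ball 0 r) (affineOrder ℓ c) a T)
    (hT' : Family (Metric.ball 0 r') (affineOrder ℓ' c') a' T') (hint : IsIntegral r ℓ c a)
    (hint' : IsIntegral r' ℓ' c' a') (hw : ∀ v ∈ w, v ≠ 0) (hw' : ∀ v ∈ w', v ≠ 0)
    (hℓ : emb n ℓ ∈ V₁) (hℓ' : emb n' ℓ' ∈ V₂) :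
    quotientGerm Q w T * quotientGerm Q w' T' ∈ symbolGerms Q := by
  obtain ⟨n₁, h₁⟩ := exists_extension hpos ℓ
  obtain ⟨n₂, h₂⟩ := exists_extension hpos ℓ'
  obtain ⟨hm₁, k, hk, hdot⟩ := h₁ (max n₁ n₂) (le_max_left _ _)
  obtain ⟨hm₂, k', hk', hdot'⟩ := h₂ (max n₁ n₂) (le_max_right _ _)
  have hF := (hT.restr hm₁ hdot).subset (Metric.ball_subset_ball (min_le_left r r'))
  have hF' := (hT'.restr hm₂ hdot').subset (Metric.ball_subset_ball (min_le_right r r'))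
  have hI := (hint.restr hm₁ hk).subset (min_le_left r r')
  have hI' := (hint'.restr hm₂ hk').subset (min_le_right r r')
  have hmul := (hF.mul (bddFun_affineOrder _ _ _) (bddFun_affineOrder _ _ _) hF').congr_order
    (α' := affineOrder (k + k') (c + c')) fun y _ => by
      rw [affineOrder_eq, affineOrder_eq, affineOrder_eq, dot_add_left]
      push_cast
      ring
  -- If the linear parts cancel, each is minus the other and so lies in `V₁ ⊓ V₂`, which is zero.
  have hzero : k + k' = 0 → k = 0 ∧ k' = 0 := by
    intro h
    have h1 : k = -k' := eq_neg_of_add_eq_zero_left h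
    have h2 : emb _ k ∈ V₁ ⊓ V₂ := by
      refine ⟨by rw [hk]; exact hℓ, ?_⟩
      rw [h1, map_neg, hk']
      exact V₂.neg_mem hℓ'
    rw [hV, Submodule.mem_bot, emb_eq_zero] at h2
    refine ⟨h2, ?_⟩
    rwa [h2, zero_add] at h
  have hmem := quotientGerm_mem (Q := Q) (lt_min hr hr') hmul (hI.antidiagonal hI' hzero)
    (w := w ++ w') fun v hv => (List.mem_append.1 hv).elim (hw v) (hw' v)
  convert hmem using 1
  refine Germ.coe_eq.2 (Eventually.of_forall fun z => ?_)
  ext x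
  change (((w.map fun v => linForm Q v z).prod)⁻¹ * T (coords Q n z) x) *
      (((w'.map fun v => linForm Q v z).prod)⁻¹ * T' (coords Q n' z) x) =
    (((w ++ w').map fun v => linForm Q v z).prod)⁻¹ *
      (T (coords Q n z) x * T' (coords Q n' z) x)
  rw [List.map_append, List.prod_append, mul_inv]
  exact mul_mul_mul_comm _ _ _ _

theorem real_smul_mul (s : ℝ) (σ τ : FunGerm Q) : (s • σ) * τ = s • (σ * τ) := by
  induction σ using Germ.inductionOn with | _ f
  induction τ using Germ.inductionOn with | _ g
  exact congrArg Germ.ofFun (smul_mul_assoc s f g)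

theorem mul_mem_of_mem_spanIn (hpos : ∀ v, v ≠ 0 → 0 < Q v v) (hV : V₁ ⊓ V₂ = ⊥)
    (hσ : σ ∈ spanIn Q V₁) (hτ : τ ∈ spanIn Q V₂) : σ * τ ∈ symbolGerms Q := by
  induction hσ using Submodule.span_induction with
  | zero => rw [zero_mul]; exact Submodule.zero_mem _
  | add σ σ' _ _ h h' => rw [add_mul]; exact Submodule.add_mem _ h h'
  | smul s σ _ h => rw [real_smul_mul]; exact Submodule.smul_mem _ s h
  | mem σ hσ =>
    obtain ⟨n, r, ℓ, c, a, T, w, hr, hT, hint, hw, hℓ, rfl⟩ := hσ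
    induction hτ using Submodule.span_induction with
    | zero => rw [mul_zero]; exact Submodule.zero_mem _
    | add τ τ' _ _ h h' => rw [mul_add]; exact Submodule.add_mem _ h h'
    | smul s τ _ h =>
      rw [mul_comm, real_smul_mul, mul_comm τ]
      exact Submodule.smul_mem _ s h
    | mem τ hτ =>
      obtain ⟨n', r', ℓ', c', a', T', w', hr', hT', hint', hw', hℓ', rfl⟩ := hτ
      exact quotientGerm_mul_mem hpos hV hr hr' hT hT' hint hint' hw hw' hℓ hℓ'

/-- Products of independent germs of symbols are germs of symbols. -/
theorem mul_mem_symbolGerms (hpos : ∀ v, v ≠ 0 → 0 < Q v v) (hσ : σ ∈ symbolGerms Q)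
    (hτ : τ ∈ symbolGerms Q) (h : perp Q σ τ) : σ * τ ∈ symbolGerms Q := by
  obtain ⟨hV₁, h₁⟩ := dependsOn_dep hpos (exists_dependsOn hσ)
  obtain ⟨hV₂, h₂⟩ := dependsOn_dep hpos (exists_dependsOn hτ)
  refine mul_mem_of_mem_spanIn hpos ?_ (mem_spanIn hpos hσ hV₁ h₁) (mem_spanIn hpos hτ hV₂ h₂)
  refine (Submodule.eq_bot_iff _).2 fun v hv => ?_
  by_contra hv0
  -- A vector in both dependence spaces is orthogonal to itself.
  exact (hpos v hv0).ne' (h v hv.1 v hv.2)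

theorem eventually_summation_nat {lam : ℤ} (hlam : lam = 1 ∨ lam = -1)
    (s : (ℕ →₀ ℂ) → NNReal → ℂ) (hs : (s : FunGerm Q) ∈ symbolGerms Q) :
    ∀ᶠ z in genericNhds Q, ∀ n : ℕ, 1 ≤ n →
      summation lam (s z) n = discreteSum lam (s z) n := by
  obtain ⟨m, hm⟩ := exists_eventually_isSym hs
  exact (Germ.liftPred_coe.1 hm).mono fun z hz n hn => hz.summation_nat hlam n hn

end Product

end Locality

end

/-! ### Assembly of the analytic and the algebraic parts -/

theorem mainTheorem5 (Q : LinearMap.BilinForm ℝ (ℕ →₀ ℝ)) (hsymm : ∀ u v, Q u v = Q v u)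
    (hpos : ∀ v, v ≠ 0 → 0 < Q v v) (lam : ℤ) (hlam : lam = 1 ∨ lam = -1) :
    -- `(Ω, ⊥^Q)` and `(ℝ𝓕_{Ω,⊥^Q}, ⊤)` are commutative unital locality algebras
    Locality.IsUnitalLocalityAlgebra (Locality.symbolGerms Q) (Locality.perp Q) ∧
    Locality.IsUnitalLocalityAlgebra (Locality.properForests (Locality.perpΩ Q))
      (Locality.forestRel (Locality.perpΩ Q)) ∧
    -- `𝔖_λ` is a linear map from `Ω` to `Ω`, independent of the identity, interpolating the sums
    (∃ S : Locality.symbolGerms Q →ₗ[ℝ] Locality.symbolGerms Q,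
      (∀ σ, (S σ : Locality.FunGerm Q) = Locality.summationGerm Q lam σ) ∧
      (∀ σ τ, Locality.perpΩ Q σ τ → Locality.perpΩ Q (S σ) τ)) ∧
    (∀ s : (ℕ →₀ ℂ) → NNReal → ℂ, (s : Locality.FunGerm Q) ∈ Locality.symbolGerms Q →
      ∀ᶠ z in Locality.genericNhds Q, ∀ n : ℕ, 1 ≤ n →
        Locality.summation lam (s z) n = Locality.discreteSum lam (s z) n) ∧
    -- the branched map takes its values in `Ω`, is a locality algebra homomorphism, and is the
    -- unique morphism of operated locality algebras lifting `𝔖_λ`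
    ∃ S_hat : Locality.properForests (Locality.perpΩ Q) →ₗ[ℝ] Locality.symbolGerms Q,
      (∀ (F : Locality.Forest (Locality.symbolGerms Q)), F.IsProper (Locality.perpΩ Q) →
        ∀ hF : MonoidAlgebra.single F 1 ∈ Locality.properForests (Locality.perpΩ Q),
          (S_hat ⟨MonoidAlgebra.single F 1, hF⟩ : Locality.FunGerm Q) =
            F.lift (Locality.summationAction Q lam)) ∧
      Locality.IsLocalityAlgHom (Locality.forestRel (Locality.perpΩ Q)) (Locality.perp Q) S_hat ∧
      Locality.IsOperatedMorphism (Locality.perpΩ Q) (Locality.perp Q)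
        (Locality.summationAction Q lam) S_hat ∧
      ∀ f : Locality.properForests (Locality.perpΩ Q) →ₗ[ℝ] Locality.symbolGerms Q,
        Locality.IsOperatedMorphism (Locality.perpΩ Q) (Locality.perp Q)
          (Locality.summationAction Q lam) f → f = S_hat := by
  have hΩ := Locality.isUnitalLocalityAlgebra_symbolGerms hpos hsymm Locality.one_mem_symbolGerms
    fun σ hσ τ hτ h => Locality.mul_mem_symbolGerms hpos hσ hτ h
  have hrel : ∀ σ τ : Locality.symbolGerms Q, Locality.perpΩ Q σ τ →
      Locality.perpΩ Q (Locality.summationMap Q lam σ) τ := fun σ _ h =>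
    Locality.perp_map hpos (Locality.summation lam) σ.2 h
  refine ⟨hΩ, Locality.isUnitalLocalityAlgebra_properForests fun _ _ h =>
    Locality.perp_symm hsymm h, ⟨Locality.summationMap Q lam, fun _ => rfl, hrel⟩,
    fun s hs => Locality.eventually_summation_nat hlam s hs, ?_⟩
  exact Locality.exists_branched (S := Locality.summationMap Q lam)
    (s := Locality.summationGerm Q lam) Locality.real_smul_mul hΩ (fun _ => rfl) hrel
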